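/- Let $D=[0,2]$ with periodic boundary conditions (all functions of $x$ are $2$-periodic, $\|\cdot\|$ is the norm of $L^2(0,2)$), let $T>0$, $0<\alpha\le 1$, $0<\gamma\le 1$, $K\in\mathbb R$, and let $a$ be $2$-periodic, $\alpha$-Hölder continuous, with $0<\underline a\le a(x)\le\overline a<\infty$ for all $x$. For a periodic function $w$ put $\nu_x^2(w,\sigma)=\sup_{|\delta|\le\sigma}\int_D|w(x+\delta)-w(x)|^2\,dx$. For $u_0,v_0\in L^2(D)$ let $(u,v)\in C([0,T];L^2(D))^2$ be the weak solution of $$u_t-v_x=0,\qquad \tfrac1{a(x)}v_t-u_x=0,\qquad u(0,\cdot)=u_0,\quad v(0,\cdot)=v_0 .$$ For $\Delta x=2/N_x$ and $\Delta t=T/N$ ($N_x,N$ positive integers), let $a_j,u_j^0,v_j^0$ be the means of $a,u_0,v_0$ over the cell $[(j-1)\Delta x,j\Delta x)$, $j\in\mathbb Z$, assume the CFL condition $2\Delta t\max_j\max\{2a_j+1,\ a_j/4+5/4\}\le\Delta x$, and define $u_j^n,v_j^n$ for $n\ge0$ by the viscous centered scheme $$\frac{u_j^{n+1}-u_j^n}{\Delta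 t}=\frac{v_{j+1}^n-v_{j-1}^n}{2\Delta x}+\frac{\Delta x}{2}\,\frac{u_{j+1}^n-2u_j^n+u_{j-1}^n}{\Delta x^2},\qquad \frac{v_j^{n+1}-v_j^n}{a_j\,\Delta t}=\frac{u_{j+1}^n-u_{j-1}^n}{2\Delta x}+\frac{\Delta x}{2}\,\frac{v_{j+1}^n-2v_j^n+v_{j-1}^n}{\Delta x^2}.$$ Let $(u_{\Delta x},v_{\Delta x})(t,x)=(u_j^n,v_j^n)$ for $(t,x)\in[n\Delta t,(n+1)\Delta t)\times[(j-1)\Delta x,j\Delta x)$. Assume that for all $t\in(0,T)$ $$\nu_x^2(u(t,\cdot),\sigma)\le K\sigma^{2\gamma},\qquad \nu_x^2(v(t,\cdot),\sigma)\le K\sigma^{2\gamma}\qquad\text{for all }\sigma>0,$$ and that for all $t\in(0,T)$ $$\nu_x^2(u_{\Delta x}(t,\cdot),\sigma)\le K\sigma^{2\gamma},\qquad \nu_x^2(v_{\Delta x}(t,\cdot),\sigma)\le K\sigma^{2\gamma}$$ for all $\sigma>0$; if $\gamma(1-\alpha)\le\frac12$, these last two bounds are only required for $\sigma\ge\Delta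 x$. Then for all $t\in(0,T)$ $$\|(u-u_{\Delta x})(t,\cdot)\|+\Big\|\tfrac{(v-v_{\Delta x})(t,\cdot)}{a}\Big\|\le C\Big(\|u_0-u_{\Delta x}(0,\cdot)\|+\Big\|\tfrac{v_0-v_{\Delta x}(0,\cdot)}{a}\Big\|+\Delta x^{\frac{\alpha\gamma}{2(\alpha\gamma+1-\gamma)}}\Big),$$ where $C$ depends only on $a$, $T$, $\alpha$, $\gamma$ and $K$, not on $\Delta x$, $\Delta t$, the data or the solution. (For $\gamma=1$ the exponent is $\frac12$.) Moreover, along any sequence of such meshes with $\Delta x\to0$ for which the assumptions hold with the same $K$, $u_{\Delta x}(t,\cdot)\to u(t,\cdot)$ and $v_{\Delta x}(t,\cdot)\to v(t,\cdot)$ in $L^2(D)$ for every $t\in(0,T)$. -/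

import Mathlib

open Set Filter Topology MeasureTheory
open scoped NNReal ENNReal ContDiff

noncomputable section

namespace Wave1D

/-! The spatial domain is the interval `[0,2]` with periodic boundary conditions: functions of `x`
are functions `ℝ → ℝ` of period `2`, and integrals run over one period. -/

/-- Lebesgue measure on one period. -/
def period : Measure ℝ := volume.restrict (Ioc (0 : ℝ) 2)

/-- `w ∈ L²(D)`, with `D = [0,2]` periodic. -/
def IsPeriodicL2 (w : ℝ → ℝ) : Prop :=
  Function.Periodic w 2 ∧ MemLp w 2 period

/-- The norm of `L²(D)` (used only for functions of class `L²(D)`). -/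
def norm2 (w : ℝ → ℝ) : ℝ := Real.sqrt (∫ x in (0 : ℝ)..2, w x ^ 2)

/-- The squared `L²` modulus of continuity in space,
`ν²(w, σ) = sup_{|δ| ≤ σ} ∫_D |w(x + δ) - w(x)|² dx`, with values in `[0, ∞]`. -/
def modulusSq (w : ℝ → ℝ) (σ : ℝ) : ℝ≥0∞ :=
  ⨆ δ ∈ Icc (-σ) σ, ∫⁻ x, ENNReal.ofReal (|w (x + δ) - w x| ^ 2) ∂period

/-- `ν²(w, σ) ≤ K σ^{2γ}` for all `σ > 0` with `σ ≥ σ₀`. For `σ₀ = 0` this is the modulus of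
continuity of order `γ`; for `σ₀ > 0` it is that modulus down to the scale `σ₀`. -/
def HasModulus (γ K σ₀ : ℝ) (w : ℝ → ℝ) : Prop :=
  ∀ σ : ℝ, 0 < σ → σ₀ ≤ σ → modulusSq w σ ≤ ENNReal.ofReal (K * σ ^ (2 * γ))

/-- Smooth test functions, periodic in space, that vanish for times near `T` and after `T`.
They need not vanish at time `0`. -/
structure IsTestFunction (T : ℝ) (φ : ℝ → ℝ → ℝ) : Prop where
  smooth : ContDiff ℝ ∞ (fun p : ℝ × ℝ => φ p.1 p.2)
  periodic : ∀ t, Function.Periodic (φ t) 2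
  vanish : ∃ T' < T, ∀ t, T' ≤ t → ∀ x, φ t x = 0

/-- `w ∈ C([0,T]; L²(D))`. -/
def IsContinuousL2 (T : ℝ) (w : ℝ → ℝ → ℝ) : Prop :=
  (∀ t ∈ Icc 0 T, IsPeriodicL2 (w t)) ∧
  ∀ t ∈ Icc 0 T, Tendsto (fun s => norm2 (w s - w t)) (𝓝[Icc 0 T] t) (𝓝 0)

/-- `(u, v)` is the weak solution in `C([0,T]; L²(D))²` of
`u_t - v_x = 0`, `v_t / a - u_x = 0`, `u(0) = u₀`, `v(0) = v₀`, periodic in space. -/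
structure IsWeakSolution (a : ℝ → ℝ) (T : ℝ) (u₀ v₀ : ℝ → ℝ) (u v : ℝ → ℝ → ℝ) : Prop where
  continuous_u : IsContinuousL2 T u
  continuous_v : IsContinuousL2 T v
  eq_u : ∀ φ : ℝ → ℝ → ℝ, IsTestFunction T φ →
    (∫ t in (0 : ℝ)..T, ∫ x in (0 : ℝ)..2,
        (u t x * deriv (fun s => φ s x) t - v t x * deriv (φ t) x))
      + ∫ x in (0 : ℝ)..2, u₀ x * φ 0 x = 0
  eq_v : ∀ φ : ℝ → ℝ → ℝ, IsTestFunction T φ →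
    (∫ t in (0 : ℝ)..T, ∫ x in (0 : ℝ)..2,
        (v t x / a x * deriv (fun s => φ s x) t - u t x * deriv (φ t) x))
      + ∫ x in (0 : ℝ)..2, v₀ x / a x * φ 0 x = 0

/-- The mean of `f` over the `j`-th cell `[(j-1)Δx, jΔx)`, `j ∈ ℤ`. -/
def cellMean (Δx : ℝ) (f : ℝ → ℝ) (j : ℤ) : ℝ :=
  (1 / Δx) * ∫ x in (((j : ℝ) - 1) * Δx)..((j : ℝ) * Δx), f x

/-- Forward difference quotient in space. -/
def Dplus (Δx : ℝ) (w : ℤ → ℝ) (j : ℤ) : ℝ := (w (j + 1) - w j) / Δx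

/-- Backward difference quotient in space. -/
def Dminus (Δx : ℝ) (w : ℤ → ℝ) (j : ℤ) : ℝ := (w j - w (j - 1)) / Δx

/-- Centered difference quotient in space. -/
def Dcent (Δx : ℝ) (w : ℤ → ℝ) (j : ℤ) : ℝ := (w (j + 1) - w (j - 1)) / (2 * Δx)

/-- The grid values `(u_j^n, v_j^n)` of the viscous centered scheme
`D_t^+ u_j^n = D^c v_j^n + (Δx/2) D^+ D^- u_j^n`,
`D_t^+ v_j^n / a_j = D^c u_j^n + (Δx/2) D^+ D^- v_j^n`,
started from the cell means of `u₀` and `v₀`; `a_j` is the cell mean of `a`. The index `j` runs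
over `ℤ`; all grid functions inherit the periodicity of `a`, `u₀`, `v₀`. -/
def scheme (a u₀ v₀ : ℝ → ℝ) (Δx Δt : ℝ) : ℕ → (ℤ → ℝ) × (ℤ → ℝ)
  | 0 => (cellMean Δx u₀, cellMean Δx v₀)
  | n + 1 =>
    let U := (scheme a u₀ v₀ Δx Δt n).1
    let V := (scheme a u₀ v₀ Δx Δt n).2
    (fun j => U j + Δt * (Dcent Δx V j + Δx / 2 * Dplus Δx (Dminus Δx U) j),
     fun j => V j + Δt * (cellMean Δx a j *
        (Dcent Δx U j + Δx / 2 * Dplus Δx (Dminus Δx V) j)))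

/-- The piecewise constant approximation `u_Δx`: it equals `u_j^n` on
`[nΔt, (n+1)Δt) × [(j-1)Δx, jΔx)`. -/
def uApprox (a u₀ v₀ : ℝ → ℝ) (Δx Δt t x : ℝ) : ℝ :=
  (scheme a u₀ v₀ Δx Δt ⌊t / Δt⌋₊).1 (⌊x / Δx⌋ + 1)

/-- The piecewise constant approximation `v_Δx`. -/
def vApprox (a u₀ v₀ : ℝ → ℝ) (Δx Δt t x : ℝ) : ℝ :=
  (scheme a u₀ v₀ Δx Δt ⌊t / Δt⌋₊).2 (⌊x / Δx⌋ + 1)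

/-- Admissible meshes: `Nx` cells of size `Δx` fill the period, `N` steps of size `Δt` fill
`[0,T]`, and the CFL condition `2 Δt max_j max {2 a_j + 1, a_j/4 + 5/4} ≤ Δx` holds. -/
structure IsMesh (a : ℝ → ℝ) (T : ℝ) (Nx N : ℕ) (Δx Δt : ℝ) : Prop where
  dx_pos : 0 < Δx
  dt_pos : 0 < Δt
  fill_space : Nx * Δx = 2
  fill_time : N * Δt = T
  cfl : ∀ j : ℤ,
    2 * Δt * max (2 * cellMean Δx a j + 1) (cellMean Δx a j / 4 + 5 / 4) ≤ Δx

/-- The smallest scale on which the modulus of continuity of the piecewise constant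
approximations is required: the mesh size if `γ (1 - α) ≤ 1/2`, and no restriction otherwise. -/
def minScale (α γ Δx : ℝ) : ℝ := if γ * (1 - α) ≤ 1 / 2 then Δx else 0

/-- The error `‖(u - u_Δx)(t)‖ + ‖(v - v_Δx)(t) / a‖` at time `t` against `p = u(t)`,
`q = v(t)`. -/
def errorAt (a u₀ v₀ : ℝ → ℝ) (Δx Δt t : ℝ) (p q : ℝ → ℝ) : ℝ :=
  norm2 (fun x => p x - uApprox a u₀ v₀ Δx Δt t x) +
    norm2 (fun x => (q x - vApprox a u₀ v₀ Δx Δt t x) / a x)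

end Wave1D

end

/-! The scheme is compared not with the exact solution itself but with time averages, over windows
of length τ, of the cell means of the exact solution. Put b = 1/a and let h be the mesh size, so
that the system reads u_t = v_x, (b v)_t = u_x.

Time regularity. A spatial modulus of order γ for both components gives the same order in time
(`IsWeakPair.sqNorm_increment_le`, `exists_time_holder`): the increment of b f over [s,t] is tested
against the increment of f, on an auxiliary mesh of size comparable to t − s.

Consistency. For w_t = z_x let P be the spatial primitive of w(t) − w(s). Then P minus the time
integral of z is constant in x, so differences of cell means of P are time integrals of differences
of cell means of z (`IsWeakPair.flux`). Writing each nodal value of P as the average of the two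
adjacent cell means plus a defect puts the exact evolution of cell means into centered form
(`IsWeakPair.cellMean_sub_eq`). No point values of z occur, and the defects are controlled by ‖w(t)
− w(s)‖. After averaging over τ, the exact solution satisfies the scheme up to differences of flux
residuals R, S with ∑(R² + S²) of order h τ^(2γ−2), and a source c, due to replacing a by its cell
means, with h∑c² of order h^(2α) τ^(2γ−2) (`IsWeakPair.exists_flux_residual`,
`IsHolderSolution.consistency`). The artificial viscosity is one of the flux residuals and is
bounded through the same flux identity.

Stability. Under the CFL condition a tenth of the numerical viscosity survives the explicit time
step (`energy_balance_cell`). It absorbs the flux residuals after summation by parts, and a discrete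
Grönwall argument follows (`IsHolderSolution.gridEnergy_iterate`, `IsHolderSolution.gridDist_le`).
The squared error is thus of order τ^(2γ) + (h + h^(2α)) τ^(2γ−2), plus the discrete initial error.
With τ proportional to h^s, s ≤ 1/2 and s ≤ α, this is h^(2sγ) (`exists_error_bound`); for data
projected to cell means the discrete initial error is zero.

The exponent. The claimed rate is h^(sγ) with s = α / (2(αγ + 1 − γ)). Always s ≤ 1/2, while s ≤ α
holds exactly when γ(1 − α) ≤ 1/2. In the other case γ > 1/2, and a modulus of this order at all
scales admits only constant step functions (`HasModulus.stepFn_const`). The scheme is then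
stationary, the data are within O(h^γ) of constants, and stability of constant states
(`exists_const_stability`) gives the better rate h^γ. That stability itself comes from the error
bound, applied to constant grid solutions on meshes refined to zero. -/

noncomputable section

namespace Wave1D

/-! ### Locally square integrable functions -/

/-- Measurable functions on the line that are square integrable on bounded intervals. -/
structure IsLocL2 (f : ℝ → ℝ) : Prop where
  meas : AEStronglyMeasurable f volume
  sq : ∀ a b : ℝ, IntervalIntegrable (fun x => f x ^ 2) volume a b

namespace IsLocL2

variable {f g : ℝ → ℝ}

theorem mul_integrable (hf : IsLocL2 f) (hg : IsLocL2 g) (a b : ℝ) :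
    IntervalIntegrable (fun x => f x * g x) volume a b := by
  refine ((hf.sq a b).add (hg.sq a b)).mono_fun (hf.meas.mul hg.meas).restrict ?_
  refine Eventually.of_forall fun x => ?_
  simp only [Real.norm_eq_abs]
  rw [abs_mul, abs_of_nonneg (by positivity : (0 : ℝ) ≤ f x ^ 2 + g x ^ 2),
    ← sq_abs (f x), ← sq_abs (g x)]
  nlinarith [sq_nonneg (|f x| - |g x|), sq_nonneg (|f x|), sq_nonneg (|g x|)]

theorem of_bound (hf : AEStronglyMeasurable f volume) {C : ℝ} (hC : ∀ x, |f x| ≤ C) :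
    IsLocL2 f := by
  refine ⟨hf, fun a b => ?_⟩
  have hc : IntervalIntegrable (fun _ : ℝ => C ^ 2) volume a b := by simp
  refine hc.mono_fun (hf.pow 2).restrict (Eventually.of_forall fun x => ?_)
  simp only [Real.norm_eq_abs, abs_pow, sq_abs]
  rw [← sq_abs]
  have h0 := abs_nonneg (f x)
  exact pow_le_pow_left₀ h0 (hC x) 2

theorem const (c : ℝ) : IsLocL2 (fun _ => c) :=
  of_bound aestronglyMeasurable_const (C := |c|) fun _ => le_rfl

theorem of_continuous (hf : Continuous f) : IsLocL2 f :=
  ⟨hf.aestronglyMeasurable, fun a b => (hf.pow 2).intervalIntegrable a b⟩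

theorem integrable (hf : IsLocL2 f) (a b : ℝ) : IntervalIntegrable f volume a b := by
  simpa using hf.mul_integrable (const 1) a b

theorem add (hf : IsLocL2 f) (hg : IsLocL2 g) : IsLocL2 (fun x => f x + g x) := by
  refine ⟨hf.meas.add hg.meas, fun a b => ?_⟩
  have h := ((hf.sq a b).add (hg.sq a b)).add ((hf.mul_integrable hg a b).const_mul 2)
  exact h.congr fun x _ => by ring

theorem mul_bound (hf : IsLocL2 f) (hg : AEStronglyMeasurable g volume) {C : ℝ}
    (hC : ∀ x, |g x| ≤ C) : IsLocL2 (fun x => g x * f x) := by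
  refine ⟨hg.mul hf.meas, fun a b => ?_⟩
  refine ((hf.sq a b).const_mul (C ^ 2)).mono_fun ((hg.mul hf.meas).pow 2).restrict
    (Eventually.of_forall fun x => ?_)
  simp only [Real.norm_eq_abs, abs_pow, abs_mul, mul_pow, sq_abs]
  have h0 := abs_nonneg (g x)
  have := pow_le_pow_left₀ h0 (hC x) 2
  rw [sq_abs] at this
  gcongr

theorem const_mul (hf : IsLocL2 f) (c : ℝ) : IsLocL2 (fun x => c * f x) :=
  hf.mul_bound (g := fun _ => c) aestronglyMeasurable_const fun _ => le_refl |c|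

theorem sub (hf : IsLocL2 f) (hg : IsLocL2 g) : IsLocL2 (fun x => f x - g x) := by
  have := hf.add (hg.const_mul (-1))
  refine (congrArg IsLocL2 (funext fun x => ?_)).mp this
  ring

theorem comp_add_right (hf : IsLocL2 f) (d : ℝ) : IsLocL2 (fun x => f (x + d)) := by
  refine ⟨hf.meas.comp_measurePreserving (measurePreserving_add_right volume d), fun a b => ?_⟩
  simpa using (hf.sq (a + d) (b + d)).comp_add_right d

end IsLocL2

/-- Measurability is given on one period only. Periodicity carries integrability to every bounded
interval, and a countable cover by such intervals glues the measurability. -/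
theorem IsPeriodicL2.isLocL2 {w : ℝ → ℝ} (hw : IsPeriodicL2 w) : IsLocL2 w := by
  obtain ⟨hp, hm⟩ := hw
  have h1 : IntervalIntegrable w volume 0 2 := by
    rw [intervalIntegrable_iff_integrableOn_Ioc_of_le (by norm_num)]
    have : IsFiniteMeasure period := by unfold period; infer_instance
    exact hm.integrable (by norm_num)
  have h2 : IntervalIntegrable (fun x => w x ^ 2) volume 0 2 := by
    rw [intervalIntegrable_iff_integrableOn_Ioc_of_le (by norm_num)]
    exact hm.integrable_sq
  have h3 := hp.intervalIntegrable₀ (by norm_num) h1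
  have hp2 : Function.Periodic (fun x => w x ^ 2) 2 := fun x => by simp only [hp x]
  refine ⟨?_, hp2.intervalIntegrable₀ (by norm_num) h2⟩
  have hcov : (⋃ n : ℕ, Ioc (-(n : ℝ)) n) = univ := by
    refine eq_univ_of_forall fun x => mem_iUnion.2 ?_
    obtain ⟨n, hn⟩ := exists_nat_gt |x|
    exact ⟨n, (abs_lt.1 hn).1, (abs_lt.1 hn).2.le⟩
  rw [← Measure.restrict_univ (μ := (volume : Measure ℝ)), ← hcov,
    aestronglyMeasurable_iUnion_iff]
  intro n
  exact (h3 (-(n : ℝ)) n).aestronglyMeasurable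

/-- The Cauchy-Schwarz inequality against the constant `1`. -/
theorem sq_integral_le {f : ℝ → ℝ} {a b : ℝ} (hf : IntervalIntegrable f volume a b)
    (hf2 : IntervalIntegrable (fun x => f x ^ 2) volume a b) (hab : a ≤ b) :
    (∫ x in a..b, f x) ^ 2 ≤ (b - a) * ∫ x in a..b, f x ^ 2 := by
  rcases hab.eq_or_lt with rfl | hlt
  · simp
  -- The inequality is the nonnegativity of the variance about the mean `m`.
  set m := (∫ x in a..b, f x) / (b - a) with hm
  have hpos : 0 < b - a := by linarith
  have h0 : 0 ≤ ∫ x in a..b, (f x - m) ^ 2 :=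
    intervalIntegral.integral_nonneg hab fun x _ => sq_nonneg _
  have h1 : ∫ x in a..b, (f x - m) ^ 2
      = (∫ x in a..b, f x ^ 2) - 2 * m * (∫ x in a..b, f x) + m ^ 2 * (b - a) := by
    have : ∀ x, (f x - m) ^ 2 = f x ^ 2 - 2 * m * f x + m ^ 2 := fun x => by ring
    simp only [this]
    rw [intervalIntegral.integral_add (hf2.sub (hf.const_mul _)) (by simp),
      intervalIntegral.integral_sub hf2 (hf.const_mul _),
      intervalIntegral.integral_const_mul, intervalIntegral.integral_const, smul_eq_mul]
    ring
  have h2 : (∫ x in a..b, f x) = m * (b - a) := by rw [hm]; field_simp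
  rw [h1, h2] at h0
  rw [h2]
  nlinarith

theorem IsLocL2.sq_integral_le {f : ℝ → ℝ} (hf : IsLocL2 f) {a b : ℝ} (hab : a ≤ b) :
    (∫ x in a..b, f x) ^ 2 ≤ (b - a) * ∫ x in a..b, f x ^ 2 :=
  Wave1D.sq_integral_le (hf.integrable a b) (hf.sq a b) hab

/-! ### The squared norm -/

/-- The squared norm of `L²(D)`. -/
def sqNorm (f : ℝ → ℝ) : ℝ := ∫ x in (0 : ℝ)..2, f x ^ 2

theorem sqNorm_nonneg (f : ℝ → ℝ) : 0 ≤ sqNorm f :=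
  intervalIntegral.integral_nonneg (by norm_num) fun x _ => sq_nonneg _

theorem norm2_eq_sqrt (f : ℝ → ℝ) : norm2 f = Real.sqrt (sqNorm f) := rfl

theorem norm2_sq (f : ℝ → ℝ) : norm2 f ^ 2 = sqNorm f := Real.sq_sqrt (sqNorm_nonneg f)

theorem sqNorm_mono {f g : ℝ → ℝ} (hf : IsLocL2 f) (hg : IsLocL2 g) (c : ℝ)
    (h : ∀ x, f x ^ 2 ≤ c * g x ^ 2) : sqNorm f ≤ c * sqNorm g := by
  unfold sqNorm
  rw [← intervalIntegral.integral_const_mul]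
  exact intervalIntegral.integral_mono_on (by norm_num) (hf.sq 0 2) ((hg.sq 0 2).const_mul c)
    fun x _ => h x

theorem sqNorm_add_le {f g : ℝ → ℝ} (hf : IsLocL2 f) (hg : IsLocL2 g) :
    sqNorm (fun x => f x + g x) ≤ 2 * sqNorm f + 2 * sqNorm g := by
  unfold sqNorm
  rw [← intervalIntegral.integral_const_mul, ← intervalIntegral.integral_const_mul,
    ← intervalIntegral.integral_add ((hf.sq 0 2).const_mul 2) ((hg.sq 0 2).const_mul 2)]
  refine intervalIntegral.integral_mono_on (by norm_num) ((hf.add hg).sq 0 2)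
    (((hf.sq 0 2).const_mul 2).add ((hg.sq 0 2).const_mul 2)) fun x _ => ?_
  nlinarith [sq_nonneg (f x - g x)]

theorem sqNorm_sub_comm (f g : ℝ → ℝ) :
    sqNorm (fun x => f x - g x) = sqNorm (fun x => g x - f x) := by
  unfold sqNorm
  congr 1
  funext x
  ring

theorem sqNorm_triangle {f g k : ℝ → ℝ} (hf : IsLocL2 f) (hg : IsLocL2 g) (hk : IsLocL2 k) :
    sqNorm (fun x => f x - k x) ≤
      2 * sqNorm (fun x => f x - g x) + 2 * sqNorm (fun x => g x - k x) := by
  have := sqNorm_add_le (hf.sub hg) (hg.sub hk)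
  simpa using this

/-! ### Sums over the cells of one period -/

/-- The sum of a grid function over one period. -/
def cellSum (n : ℕ) (f : ℤ → ℝ) : ℝ := ∑ i ∈ Finset.range n, f i

/-- Grid functions of period `n`. -/
def IsGridPeriodic (n : ℕ) (f : ℤ → ℝ) : Prop := ∀ j, f (j + n) = f j

theorem cellSum_shift {n : ℕ} {f : ℤ → ℝ} (hf : IsGridPeriodic n f) :
    cellSum n (fun j => f (j + 1)) = cellSum n f := by
  unfold cellSum
  have h1 := Finset.sum_range_succ (fun i : ℕ => f (i : ℤ)) n
  have h2 := Finset.sum_range_succ' (fun i : ℕ => f (i : ℤ)) n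
  have h3 : f (n : ℤ) = f 0 := by simpa using hf 0
  push_cast at h1 h2
  linarith

theorem cellSum_shift_sub {n : ℕ} {f : ℤ → ℝ} (hf : IsGridPeriodic n f) :
    cellSum n (fun j => f (j - 1)) = cellSum n f := by
  have h : IsGridPeriodic n (fun j => f (j - 1)) := fun j => by
    have := hf (j - 1)
    simp only [← this]; congr 1; ring
  simpa using (cellSum_shift h).symm

theorem cellSum_mono {n : ℕ} {f g : ℤ → ℝ} (h : ∀ j, f j ≤ g j) : cellSum n f ≤ cellSum n g :=
  Finset.sum_le_sum fun i _ => h i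

theorem cellSum_nonneg {n : ℕ} {f : ℤ → ℝ} (h : ∀ j, 0 ≤ f j) : 0 ≤ cellSum n f :=
  Finset.sum_nonneg fun i _ => h i

theorem cellSum_add (n : ℕ) (f g : ℤ → ℝ) :
    cellSum n (fun j => f j + g j) = cellSum n f + cellSum n g := Finset.sum_add_distrib

theorem cellSum_sub (n : ℕ) (f g : ℤ → ℝ) :
    cellSum n (fun j => f j - g j) = cellSum n f - cellSum n g := Finset.sum_sub_distrib _ _

theorem cellSum_mul (n : ℕ) (c : ℝ) (f : ℤ → ℝ) :
    cellSum n (fun j => c * f j) = c * cellSum n f := (Finset.mul_sum _ _ _).symm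

theorem cellSum_integral {n : ℕ} {h : ℝ} (hn : n * h = 2) {f : ℝ → ℝ}
    (hp : Function.Periodic f 2) (hf : ∀ a b, IntervalIntegrable f volume a b) :
    cellSum n (fun j => ∫ x in (((j : ℝ) - 1) * h)..((j : ℝ) * h), f x)
      = ∫ x in (0 : ℝ)..2, f x := by
  unfold cellSum
  have := intervalIntegral.sum_integral_adjacent_intervals (f := f) (μ := volume)
    (a := fun i : ℕ => ((i : ℝ) - 1) * h) (n := n) (fun k _ => hf _ _)
  simp only [Nat.cast_add, Nat.cast_one, add_sub_cancel_right, Nat.cast_zero] at this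
  simp only [Int.cast_natCast]
  rw [this]
  -- For j = 0, …, n − 1 the cells fill [−h, 2 − h] instead of [0, 2]; periodicity moves the period.
  have h2 := hp.intervalIntegral_add_eq ((0 - 1) * h) 0
  rw [show (((n : ℝ) - 1) * h) = (0 - 1) * h + 2 by rw [← hn]; ring, h2]
  simp

theorem cellMean_periodic {n : ℕ} {h : ℝ} (hn : n * h = 2) {f : ℝ → ℝ}
    (hp : Function.Periodic f 2) : IsGridPeriodic n (cellMean h f) := by
  intro j
  unfold cellMean
  congr 1
  have : ∀ x, f x = f (x + 2) := fun x => (hp x).symm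
  conv_rhs => rw [intervalIntegral.integral_congr (fun x _ => this x)]
  rw [intervalIntegral.integral_comp_add_right (fun x => f x)]
  push_cast
  congr 1 <;> rw [← hn] <;> ring

theorem cellMean_integral {h : ℝ} (hh : 0 < h) (f : ℝ → ℝ) (j : ℤ) :
    ∫ x in (((j : ℝ) - 1) * h)..((j : ℝ) * h), f x = h * cellMean h f j := by
  unfold cellMean; field_simp

theorem cellMean_sub {h : ℝ} {f g : ℝ → ℝ} (hf : IsLocL2 f) (hg : IsLocL2 g)
    (j : ℤ) : cellMean h (fun x => f x - g x) j = cellMean h f j - cellMean h g j := by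
  unfold cellMean
  rw [intervalIntegral.integral_sub (hf.integrable _ _) (hg.integrable _ _)]
  ring

theorem cellMean_const_mul (h c : ℝ) (f : ℝ → ℝ) (j : ℤ) :
    cellMean h (fun x => c * f x) j = c * cellMean h f j := by
  unfold cellMean
  rw [intervalIntegral.integral_const_mul]
  ring

theorem cell_le {h : ℝ} (hh : 0 < h) (j : ℤ) : ((j : ℝ) - 1) * h ≤ (j : ℝ) * h := by nlinarith

/-- Jensen's inequality on a cell. -/
theorem sq_cellMean_le {h : ℝ} (hh : 0 < h) {f : ℝ → ℝ} (hf : IsLocL2 f) (j : ℤ) :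
    h * cellMean h f j ^ 2 ≤ ∫ x in (((j : ℝ) - 1) * h)..((j : ℝ) * h), f x ^ 2 := by
  have h1 := hf.sq_integral_le (cell_le hh j)
  rw [cellMean_integral hh, show (j : ℝ) * h - ((j : ℝ) - 1) * h = h by ring] at h1
  have : h * (h * cellMean h f j ^ 2) ≤
      h * ∫ x in (((j : ℝ) - 1) * h)..((j : ℝ) * h), f x ^ 2 := by linarith [h1]
  exact le_of_mul_le_mul_left this hh

theorem Periodic_sq {f : ℝ → ℝ} (hp : Function.Periodic f 2) :
    Function.Periodic (fun x => f x ^ 2) 2 := fun x => by simp only [hp x]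

theorem cellSum_sq_cellMean_le {n : ℕ} {h : ℝ} (hh : 0 < h) (hn : n * h = 2) {f : ℝ → ℝ}
    (hp : Function.Periodic f 2) (hf : IsLocL2 f) :
    cellSum n (fun j => h * cellMean h f j ^ 2) ≤ sqNorm f := by
  unfold sqNorm
  rw [← cellSum_integral hn (Periodic_sq hp) hf.sq]
  exact cellSum_mono fun j => sq_cellMean_le hh hf j

/-! ### Step functions -/

/-- The step function with value `U j` on the `j`-th cell. -/
def stepFn (h : ℝ) (U : ℤ → ℝ) (x : ℝ) : ℝ := U (⌊x / h⌋ + 1)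

theorem stepFn_measurable (h : ℝ) (U : ℤ → ℝ) : Measurable (stepFn h U) :=
  (measurable_from_top (f := U)).comp (((measurable_id.div_const h).floor).add_const 1)

theorem stepFn_periodic {n : ℕ} {h : ℝ} (hh : 0 < h) (hn : n * h = 2) {U : ℤ → ℝ}
    (hU : IsGridPeriodic n U) : Function.Periodic (stepFn h U) 2 := by
  intro x
  unfold stepFn
  rw [show (x + 2) / h = x / h + n by rw [← hn]; field_simp, Int.floor_add_natCast,
    show ⌊x / h⌋ + (n : ℤ) + 1 = ⌊x / h⌋ + 1 + n by ring]
  exact hU _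

theorem stepFn_eq {h : ℝ} (hh : 0 < h) (U : ℤ → ℝ) {j : ℤ} {x : ℝ}
    (hx : x ∈ Ico (((j : ℝ) - 1) * h) ((j : ℝ) * h)) : stepFn h U x = U j := by
  unfold stepFn
  have : ⌊x / h⌋ = j - 1 := by
    rw [Int.floor_eq_iff]
    push_cast
    exact ⟨by rw [le_div_iff₀ hh]; exact hx.1, by rw [div_lt_iff₀ hh]; linarith [hx.2]⟩
  rw [this]; simp

theorem mem_cell {h : ℝ} (hh : 0 < h) (x : ℝ) :
    x ∈ Ico (((((⌊x / h⌋ + 1 : ℤ)) : ℝ) - 1) * h) (((⌊x / h⌋ + 1 : ℤ) : ℝ) * h) := by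
  have h1 := Int.floor_le (x / h)
  have h2 := Int.lt_floor_add_one (x / h)
  rw [le_div_iff₀ hh] at h1
  rw [div_lt_iff₀ hh] at h2
  push_cast
  exact ⟨by linarith, by linarith⟩

theorem cell_integral_congr_stepFn {h : ℝ} (hh : 0 < h) (U : ℤ → ℝ) (F : ℝ → ℝ → ℝ) (j : ℤ) :
    ∫ x in (((j : ℝ) - 1) * h)..((j : ℝ) * h), F x (stepFn h U x)
      = ∫ x in (((j : ℝ) - 1) * h)..((j : ℝ) * h), F x (U j) := by
  apply intervalIntegral.integral_congr_ae
  -- Interval integrals include the right endpoint, where the step function already has its next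
  -- value; one point is null.
  have : ∀ᵐ x : ℝ, x ≠ (j : ℝ) * h := by simp [ae_iff]
  filter_upwards [this] with x hx hm
  rw [uIoc_of_le (cell_le hh j)] at hm
  rw [stepFn_eq hh U ⟨hm.1.le, lt_of_le_of_ne hm.2 hx⟩]

theorem IsGridPeriodic.bounded {n : ℕ} (hn : 0 < n) {U : ℤ → ℝ} (hU : IsGridPeriodic n U) :
    ∃ C, ∀ j, |U j| ≤ C := by
  refine ⟨∑ i ∈ Finset.range n, |U i|, fun j => ?_⟩
  have hz : ∀ (m : ℤ) (i : ℤ), U (i + m * n) = U i := by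
    intro m
    induction m using Int.induction_on with
    | zero => simp
    | succ k ih => intro i; rw [← ih i, ← hU (i + k * n)]; congr 1; ring
    | pred k ih => intro i; rw [← ih i, ← hU (i + (-k - 1) * n)]; congr 1; ring
  have h1 : U j = U ((j % n).toNat : ℤ) := by
    have hn' : (n : ℤ) ≠ 0 := by positivity
    rw [Int.toNat_of_nonneg (Int.emod_nonneg _ hn'), ← hz (j / n) (j % n)]
    congr 1
    have := Int.emod_add_mul_ediv j n
    linarith
  rw [h1]
  refine Finset.single_le_sum (f := fun i : ℕ => |U i|) (fun i _ => abs_nonneg _) ?_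
  rw [Finset.mem_range]
  have := Int.emod_lt_of_pos j (by exact_mod_cast hn : (0 : ℤ) < n)
  omega

theorem stepFn_isLocL2 {n : ℕ} (hn : 0 < n) (h : ℝ) {U : ℤ → ℝ}
    (hU : IsGridPeriodic n U) : IsLocL2 (stepFn h U) := by
  obtain ⟨C, hC⟩ := hU.bounded hn
  exact IsLocL2.of_bound (stepFn_measurable h U).aestronglyMeasurable fun x => hC _

theorem sqNorm_stepFn {n : ℕ} {h : ℝ} (hh : 0 < h) (hn : n * h = 2) (hn0 : 0 < n) {U : ℤ → ℝ}
    (hU : IsGridPeriodic n U) : sqNorm (stepFn h U) = cellSum n (fun j => h * U j ^ 2) := by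
  unfold sqNorm
  rw [← cellSum_integral hn (Periodic_sq (stepFn_periodic hh hn hU))
    (stepFn_isLocL2 hn0 h hU).sq]
  congr 1
  funext j
  rw [cell_integral_congr_stepFn hh U (fun _ y => y ^ 2)]
  simp only [intervalIntegral.integral_const, smul_eq_mul]
  ring

/-! ### The modulus of continuity on a mesh -/

theorem lintegral_ofReal_sq {f : ℝ → ℝ} (hf : IsLocL2 f) :
    ∫⁻ x, ENNReal.ofReal (|f x| ^ 2) ∂period = ENNReal.ofReal (sqNorm f) := by
  unfold sqNorm period
  rw [intervalIntegral.integral_of_le (by norm_num), ofReal_integral_eq_lintegral_ofReal]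
  · simp only [sq_abs]
  · have := hf.sq 0 2
    rwa [intervalIntegrable_iff_integrableOn_Ioc_of_le (by norm_num)] at this
  · exact Eventually.of_forall fun x => sq_nonneg _

/-- Passing to |K| makes the bound nonnegative, so it can later be read back from [0, ∞] to ℝ with
no assumption on the sign of K. -/
theorem HasModulus.lintegral_le {γ K σ₀ σ δ : ℝ} {w : ℝ → ℝ} (hm : HasModulus γ K σ₀ w)
    (hσ : 0 < σ) (hσ' : σ₀ ≤ σ) (hδ : |δ| ≤ σ) :
    ∫⁻ x, ENNReal.ofReal (|w (x + δ) - w x| ^ 2) ∂period ≤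
      ENNReal.ofReal (|K| * σ ^ (2 * γ)) := by
  refine (le_trans ?_ (hm σ hσ hσ')).trans (ENNReal.ofReal_le_ofReal ?_)
  · unfold modulusSq
    exact le_iSup₂ (f := fun δ (_ : δ ∈ Icc (-σ) σ) =>
      ∫⁻ x, ENNReal.ofReal (|w (x + δ) - w x| ^ 2) ∂period) δ (abs_le.1 hδ)
  · exact mul_le_mul_of_nonneg_right (le_abs_self K) (by positivity)

theorem HasModulus.sqNorm_le {γ K σ₀ σ δ : ℝ} {w : ℝ → ℝ} (hm : HasModulus γ K σ₀ w)
    (hw : IsLocL2 w) (hσ : 0 < σ) (hσ' : σ₀ ≤ σ) (hδ : |δ| ≤ σ) :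
    sqNorm (fun x => w (x + δ) - w x) ≤ |K| * σ ^ (2 * γ) := by
  have h := hm.lintegral_le hσ hσ' hδ
  rw [lintegral_ofReal_sq ((hw.comp_add_right δ).sub hw)] at h
  exact (ENNReal.ofReal_le_ofReal_iff (by positivity)).1 h

/-- The modulus of continuity controls the differences of adjacent cell means. -/
theorem HasModulus.cellSum_sq_diff_le {γ K h : ℝ} {n : ℕ} {w : ℝ → ℝ} (hm : HasModulus γ K 0 w)
    (hp : Function.Periodic w 2) (hw : IsLocL2 w) (hh : 0 < h) (hn : n * h = 2) :
    cellSum n (fun j => h * (cellMean h w (j + 1) - cellMean h w j) ^ 2)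
      ≤ |K| * h ^ (2 * γ) := by
  -- A shift by exactly one cell turns increments of w into differences of adjacent cell means; the
  -- rest is Jensen on each cell.
  have h1 := hm.sqNorm_le hw hh hh.le (abs_of_pos hh).le
  refine le_trans (le_of_eq ?_) ((cellSum_sq_cellMean_le hh hn (f := fun x => w (x + h) - w x)
    (fun x => by simp only [show x + 2 + h = x + h + 2 by ring, hp (x + h), hp x])
    ((hw.comp_add_right h).sub hw)).trans h1)
  congr 1
  funext j
  rw [cellMean_sub (hw.comp_add_right h) hw]
  congr 3
  unfold cellMean
  rw [intervalIntegral.integral_comp_add_right (fun x => w x)]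
  congr 2 <;> push_cast <;> ring

/-- The piecewise constant projection on the mesh. -/
def cellProj (h : ℝ) (w : ℝ → ℝ) : ℝ → ℝ := stepFn h (cellMean h w)

/-- The cell that contains x lies in [x − h, x + h], so Jensen bounds the deviation from the cell
mean by increments from x. The larger window no longer depends on the cell, which prepares the
exchange of integrals over x and δ. -/
theorem sq_sub_cellProj_le {h : ℝ} (hh : 0 < h) {w : ℝ → ℝ} (hw : IsLocL2 w) (x : ℝ) :
    (w x - cellProj h w x) ^ 2 ≤ (1 / h) * ∫ δ in (-h)..h, (w (x + δ) - w x) ^ 2 := by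
  set j : ℤ := ⌊x / h⌋ + 1 with hj
  have hx := mem_cell hh x
  rw [← hj] at hx
  have h1 : cellMean h (fun y => w y - w x) j = cellProj h w x - w x := by
    rw [cellMean_sub hw (IsLocL2.const (w x))]
    unfold cellProj stepFn
    rw [← hj]
    congr 1
    unfold cellMean
    simp only [intervalIntegral.integral_const, smul_eq_mul]
    field_simp
    ring
  have h2 := sq_cellMean_le hh (hw.sub (IsLocL2.const (w x))) j
  rw [h1] at h2
  have h3 : ∫ y in (((j : ℝ) - 1) * h)..((j : ℝ) * h), (w y - w x) ^ 2
      ≤ ∫ δ in (-h)..h, (w (x + δ) - w x) ^ 2 := by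
    have e : ∫ δ in (-h)..h, (w (x + δ) - w x) ^ 2
        = ∫ y in (x - h)..(x + h), (w y - w x) ^ 2 := by
      have := intervalIntegral.integral_comp_add_left (a := -h) (b := h)
        (fun y => (w y - w x) ^ 2) x
      rw [this]; rfl
    rw [e]
    refine intervalIntegral.integral_mono_interval ?_ (cell_le hh j) ?_ ?_
      ((hw.sub (IsLocL2.const (w x))).sq _ _)
    · nlinarith [hx.1, hx.2]
    · nlinarith [hx.1, hx.2]
    · exact Eventually.of_forall fun y => sq_nonneg _
  rw [div_mul_eq_mul_div, le_div_iff₀ hh]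
  nlinarith

/-- The modulus of continuity controls the distance to the piecewise constant projection. -/
theorem HasModulus.sqNorm_sub_cellProj_le {γ K h : ℝ} {n : ℕ} {w : ℝ → ℝ}
    (hm : HasModulus γ K 0 w) (hp : Function.Periodic w 2) (hw : IsLocL2 w) (hh : 0 < h)
    (hn : n * h = 2) (hn0 : 0 < n) :
    sqNorm (fun x => w x - cellProj h w x) ≤ 2 * |K| * h ^ (2 * γ) := by
  have hloc : IsLocL2 (fun x => w x - cellProj h w x) :=
    hw.sub (stepFn_isLocL2 hn0 h (cellMean_periodic hn hp))
  rw [← ENNReal.ofReal_le_ofReal_iff (by positivity), ← lintegral_ofReal_sq hloc]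
  have : IsFiniteMeasure period := by unfold period; infer_instance
  have hmeas : AEMeasurable (Function.uncurry fun x δ : ℝ =>
      ENNReal.ofReal (|w (x + δ) - w x| ^ 2))
      (period.prod (volume.restrict (Ioc (-h) h))) := by
    have hq : Measure.QuasiMeasurePreserving (fun p : ℝ × ℝ => p.1 + p.2)
        (volume.prod volume) volume :=
      (Measure.quasiMeasurePreserving_fst (μ := volume) (ν := volume)).comp
        (measurePreserving_add_prod volume volume).quasiMeasurePreserving
    have h1 : AEMeasurable (fun p : ℝ × ℝ => w (p.1 + p.2) - w p.1)
        ((volume : Measure ℝ).prod volume) :=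
      (hw.meas.aemeasurable.comp_quasiMeasurePreserving hq).sub
        (hw.meas.aemeasurable.comp_quasiMeasurePreserving Measure.quasiMeasurePreserving_fst)
    unfold period
    rw [Measure.prod_restrict]
    exact ENNReal.measurable_ofReal.comp_aemeasurable ((h1.norm.pow_const 2).restrict)
  have hδ : ∀ δ ∈ Ioc (-h) h, ∫⁻ x, ENNReal.ofReal (|w (x + δ) - w x| ^ 2) ∂period ≤
      ENNReal.ofReal (|K| * h ^ (2 * γ)) := fun δ hδ =>
    hm.lintegral_le hh hh.le (abs_le.2 ⟨hδ.1.le, hδ.2⟩)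
  calc ∫⁻ x, ENNReal.ofReal (|w x - cellProj h w x| ^ 2) ∂period
      ≤ ∫⁻ x, (ENNReal.ofReal (1 / h) *
          ∫⁻ δ in Ioc (-h) h, ENNReal.ofReal (|w (x + δ) - w x| ^ 2)) ∂period := by
        refine lintegral_mono fun x => ?_
        have h1 := sq_sub_cellProj_le hh hw x
        rw [sq_abs]
        refine (ENNReal.ofReal_le_ofReal h1).trans (le_of_eq ?_)
        rw [ENNReal.ofReal_mul (by positivity),
          intervalIntegral.integral_of_le (by linarith), ofReal_integral_eq_lintegral_ofReal]
        · simp only [sq_abs]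
        · have : IntervalIntegrable (fun δ => (w (x + δ) - w x) ^ 2) volume (-h) h := by
            have := (((hw.comp_add_right x).sub (IsLocL2.const (w x))).sq (-h) h)
            simpa only [add_comm] using this
          rwa [intervalIntegrable_iff_integrableOn_Ioc_of_le (by linarith)] at this
        · exact Eventually.of_forall fun _ => sq_nonneg _
    -- After the exchange the inner integral is a shift by a fixed δ, to which the modulus applies.
    -- The window of length 2h against 1/h leaves the factor 2.
    _ = ENNReal.ofReal (1 / h) * ∫⁻ δ in Ioc (-h) h,
          ∫⁻ x, ENNReal.ofReal (|w (x + δ) - w x| ^ 2) ∂period := by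
        rw [lintegral_const_mul' _ _ ENNReal.ofReal_ne_top, lintegral_lintegral_swap hmeas]
    _ ≤ ENNReal.ofReal (1 / h) * ∫⁻ _ in Ioc (-h) h, ENNReal.ofReal (|K| * h ^ (2 * γ)) := by
        gcongr 1
        exact setLIntegral_mono' measurableSet_Ioc hδ
    _ = ENNReal.ofReal (2 * |K| * h ^ (2 * γ)) := by
        rw [setLIntegral_const, Real.volume_Ioc, ← ENNReal.ofReal_mul (by positivity),
          ← ENNReal.ofReal_mul (by positivity)]
        congr 1
        field_simp
        ring

/-! ### The weak formulation in time -/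

/-- A distributional identity `A' = -B`, `A 0 = A₀` between continuous functions holds in
integrated form. -/
theorem eq_sub_integral_of_weak_of_continuous {T : ℝ} (hT : 0 < T) {A B : ℝ → ℝ} {A₀ : ℝ}
    (hA : Continuous A) (hB : Continuous B)
    (hweak : ∀ χ : ℝ → ℝ, ContDiff ℝ ∞ χ → (∃ T' < T, ∀ t, T' ≤ t → χ t = 0) →
      (∫ t in (0 : ℝ)..T, (deriv χ t * A t - χ t * B t)) + A₀ * χ 0 = 0) :
    ∀ t ∈ Icc 0 T, A t = A₀ - ∫ r in (0 : ℝ)..t, B r := by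
  set I : ℝ → ℝ := fun t => ∫ r in (0 : ℝ)..t, B r with hI
  have hId : ∀ t, HasDerivAt I (B t) t := fun t =>
    intervalIntegral.integral_hasDerivAt_right (hB.intervalIntegrable _ _)
      (hB.stronglyMeasurableAtFilter _ _) hB.continuousAt
  have hIc : Continuous I := continuous_iff_continuousAt.2 fun t => (hId t).continuousAt
  have hDc : Continuous fun t => A t + I t - A₀ := (hA.add hIc).sub continuous_const
  have key : ∀ η : ℝ → ℝ, ContDiff ℝ ∞ η → HasCompactSupport η → tsupport η ⊆ Ioo 0 T →
      ∫ t, η t • (A t + I t - A₀) = 0 := by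
    intro η hη hηc hηs
    set c := ∫ t in (0 : ℝ)..T, η t with hc
    -- The primitive of η is normalised to vanish at T. Since η is supported inside the open
    -- interval, χ vanishes from the end of that support on and is admissible; its value −c at 0
    -- brings in `A₀`.
    set χ : ℝ → ℝ := fun t => (∫ r in (0 : ℝ)..t, η r) - c with hχ
    have hηcont := hη.continuous
    have hχd : ∀ t, HasDerivAt χ (η t) t := fun t =>
      (intervalIntegral.integral_hasDerivAt_right (hηcont.intervalIntegrable _ _)
        (hηcont.stronglyMeasurableAtFilter _ _) hηcont.continuousAt).sub_const c
    have hχderiv : deriv χ = η := funext fun t => (hχd t).deriv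
    have hχs : ContDiff ℝ ∞ χ := by
      rw [contDiff_infty_iff_deriv, hχderiv]
      exact ⟨fun t => (hχd t).differentiableAt, hη⟩
    have hvan : ∃ T' < T, ∀ t, T' ≤ t → χ t = 0 := by
      rcases (tsupport η).eq_empty_or_nonempty with he | hne
      · have h0 : ∀ t, η t = 0 := fun t => image_eq_zero_of_notMem_tsupport (by simp [he])
        exact ⟨0, hT, fun t _ => by simp [hχ, hc, h0]⟩
      · obtain ⟨M, hM, hMs⟩ := hηc.isCompact.exists_isGreatest hne
        refine ⟨M, (hηs hM).2, fun t ht => ?_⟩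
        have : ∫ r in T..t, η r = 0 := by
          rw [← intervalIntegral.integral_zero (a := T) (b := t) (μ := volume)]
          refine intervalIntegral.integral_congr_ae (Eventually.of_forall fun r hr => ?_)
          by_contra hne0
          have h1 := subset_tsupport η hne0
          have h2 := (hηs h1).2
          have h3 := hMs h1
          have h4 := (mem_uIoc.1 hr)
          rcases h4 with h4 | h4 <;> linarith [h4.1, h4.2]
        have h2 := intervalIntegral.integral_add_adjacent_intervals (μ := volume)
          (hηcont.intervalIntegrable 0 T) (hηcont.intervalIntegrable T t)
        simp only [hχ, hc]
        linarith
    have hχT : χ T = 0 := by simp [hχ, hc]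
    have hχ0 : χ 0 = -c := by simp [hχ]
    have hw := hweak χ hχs hvan
    rw [hχderiv, hχ0] at hw
    have hχcont := hχs.continuous
    have hparts := intervalIntegral.integral_mul_deriv_eq_deriv_mul (a := 0) (b := T)
      (u := χ) (v := I) (u' := η) (v' := B) (fun t _ => hχd t) (fun t _ => hId t)
      (hηcont.intervalIntegrable _ _) (hB.intervalIntegrable _ _)
    have hI0 : I 0 = 0 := by simp [hI]
    rw [hχT, hI0] at hparts
    have hi1 : IntervalIntegrable (fun t => η t * A t) volume 0 T :=
      (hηcont.mul hA).intervalIntegrable _ _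
    have hi2 : IntervalIntegrable (fun t => η t * I t) volume 0 T :=
      (hηcont.mul hIc).intervalIntegrable _ _
    have hi3 : IntervalIntegrable (fun t => χ t * B t) volume 0 T :=
      (hχcont.mul hB).intervalIntegrable _ _
    rw [intervalIntegral.integral_sub hi1 hi3, hparts] at hw
    have h1 : ∫ t, η t • (A t + I t - A₀) = ∫ t in (0 : ℝ)..T, η t * (A t + I t - A₀) := by
      rw [intervalIntegral.integral_of_le hT.le, setIntegral_eq_integral_of_forall_compl_eq_zero]
      · rfl
      · intro t ht
        have : η t = 0 := image_eq_zero_of_notMem_tsupport fun h =>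
          ht ⟨(hηs h).1, (hηs h).2.le⟩
        simp [this]
    have h2 : ∀ t, η t * (A t + I t - A₀) = (η t * A t + η t * I t) - A₀ * η t := fun t => by ring
    rw [h1]
    simp only [h2]
    rw [intervalIntegral.integral_sub (hi1.add hi2)
        ((hηcont.const_mul A₀).intervalIntegrable _ _),
      intervalIntegral.integral_add hi1 hi2, intervalIntegral.integral_const_mul]
    linarith
  -- The fundamental lemma gives the identity almost everywhere; continuity extends it to every
  -- time, endpoints included.
  have hae := isOpen_Ioo.ae_eq_zero_of_integral_contDiff_smul_eq_zero
    (μ := (volume : Measure ℝ)) (f := fun t => A t + I t - A₀) (U := Ioo 0 T)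
    (hDc.locallyIntegrable.locallyIntegrableOn _) key
  have h1 : (fun t => A t + I t - A₀) =ᵐ[volume.restrict (Icc 0 T)] fun _ => 0 := by
    rw [← restrict_Ioo_eq_restrict_Icc]
    exact (ae_restrict_iff' measurableSet_Ioo).2 hae
  have h2 := Measure.eqOn_Icc_of_ae_eq volume hT.ne h1 hDc.continuousOn continuousOn_const
  intro t ht
  have := h2 ht
  simp only [hI] at this
  linarith

/-- Only values on [0, T] enter, so both functions may be replaced by their constant extensions
beyond the endpoints. -/
theorem eq_sub_integral_of_weak {T : ℝ} (hT : 0 < T) {A B : ℝ → ℝ} {A₀ : ℝ}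
    (hA : ContinuousOn A (Icc 0 T)) (hB : ContinuousOn B (Icc 0 T))
    (hweak : ∀ χ : ℝ → ℝ, ContDiff ℝ ∞ χ → (∃ T' < T, ∀ t, T' ≤ t → χ t = 0) →
      (∫ t in (0 : ℝ)..T, (deriv χ t * A t - χ t * B t)) + A₀ * χ 0 = 0) :
    ∀ t ∈ Icc 0 T, A t = A₀ - ∫ r in (0 : ℝ)..t, B r := by
  have eA : ∀ t ∈ Icc 0 T, IccExtend hT.le (domRestrict (Icc 0 T) A) t = A t := fun t ht =>
    IccExtend_of_mem _ _ ht
  have eB : ∀ t ∈ Icc 0 T, IccExtend hT.le (domRestrict (Icc 0 T) B) t = B t := fun t ht =>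
    IccExtend_of_mem _ _ ht
  have h := eq_sub_integral_of_weak_of_continuous hT (A := IccExtend hT.le (domRestrict (Icc 0 T) A))
    (B := IccExtend hT.le (domRestrict (Icc 0 T) B)) (A₀ := A₀)
    (continuousOn_iff_continuous_domRestrict.1 hA).Icc_extend'
    (continuousOn_iff_continuous_domRestrict.1 hB).Icc_extend' ?_
  · intro t ht
    have := h t ht
    rw [eA t ht] at this
    rw [this]
    congr 1
    refine intervalIntegral.integral_congr fun r hr => ?_
    rw [uIcc_of_le ht.1] at hr
    exact eB r ⟨hr.1, hr.2.trans ht.2⟩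
  · intro χ hχ hv
    refine Eq.trans ?_ (hweak χ hχ hv)
    congr 1
    refine intervalIntegral.integral_congr fun r hr => ?_
    rw [uIcc_of_le hT.le] at hr
    simp only [eA r hr, eB r hr]

/-! ### Smooth periodic approximations of the indicator function of an interval -/

/-- Smooth functions of period `2` that increase to the indicator function of the periodic
interval of centre `c` and half width `H`. -/
def bumpApprox (c H : ℝ) (k : ℕ) (x : ℝ) : ℝ :=
  Real.smoothTransition (k * (Real.cos (Real.pi * (x - c)) - Real.cos (Real.pi * H)))

theorem bumpApprox_contDiff (c H : ℝ) (k : ℕ) : ContDiff ℝ ∞ (bumpApprox c H k) := by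
  have : ContDiff ℝ ∞ fun x : ℝ =>
      (k : ℝ) * (Real.cos (Real.pi * (x - c)) - Real.cos (Real.pi * H)) := by fun_prop
  exact (Real.smoothTransition.contDiff (n := ⊤)).comp this

theorem bumpApprox_periodic (c H : ℝ) (k : ℕ) : Function.Periodic (bumpApprox c H k) 2 := by
  intro x
  unfold bumpApprox
  rw [show Real.pi * (x + 2 - c) = Real.pi * (x - c) + 2 * Real.pi by ring, Real.cos_add_two_pi]

theorem bumpApprox_abs_le (c H : ℝ) (k : ℕ) (x : ℝ) : |bumpApprox c H k x| ≤ 1 := by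
  unfold bumpApprox
  rw [abs_of_nonneg (Real.smoothTransition.nonneg _)]
  exact Real.smoothTransition.le_one _

/-- Bumps of equal width are translates of each other. Hence the difference of two of them has mean
zero and a periodic primitive, which is the test function of `IsWeakPair.flux`. -/
theorem bumpApprox_integral (c d H : ℝ) (k : ℕ) :
    ∫ x in (0 : ℝ)..2, bumpApprox c H k x = ∫ x in (0 : ℝ)..2, bumpApprox d H k x := by
  have h : ∀ x, bumpApprox c H k x = bumpApprox d H k (x + (d - c)) := fun x => by
    unfold bumpApprox; rw [show x + (d - c) - d = x - c by ring]
  simp only [h]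
  rw [intervalIntegral.integral_comp_add_right (fun x => bumpApprox d H k x)]
  have := (bumpApprox_periodic d H k).intervalIntegral_add_eq (0 + (d - c)) 0
  rw [zero_add, zero_add] at this
  rw [zero_add, ← this]
  congr 1
  ring

theorem bumpApprox_tendsto_one {c H x : ℝ} (hH1 : H ≤ 1) (hx : x ∈ Ioo (c - H) (c + H)) :
    Tendsto (fun k => bumpApprox c H k x) atTop (𝓝 1) := by
  have hpos : 0 < Real.cos (Real.pi * (x - c)) - Real.cos (Real.pi * H) := by
    rw [sub_pos, ← Real.cos_abs (Real.pi * (x - c)), abs_mul, abs_of_pos Real.pi_pos]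
    have h1 : |x - c| < H := abs_lt.2 ⟨by linarith [hx.1], by linarith [hx.2]⟩
    refine Real.cos_lt_cos_of_nonneg_of_le_pi (by positivity) ?_ ?_
    · nlinarith [Real.pi_pos]
    · exact mul_lt_mul_of_pos_left h1 Real.pi_pos
  refine tendsto_const_nhds.congr' ?_
  obtain ⟨n, hn⟩ := exists_nat_ge (1 / (Real.cos (Real.pi * (x - c)) - Real.cos (Real.pi * H)))
  filter_upwards [eventually_ge_atTop n] with k hk
  refine (Real.smoothTransition.one_of_one_le ?_).symm
  rw [← div_le_iff₀ hpos]
  exact hn.trans (by exact_mod_cast hk)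

theorem bumpApprox_eq_zero {c H x : ℝ} (hH : 0 ≤ H) (hx1 : |x - c| ≤ 1) (hx : H ≤ |x - c|)
    (k : ℕ) : bumpApprox c H k x = 0 := by
  refine Real.smoothTransition.zero_of_nonpos (mul_nonpos_of_nonneg_of_nonpos (by positivity) ?_)
  rw [sub_nonpos, ← Real.cos_abs (Real.pi * (x - c)), abs_mul, abs_of_pos Real.pi_pos]
  refine Real.cos_le_cos_of_nonneg_of_le_pi ?_ ?_ ?_
  · exact mul_nonneg Real.pi_pos.le hH
  · nlinarith [Real.pi_pos]
  · exact mul_le_mul_of_nonneg_left hx Real.pi_pos.le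

/-- On the period [c − 1, c + 1] the bump lives on a single interval; there |f| dominates and the
bumps tend to 1. -/
theorem tendsto_integral_mul_bumpApprox {f : ℝ → ℝ} (hf : IsLocL2 f)
    (hp : Function.Periodic f 2) {c H : ℝ} (hH : 0 < H) (hH1 : H ≤ 1) :
    Tendsto (fun k => ∫ x in (0 : ℝ)..2, f x * bumpApprox c H k x) atTop
      (𝓝 (∫ x in (c - H)..(c + H), f x)) := by
  have e1 : ∀ k, ∫ x in (0 : ℝ)..2, f x * bumpApprox c H k x
      = ∫ x in (c - 1)..(c + 1), f x * bumpApprox c H k x := fun k => by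
    have hp2 : Function.Periodic (fun x => f x * bumpApprox c H k x) 2 := fun x => by
      simp only [hp x, bumpApprox_periodic c H k x]
    have := hp2.intervalIntegral_add_eq 0 (c - 1)
    rw [zero_add] at this
    rw [this]
    congr 1
    ring
  have hgc : ∀ k, Continuous (bumpApprox c H k) := fun k => (bumpApprox_contDiff c H k).continuous
  have e2 : ∀ k, ∫ x in (c - 1)..(c + 1), f x * bumpApprox c H k x
      = ∫ x in (c - H)..(c + H), f x * bumpApprox c H k x := fun k => by
    have hi : ∀ a b, IntervalIntegrable (fun x => f x * bumpApprox c H k x) volume a b :=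
      fun a b => hf.mul_integrable (IsLocL2.of_continuous (hgc k)) a b
    rw [← intervalIntegral.integral_add_adjacent_intervals (hi (c - 1) (c - H)) (hi _ (c + 1)),
      ← intervalIntegral.integral_add_adjacent_intervals (hi (c - H) (c + H)) (hi _ (c + 1))]
    have z1 : ∫ x in (c - 1)..(c - H), f x * bumpApprox c H k x = 0 := by
      rw [← intervalIntegral.integral_zero (a := c - 1) (b := c - H) (μ := volume)]
      refine intervalIntegral.integral_congr fun x hx => ?_
      rw [uIcc_of_le (by linarith)] at hx
      have : |x - c| = c - x := by rw [abs_of_nonpos (by linarith [hx.2])]; ring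
      rw [bumpApprox_eq_zero hH.le (by rw [this]; linarith [hx.1]) (by rw [this]; linarith [hx.2]),
        mul_zero]
    have z2 : ∫ x in (c + H)..(c + 1), f x * bumpApprox c H k x = 0 := by
      rw [← intervalIntegral.integral_zero (a := c + H) (b := c + 1) (μ := volume)]
      refine intervalIntegral.integral_congr fun x hx => ?_
      rw [uIcc_of_le (by linarith)] at hx
      have : |x - c| = x - c := by rw [abs_of_nonneg (by linarith [hx.1])]
      rw [bumpApprox_eq_zero hH.le (by rw [this]; linarith [hx.2]) (by rw [this]; linarith [hx.1]),
        mul_zero]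
    rw [z1, z2]; ring
  simp only [e1, e2]
  refine intervalIntegral.tendsto_integral_filter_of_dominated_convergence (fun x => |f x|)
    (Eventually.of_forall fun k => (hf.meas.mul (hgc k).aestronglyMeasurable).restrict)
    (Eventually.of_forall fun k => Eventually.of_forall fun x _ => ?_)
    (hf.integrable _ _).abs ?_
  · rw [Real.norm_eq_abs, abs_mul]
    exact mul_le_of_le_one_right (abs_nonneg _) (bumpApprox_abs_le c H k x)
  · have : ∀ᵐ x : ℝ, x ≠ c + H := by simp [ae_iff]
    filter_upwards [this] with x hx hm
    rw [uIoc_of_le (by linarith)] at hm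
    have := (bumpApprox_tendsto_one (c := c) hH1
      ⟨hm.1, lt_of_le_of_ne hm.2 hx⟩).const_mul (f x)
    simpa using this

/-- A periodic function that is orthogonal to all smooth periodic functions vanishes almost
everywhere. -/
theorem ae_eq_zero_of_integral_mul_smooth {f : ℝ → ℝ} (hf : IsLocL2 f)
    (hp : Function.Periodic f 2)
    (h : ∀ ψ : ℝ → ℝ, ContDiff ℝ ∞ ψ → Function.Periodic ψ 2 →
      ∫ x in (0 : ℝ)..2, f x * ψ x = 0) : ∀ᵐ x, f x = 0 := by
  -- Limits of smooth bumps show that integrals over intervals vanish. The primitive is then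
  -- identically zero, and f is its derivative almost everywhere.
  have h1 : ∀ c H : ℝ, 0 < H → H ≤ 1 → ∫ x in (c - H)..(c + H), f x = 0 := by
    intro c H hH hH1
    refine tendsto_nhds_unique (tendsto_integral_mul_bumpApprox hf hp hH hH1) ?_
    simp only [h _ (bumpApprox_contDiff c H _) (bumpApprox_periodic c H _)]
    exact tendsto_const_nhds
  have h2 : ∀ x ∈ Ioc (0 : ℝ) 2, ∫ y in (0 : ℝ)..x, f y = 0 := by
    intro x hx
    have := h1 (x / 2) (x / 2) (by linarith [hx.1]) (by linarith [hx.2])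
    simpa using this
  have hper : Function.Periodic (fun x => ∫ y in (0 : ℝ)..x, f y) 2 := by
    intro x
    beta_reduce
    have e1 := intervalIntegral.integral_add_adjacent_intervals
      (hf.integrable 0 x) (hf.integrable x (x + 2))
    have e2 := hp.intervalIntegral_add_eq x 0
    rw [zero_add, h2 2 ⟨by norm_num, le_rfl⟩] at e2
    linarith
  have h3 : ∀ x, ∫ y in (0 : ℝ)..x, f y = 0 := by
    intro x
    obtain ⟨y, hy, hxy⟩ := hper.exists_mem_Ico₀ (by norm_num : (0 : ℝ) < 2) x
    rw [hxy]
    rcases hy.1.eq_or_lt with h0 | h0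
    · rw [← h0]; simp
    · exact h2 y ⟨h0, hy.2.le⟩
  have hli : LocallyIntegrable f volume := by
    intro x
    refine ⟨Icc (x - 1) (x + 1), Icc_mem_nhds (by linarith) (by linarith), ?_⟩
    rw [integrableOn_Icc_iff_integrableOn_Ioc,
      ← intervalIntegrable_iff_integrableOn_Ioc_of_le (by linarith)]
    exact hf.integrable _ _
  filter_upwards [LocallyIntegrable.ae_hasDerivAt_integral hli] with x hx
  have := hx 0
  simp only [h3] at this
  exact this.unique (hasDerivAt_const x 0)

/-! ### Curves in L² and their pairings with bounded functions -/

/-- A curve of square integrable periodic functions, continuous on `[0,T]`. -/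
structure IsL2Curve (T : ℝ) (w : ℝ → ℝ → ℝ) : Prop where
  loc : ∀ t ∈ Icc 0 T, IsLocL2 (w t)
  periodic : ∀ t ∈ Icc 0 T, Function.Periodic (w t) 2
  cont : ∀ t ∈ Icc 0 T, Tendsto (fun s => sqNorm (fun x => w s x - w t x)) (𝓝[Icc 0 T] t) (𝓝 0)

theorem IsContinuousL2.isL2Curve {T : ℝ} {w : ℝ → ℝ → ℝ} (hw : IsContinuousL2 T w) :
    IsL2Curve T w := by
  refine ⟨fun t ht => (hw.1 t ht).isLocL2, fun t ht => (hw.1 t ht).1, fun t ht => ?_⟩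
  have := (hw.2 t ht).pow 2
  simp only [norm2_sq] at this
  rw [zero_pow two_ne_zero] at this
  exact this

theorem IsL2Curve.mul {T : ℝ} {w : ℝ → ℝ → ℝ} (hw : IsL2Curve T w) {b : ℝ → ℝ}
    (hb : AEStronglyMeasurable b volume) (hbp : Function.Periodic b 2) {C : ℝ}
    (hC : ∀ x, |b x| ≤ C) : IsL2Curve T (fun t x => b x * w t x) := by
  refine ⟨fun t ht => (hw.loc t ht).mul_bound hb hC,
    fun t ht x => by simp only [hw.periodic t ht x, hbp x], fun t ht => ?_⟩
  have h0 := (hw.cont t ht).const_mul (C ^ 2)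
  rw [mul_zero] at h0
  refine tendsto_of_tendsto_of_tendsto_of_le_of_le' tendsto_const_nhds h0
    (Eventually.of_forall fun s => sqNorm_nonneg _) ?_
  filter_upwards [self_mem_nhdsWithin] with s hs
  refine sqNorm_mono (((hw.loc s hs).mul_bound hb hC).sub ((hw.loc t ht).mul_bound hb hC))
    ((hw.loc s hs).sub (hw.loc t ht)) _ fun x => ?_
  rw [← mul_sub, mul_pow]
  have := pow_le_pow_left₀ (abs_nonneg _) (hC x) 2
  rw [sq_abs] at this
  gcongr

/-- Pairing with a bounded function is bounded by the squared norm. -/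
theorem sq_integral_mul_le {f g : ℝ → ℝ} (hf : IsLocL2 f) (hg : AEStronglyMeasurable g volume)
    {C : ℝ} (hC : ∀ x, |g x| ≤ C) :
    (∫ x in (0 : ℝ)..2, f x * g x) ^ 2 ≤ 2 * C ^ 2 * sqNorm f := by
  have hfg := hf.mul_bound hg hC
  have h1 := hfg.sq_integral_le (by norm_num : (0 : ℝ) ≤ 2)
  have h2 : sqNorm (fun x => g x * f x) ≤ C ^ 2 * sqNorm f := by
    refine sqNorm_mono hfg hf _ fun x => ?_
    rw [mul_pow]
    have := pow_le_pow_left₀ (abs_nonneg _) (hC x) 2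
    rw [sq_abs] at this
    gcongr
  unfold sqNorm at h2
  simp only [mul_comm (f _) (g _)]
  unfold sqNorm
  linarith

theorem IsL2Curve.continuousOn_pairing {T : ℝ} {w : ℝ → ℝ → ℝ} (hw : IsL2Curve T w) {g : ℝ → ℝ}
    (hg : AEStronglyMeasurable g volume) {C : ℝ} (hC : ∀ x, |g x| ≤ C) :
    ContinuousOn (fun t => ∫ x in (0 : ℝ)..2, w t x * g x) (Icc 0 T) := by
  have hgl : IsLocL2 g := IsLocL2.of_bound hg hC
  intro t ht
  unfold ContinuousWithinAt
  rw [tendsto_iff_dist_tendsto_zero]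
  have h0 := ((hw.cont t ht).const_mul (2 * C ^ 2)).sqrt
  rw [mul_zero, Real.sqrt_zero] at h0
  refine tendsto_of_tendsto_of_tendsto_of_le_of_le' tendsto_const_nhds h0
    (Eventually.of_forall fun s => dist_nonneg) ?_
  filter_upwards [self_mem_nhdsWithin] with s hs
  rw [Real.dist_eq]
  refine Real.abs_le_sqrt ?_
  rw [← intervalIntegral.integral_sub ((hw.loc s hs).mul_integrable hgl 0 2)
    ((hw.loc t ht).mul_integrable hgl 0 2)]
  simp only [← sub_mul]
  exact sq_integral_mul_le ((hw.loc s hs).sub (hw.loc t ht)) hg hC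

theorem IsL2Curve.exists_bound {T : ℝ} {w : ℝ → ℝ → ℝ} (hw : IsL2Curve T w) :
    ∃ C, ∀ t ∈ Icc 0 T, sqNorm (w t) ≤ C := by
  refine isCompact_Icc.induction_on (p := fun S => ∃ C, ∀ t ∈ S, sqNorm (w t) ≤ C)
    ⟨0, by simp⟩ (fun s t hst ⟨C, hC⟩ => ⟨C, fun x hx => hC x (hst hx)⟩) ?_ ?_
  · rintro s t ⟨C, hC⟩ ⟨D, hD⟩
    refine ⟨max C D, fun x hx => ?_⟩
    rcases hx with hx | hx
    · exact (hC x hx).trans (le_max_left _ _)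
    · exact (hD x hx).trans (le_max_right _ _)
  · intro t ht
    refine ⟨{s | s ∈ Icc 0 T ∧ sqNorm (fun x => w s x - w t x) < 1}, ?_,
      2 * 1 + 2 * sqNorm (w t), ?_⟩
    · exact Filter.inter_mem self_mem_nhdsWithin ((hw.cont t ht).eventually_lt_const one_pos)
    · rintro s ⟨hs, hs1⟩
      have := sqNorm_add_le ((hw.loc s hs).sub (hw.loc t ht)) (hw.loc t ht)
      simp only [sub_add_cancel] at this
      linarith

theorem exists_bound_of_periodic {g : ℝ → ℝ} (hg : Continuous g) (hp : Function.Periodic g 2) :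
    ∃ C, ∀ x, |g x| ≤ C := by
  obtain ⟨C, hC⟩ := isCompact_Icc.exists_bound_of_continuousOn (s := Icc (0 : ℝ) 2) hg.continuousOn
  refine ⟨C, fun x => ?_⟩
  obtain ⟨y, hy, hxy⟩ := hp.exists_mem_Ico₀ (by norm_num : (0 : ℝ) < 2) x
  rw [hxy]
  exact hC y ⟨hy.1, hy.2.le⟩

theorem periodic_deriv {g : ℝ → ℝ} (hp : Function.Periodic g 2) :
    Function.Periodic (deriv g) 2 := by
  intro x
  rw [← deriv_comp_add_const g 2 x]
  congr 1
  exact funext hp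

/-! ### One weak equation: tested identities and primitives of time increments -/

/-- One equation of the system in weak form: `w_t = z_x`, `w(0) = w₀`. -/
structure IsWeakPair (T : ℝ) (w₀ : ℝ → ℝ) (w z : ℝ → ℝ → ℝ) : Prop where
  curve_w : IsL2Curve T w
  curve_z : IsL2Curve T z
  init_loc : IsLocL2 w₀
  init_periodic : Function.Periodic w₀ 2
  eq : ∀ φ : ℝ → ℝ → ℝ, IsTestFunction T φ →
    (∫ t in (0 : ℝ)..T, ∫ x in (0 : ℝ)..2,
        (w t x * deriv (fun s => φ s x) t - z t x * deriv (φ t) x))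
      + ∫ x in (0 : ℝ)..2, w₀ x * φ 0 x = 0

namespace IsWeakPair

variable {T : ℝ} {w₀ : ℝ → ℝ} {w z : ℝ → ℝ → ℝ}

/-- Product test functions χ(t) ψ(x) turn the weak equation into a scalar weak identity in time
between two continuous pairings. -/
theorem pairing_eq (hT : 0 < T) (hw : IsWeakPair T w₀ w z) {ψ : ℝ → ℝ} (hψ : ContDiff ℝ ∞ ψ)
    (hp : Function.Periodic ψ 2) {t : ℝ} (ht : t ∈ Icc 0 T) :
    ∫ x in (0 : ℝ)..2, w t x * ψ x = (∫ x in (0 : ℝ)..2, w₀ x * ψ x)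
      - ∫ r in (0 : ℝ)..t, ∫ x in (0 : ℝ)..2, z r x * deriv ψ x := by
  have hψd : ContDiff ℝ ∞ (deriv ψ) := (contDiff_infty_iff_deriv.1 hψ).2
  obtain ⟨C, hC⟩ := exists_bound_of_periodic hψ.continuous hp
  obtain ⟨D, hD⟩ := exists_bound_of_periodic hψd.continuous (periodic_deriv hp)
  have hψl := IsLocL2.of_continuous hψ.continuous
  have hψdl := IsLocL2.of_continuous hψd.continuous
  refine eq_sub_integral_of_weak hT
    (A := fun t => ∫ x in (0 : ℝ)..2, w t x * ψ x)
    (B := fun t => ∫ x in (0 : ℝ)..2, z t x * deriv ψ x)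
    (hw.curve_w.continuousOn_pairing hψ.continuous.aestronglyMeasurable hC)
    (hw.curve_z.continuousOn_pairing hψd.continuous.aestronglyMeasurable hD) ?_ t ht
  rintro χ hχ ⟨T', hT', hv⟩
  have htest : IsTestFunction T (fun t x => χ t * ψ x) := by
    refine ⟨?_, fun t x => by simp only [hp x], T', hT', fun t ht x => by simp [hv t ht]⟩
    exact (hχ.comp contDiff_fst).mul (hψ.comp contDiff_snd)
  refine Eq.trans ?_ (hw.eq _ htest)
  congr 1
  · refine intervalIntegral.integral_congr fun t ht => ?_
    rw [uIcc_of_le hT.le] at ht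
    rw [← intervalIntegral.integral_const_mul, ← intervalIntegral.integral_const_mul,
      ← intervalIntegral.integral_sub
        (((hw.curve_w.loc t ht).mul_integrable hψl 0 2).const_mul _)
        (((hw.curve_z.loc t ht).mul_integrable hψdl 0 2).const_mul _)]
    congr 1
    funext x
    rw [deriv_mul_const_field', deriv_const_mul_field]
    ring
  · rw [← intervalIntegral.integral_mul_const]
    congr 1
    funext x
    ring

/-- At time 0 the time integral in `pairing_eq` is empty, so the difference from the data is
orthogonal to all smooth periodic functions. This identifies the cell means that start the scheme
with those of the solution at time 0. -/
theorem ae_eq_init (hT : 0 < T) (hw : IsWeakPair T w₀ w z) : ∀ᵐ x, w 0 x = w₀ x := by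
  have h0 : (0 : ℝ) ∈ Icc 0 T := ⟨le_rfl, hT.le⟩
  have := ae_eq_zero_of_integral_mul_smooth ((hw.curve_w.loc 0 h0).sub hw.init_loc)
    (fun x => by simp only [hw.curve_w.periodic 0 h0 x, hw.init_periodic x]) ?_
  · filter_upwards [this] with x hx
    linarith
  · intro ψ hψ hp
    have h1 := hw.pairing_eq hT hψ hp h0
    simp only [intervalIntegral.integral_same, sub_zero] at h1
    have hψl := IsLocL2.of_continuous hψ.continuous
    simp only [sub_mul]
    rw [intervalIntegral.integral_sub ((hw.curve_w.loc 0 h0).mul_integrable hψl 0 2)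
      (hw.init_loc.mul_integrable hψl 0 2), h1, sub_self]

theorem pairing_sub_eq (hT : 0 < T) (hw : IsWeakPair T w₀ w z) {ψ : ℝ → ℝ} (hψ : ContDiff ℝ ∞ ψ)
    (hp : Function.Periodic ψ 2) {s t : ℝ} (hs : s ∈ Icc 0 T) (ht : t ∈ Icc 0 T) :
    ∫ x in (0 : ℝ)..2, (w t x - w s x) * ψ x =
      - ∫ r in s..t, ∫ x in (0 : ℝ)..2, z r x * deriv ψ x := by
  have hψd : ContDiff ℝ ∞ (deriv ψ) := (contDiff_infty_iff_deriv.1 hψ).2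
  obtain ⟨D, hD⟩ := exists_bound_of_periodic hψd.continuous (periodic_deriv hp)
  have hψl := IsLocL2.of_continuous hψ.continuous
  have hc := hw.curve_z.continuousOn_pairing hψd.continuous.aestronglyMeasurable hD
  have hi : ∀ r ∈ Icc 0 T, IntervalIntegrable
      (fun r => ∫ x in (0 : ℝ)..2, z r x * deriv ψ x) volume 0 r := fun r hr => by
    refine (hc.mono ?_).intervalIntegrable
    rw [uIcc_of_le hr.1]
    exact Icc_subset_Icc_right hr.2
  simp only [sub_mul]
  rw [intervalIntegral.integral_sub ((hw.curve_w.loc t ht).mul_integrable hψl 0 2)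
      ((hw.curve_w.loc s hs).mul_integrable hψl 0 2), hw.pairing_eq hT hψ hp ht,
      hw.pairing_eq hT hψ hp hs, ← intervalIntegral.integral_interval_sub_left (hi t ht) (hi s hs)]
  ring

/-- The spatial primitive of a time increment. -/
def primitive (w : ℝ → ℝ → ℝ) (s t x : ℝ) : ℝ := ∫ y in (0 : ℝ)..x, (w t y - w s y)

theorem primitive_sub {s t : ℝ} (hw : IsL2Curve T w) (hs : s ∈ Icc 0 T) (ht : t ∈ Icc 0 T)
    (x y : ℝ) : primitive w s t y - primitive w s t x = ∫ r in x..y, (w t r - w s r) := by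
  have hδ := (hw.loc t ht).sub (hw.loc s hs)
  unfold primitive
  rw [intervalIntegral.integral_interval_sub_left (hδ.integrable _ _) (hδ.integrable _ _)]

theorem integral_sub_eq_zero (hT : 0 < T) (hw : IsWeakPair T w₀ w z) {s t : ℝ}
    (hs : s ∈ Icc 0 T) (ht : t ∈ Icc 0 T) : ∫ x in (0 : ℝ)..2, (w t x - w s x) = 0 := by
  have := hw.pairing_sub_eq hT (contDiff_const (c := (1 : ℝ))) (fun _ => rfl) hs ht
  simpa using this

theorem primitive_continuous {s t : ℝ} (hw : IsL2Curve T w) (hs : s ∈ Icc 0 T)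
    (ht : t ∈ Icc 0 T) : Continuous (primitive w s t) :=
  intervalIntegral.continuous_primitive
    (fun a b => ((hw.loc t ht).sub (hw.loc s hs)).integrable a b) 0

theorem primitive_periodic (hT : 0 < T) (hw : IsWeakPair T w₀ w z) {s t : ℝ}
    (hs : s ∈ Icc 0 T) (ht : t ∈ Icc 0 T) : Function.Periodic (primitive w s t) 2 := by
  intro x
  have h1 := primitive_sub hw.curve_w hs ht x (x + 2)
  have hp : Function.Periodic (fun x => w t x - w s x) 2 := fun x => by
    simp only [hw.curve_w.periodic t ht x, hw.curve_w.periodic s hs x]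
  have h2 := hp.intervalIntegral_add_eq x 0
  rw [zero_add, hw.integral_sub_eq_zero hT hs ht] at h2
  linarith

/-- The increment of w is only square integrable, so the integration by parts rests on absolute
continuity of its primitive. Boundary terms vanish because the increment has mean zero. -/
theorem integral_primitive_mul_deriv (hT : 0 < T) (hw : IsWeakPair T w₀ w z) {ψ : ℝ → ℝ}
    (hψ : ContDiff ℝ ∞ ψ) (hp : Function.Periodic ψ 2) {s t : ℝ} (hs : s ∈ Icc 0 T)
    (ht : t ∈ Icc 0 T) : ∫ x in (0 : ℝ)..2, primitive w s t x * deriv ψ x =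
      ∫ r in s..t, ∫ x in (0 : ℝ)..2, z r x * deriv ψ x := by
  have hδ := (hw.curve_w.loc t ht).sub (hw.curve_w.loc s hs)
  have hac : AbsolutelyContinuousOnInterval (primitive w s t) 0 2 :=
    (hδ.integrable 0 2).absolutelyContinuousOnInterval_intervalIntegral left_mem_uIcc
  have hψac : AbsolutelyContinuousOnInterval ψ 0 2 :=
    ((hψ.of_le (by exact_mod_cast le_top)).contDiffOn).absolutelyContinuousOnInterval
  have h := hac.integral_mul_deriv_eq_deriv_mul hψac
  have h0 : primitive w s t 0 = 0 := by simp [primitive]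
  have h2 : primitive w s t 2 = 0 := hw.integral_sub_eq_zero hT hs ht
  have h3 : ∫ x in (0 : ℝ)..2, deriv (primitive w s t) x * ψ x
      = ∫ x in (0 : ℝ)..2, (w t x - w s x) * ψ x := by
    refine intervalIntegral.integral_congr_ae ?_
    filter_upwards [(hδ.integrable 0 2).ae_hasDerivAt_integral] with x hx hm
    have h4 : HasDerivAt (primitive w s t) (w t x - w s x) x :=
      hx (uIoc_subset_uIcc hm) 0 left_mem_uIcc
    rw [h4.deriv]
  rw [h, h0, h2, h3, hw.pairing_sub_eq hT hψ hp hs ht]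
  ring

end IsWeakPair

theorem IsL2Curve.abs_pairing_le {T : ℝ} {w : ℝ → ℝ → ℝ} (hw : IsL2Curve T w) :
    ∃ M, ∀ t ∈ Icc 0 T, ∀ g : ℝ → ℝ, AEStronglyMeasurable g volume → (∀ x, |g x| ≤ 2) →
      |∫ x in (0 : ℝ)..2, w t x * g x| ≤ M := by
  obtain ⟨C, hC⟩ := hw.exists_bound
  refine ⟨Real.sqrt (8 * C), fun t ht g hg hgb => Real.abs_le_sqrt ?_⟩
  have h1 := sq_integral_mul_le (hw.loc t ht) hg hgb
  have h2 := hC t ht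
  linarith

theorem cell_bounds (h : ℝ) (j : ℤ) :
    ((j : ℝ) - 1 / 2) * h - h / 2 = ((j : ℝ) - 1) * h ∧
      ((j : ℝ) - 1 / 2) * h + h / 2 = (j : ℝ) * h := by
  constructor <;> ring

theorem tendsto_integral_mul_cellBump {f : ℝ → ℝ} (hf : IsLocL2 f)
    (hp : Function.Periodic f 2) {h : ℝ} (hh : 0 < h) (hh2 : h ≤ 2) (j : ℤ) :
    Tendsto (fun k => ∫ x in (0 : ℝ)..2, f x * bumpApprox (((j : ℝ) - 1 / 2) * h) (h / 2) k x)
      atTop (𝓝 (h * cellMean h f j)) := by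
  have := tendsto_integral_mul_bumpApprox hf hp (c := ((j : ℝ) - 1 / 2) * h) (H := h / 2)
    (by linarith) (by linarith)
  rwa [(cell_bounds h j).1, (cell_bounds h j).2, cellMean_integral hh] at this

theorem IsL2Curve.continuousOn_cellMean {T : ℝ} {w : ℝ → ℝ → ℝ} (hw : IsL2Curve T w) {n : ℕ}
    {h : ℝ} (hh : 0 < h) (hn : n * h = 2) (j : ℤ) :
    ContinuousOn (fun t => cellMean h (w t) j) (Icc 0 T) := by
  intro t ht
  unfold ContinuousWithinAt
  rw [tendsto_iff_dist_tendsto_zero]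
  have h0 := ((hw.cont t ht).const_mul (1 / h)).sqrt
  rw [mul_zero, Real.sqrt_zero] at h0
  refine tendsto_of_tendsto_of_tendsto_of_le_of_le' tendsto_const_nhds h0
    (Eventually.of_forall fun s => dist_nonneg) ?_
  filter_upwards [self_mem_nhdsWithin] with s hs
  rw [Real.dist_eq]
  refine Real.abs_le_sqrt ?_
  have hδ := (hw.loc s hs).sub (hw.loc t ht)
  rw [← cellMean_sub (hw.loc s hs) (hw.loc t ht)]
  have h1 := sq_cellMean_le hh hδ j
  have h2 : ∫ x in (((j : ℝ) - 1) * h)..((j : ℝ) * h), (w s x - w t x) ^ 2 ≤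
      sqNorm (fun x => w s x - w t x) := by
    have hp : Function.Periodic (fun x => (w s x - w t x) ^ 2) 2 := fun x => by
      simp only [hw.periodic t ht x, hw.periodic s hs x]
    have h3 := hp.intervalIntegral_add_eq (((j : ℝ) - 1) * h) 0
    rw [zero_add] at h3
    have hn1 : (1 : ℝ) ≤ n := by
      rcases Nat.eq_zero_or_pos n with h0 | h0
      · rw [h0] at hn; norm_num at hn
      · exact_mod_cast h0
    unfold sqNorm
    rw [← h3]
    refine intervalIntegral.integral_mono_interval le_rfl (cell_le hh j) ?_
      (Eventually.of_forall fun x => sq_nonneg _) (hδ.sq _ _)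
    nlinarith
  rw [one_div, inv_mul_eq_div, le_div_iff₀ hh]
  linarith

namespace IsWeakPair

variable {T : ℝ} {w₀ : ℝ → ℝ} {w z : ℝ → ℝ → ℝ}

/-- The differences of the cell means of the primitive of `w` are the time integrals of the
differences of the cell means of `z`. -/
theorem flux (hT : 0 < T) (hw : IsWeakPair T w₀ w z) {h : ℝ} (hh : 0 < h) (hh2 : h ≤ 2)
    {s t : ℝ} (hs : s ∈ Icc 0 T) (ht : t ∈ Icc 0 T) (i j : ℤ) :
    cellMean h (primitive w s t) j - cellMean h (primitive w s t) i =
      ∫ r in s..t, (cellMean h (z r) j - cellMean h (z r) i) := by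
  set g : ℤ → ℕ → ℝ → ℝ := fun j k => bumpApprox (((j : ℝ) - 1 / 2) * h) (h / 2) k with hg
  have hgc : ∀ j k, ContDiff ℝ ∞ (g j k) := fun j k => bumpApprox_contDiff _ _ _
  have hgp : ∀ j k, Function.Periodic (g j k) 2 := fun j k => bumpApprox_periodic _ _ _
  set G : ℕ → ℝ → ℝ := fun k x => g j k x - g i k x with hG
  have hGc : ∀ k, ContDiff ℝ ∞ (G k) := fun k => (hgc j k).sub (hgc i k)
  have hGcont : ∀ k, Continuous (G k) := fun k => (hGc k).continuous
  have hGp : ∀ k, Function.Periodic (G k) 2 := fun k x => by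
    simp only [hG, hgp j k x, hgp i k x]
  have hGb : ∀ k x, |G k x| ≤ 2 := fun k x => by
    have h1 := abs_le.1 (bumpApprox_abs_le (((j : ℝ) - 1 / 2) * h) (h / 2) k x)
    have h2 := abs_le.1 (bumpApprox_abs_le (((i : ℝ) - 1 / 2) * h) (h / 2) k x)
    simp only [hG, hg]
    rw [abs_le]
    constructor <;> linarith [h1.1, h1.2, h2.1, h2.2]
  -- Testing with ψ pairs both the primitive of the increment and z with ψ' = G, a difference of
  -- bumps on cells i and j. The unknown constant between the primitive and the time integral of z
  -- cancels in this difference; in the limit the pairings become differences of cell means.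
  set ψ : ℕ → ℝ → ℝ := fun k x => ∫ y in (0 : ℝ)..x, G k y with hψ
  have hψd : ∀ k x, HasDerivAt (ψ k) (G k x) x := fun k x =>
    intervalIntegral.integral_hasDerivAt_right ((hGcont k).intervalIntegrable _ _)
      ((hGcont k).stronglyMeasurableAtFilter _ _) (hGcont k).continuousAt
  have hψderiv : ∀ k, deriv (ψ k) = G k := fun k => funext fun x => (hψd k x).deriv
  have hψs : ∀ k, ContDiff ℝ ∞ (ψ k) := fun k => by
    rw [contDiff_infty_iff_deriv, hψderiv]
    exact ⟨fun t => (hψd k t).differentiableAt, hGc k⟩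
  have hG0 : ∀ k, ∫ x in (0 : ℝ)..2, G k x = 0 := fun k => by
    simp only [hG]
    rw [intervalIntegral.integral_sub ((hgc j k).continuous.intervalIntegrable _ _)
      ((hgc i k).continuous.intervalIntegrable _ _)]
    simp only [hg]
    rw [bumpApprox_integral _ (((i : ℝ) - 1 / 2) * h), sub_self]
  have hψp : ∀ k, Function.Periodic (ψ k) 2 := fun k x => by
    have h1 := intervalIntegral.integral_add_adjacent_intervals (μ := volume)
      ((hGcont k).intervalIntegrable 0 x) ((hGcont k).intervalIntegrable x (x + 2))
    have h2 := (hGp k).intervalIntegral_add_eq x 0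
    rw [zero_add, hG0 k] at h2
    simp only [hψ]
    linarith
  have hlim : ∀ f : ℝ → ℝ, IsLocL2 f → Function.Periodic f 2 →
      Tendsto (fun k => ∫ x in (0 : ℝ)..2, f x * G k x) atTop
        (𝓝 (h * (cellMean h f j - cellMean h f i))) := by
    intro f hf hp
    have h1 := (tendsto_integral_mul_cellBump hf hp hh hh2 j).sub
      (tendsto_integral_mul_cellBump hf hp hh hh2 i)
    rw [← mul_sub] at h1
    refine h1.congr fun k => ?_
    rw [← intervalIntegral.integral_sub
      (hf.mul_integrable (IsLocL2.of_continuous (hgc j k).continuous) _ _)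
      (hf.mul_integrable (IsLocL2.of_continuous (hgc i k).continuous) _ _)]
    simp only [hG, mul_sub, hg]
  have hsub : uIcc s t ⊆ Icc 0 T := uIcc_subset_Icc hs ht
  have hL := hlim _ (IsLocL2.of_continuous (primitive_continuous hw.curve_w hs ht))
    (primitive_periodic hT hw hs ht)
  obtain ⟨M, hM⟩ := hw.curve_z.abs_pairing_le
  have hR : Tendsto (fun k => ∫ r in s..t, ∫ x in (0 : ℝ)..2, z r x * G k x) atTop
      (𝓝 (∫ r in s..t, h * (cellMean h (z r) j - cellMean h (z r) i))) := by
    refine intervalIntegral.tendsto_integral_filter_of_dominated_convergence (fun _ => M)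
      (Eventually.of_forall fun k => ?_) (Eventually.of_forall fun k =>
        Eventually.of_forall fun r hr => ?_) (by simp) (Eventually.of_forall fun r hr => ?_)
    · refine ((hw.curve_z.continuousOn_pairing (hGcont k).aestronglyMeasurable
        (hGb k)).mono (uIoc_subset_uIcc.trans hsub)).aestronglyMeasurable measurableSet_uIoc
    · exact hM r (hsub (uIoc_subset_uIcc hr)) _ (hGcont k).aestronglyMeasurable (hGb k)
    · have hr' := hsub (uIoc_subset_uIcc hr)
      exact hlim _ (hw.curve_z.loc r hr') (hw.curve_z.periodic r hr')
  have heq : ∀ k, ∫ x in (0 : ℝ)..2, primitive w s t x * G k x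
      = ∫ r in s..t, ∫ x in (0 : ℝ)..2, z r x * G k x := fun k => by
    have := hw.integral_primitive_mul_deriv hT (hψs k) (hψp k) hs ht
    simpa only [hψderiv k] using this
  simp only [heq] at hL
  have := tendsto_nhds_unique hL hR
  rw [intervalIntegral.integral_const_mul] at this
  exact mul_left_cancel₀ hh.ne' this

/-! ### Node defects and the centered form of the exact evolution -/

/-- The deviation of the primitive at a node from the average of the adjacent cell means. -/
def nodeDefect (h : ℝ) (w : ℝ → ℝ → ℝ) (s t : ℝ) (j : ℤ) : ℝ :=
  primitive w s t ((j : ℝ) * h) -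
    (cellMean h (primitive w s t) j + cellMean h (primitive w s t) (j + 1)) / 2

theorem nodeDefect_periodic (hT : 0 < T) (hw : IsWeakPair T w₀ w z) {n : ℕ} {h : ℝ}
    (hn : n * h = 2) {s t : ℝ} (hs : s ∈ Icc 0 T) (ht : t ∈ Icc 0 T) :
    IsGridPeriodic n (nodeDefect h w s t) := by
  have hp := primitive_periodic hT hw hs ht
  have hm := cellMean_periodic hn hp
  intro j
  unfold nodeDefect
  rw [hm j, show j + (n : ℤ) + 1 = j + 1 + n by ring, hm (j + 1)]
  congr 1
  push_cast
  rw [show ((j : ℝ) + n) * h = j * h + 2 by rw [← hn]; ring, hp]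

/-- The increment of a cell integral of w is the difference of the primitive at two nodes. Replacing
each nodal value by the average of adjacent cell means leaves half the difference of the cell means
j + 1 and j − 1, to which `flux` applies. This is why a centered scheme matches the exact solution
without traces of z. -/
theorem cellMean_sub_eq (hT : 0 < T) (hw : IsWeakPair T w₀ w z) {h : ℝ} (hh : 0 < h)
    (hh2 : h ≤ 2) {s t : ℝ} (hs : s ∈ Icc 0 T) (ht : t ∈ Icc 0 T) (j : ℤ) :
    h * (cellMean h (w t) j - cellMean h (w s) j) =
      (1 / 2) * (∫ r in s..t, (cellMean h (z r) (j + 1) - cellMean h (z r) (j - 1)))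
        + nodeDefect h w s t j - nodeDefect h w s t (j - 1) := by
  rw [← cellMean_sub (hw.curve_w.loc t ht) (hw.curve_w.loc s hs), ← cellMean_integral hh,
    ← primitive_sub hw.curve_w hs ht, ← hw.flux hT hh hh2 hs ht]
  unfold nodeDefect
  push_cast
  rw [show j - 1 + 1 = j by ring]
  ring

/-- A continuous function that stays within `M` of its value at an endpoint of a cell has a cell
mean within `M` of this value. -/
theorem abs_sub_cellMean_le {h : ℝ} (hh : 0 < h) {f : ℝ → ℝ} (hf : Continuous f) (j : ℤ)
    {y M : ℝ} (hM : ∀ x ∈ Icc (((j : ℝ) - 1) * h) ((j : ℝ) * h), |y - f x| ≤ M) :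
    |y - cellMean h f j| ≤ M := by
  have h1 : y - cellMean h f j = cellMean h (fun x => y - f x) j := by
    rw [cellMean_sub (IsLocL2.const y) (IsLocL2.of_continuous hf)]
    congr 1
    unfold cellMean
    simp only [intervalIntegral.integral_const, smul_eq_mul]
    field_simp
    ring
  rw [h1]
  unfold cellMean
  have := intervalIntegral.norm_integral_le_of_norm_le_const (a := ((j : ℝ) - 1) * h)
    (b := (j : ℝ) * h) (f := fun x => y - f x) (C := M) fun x hx => by
      rw [uIoc_of_le (cell_le hh j)] at hx
      exact hM x ⟨hx.1.le, hx.2⟩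
  rw [show (j : ℝ) * h - ((j : ℝ) - 1) * h = h by ring, abs_of_pos hh, Real.norm_eq_abs] at this
  rw [abs_mul, abs_of_pos (by positivity : 0 < 1 / h), one_div, inv_mul_le_iff₀ hh]
  linarith

theorem sq_primitive_sub_le (hw : IsL2Curve T w) {s t : ℝ} (hs : s ∈ Icc 0 T)
    (ht : t ∈ Icc 0 T) {a b x y : ℝ} (hab : a ≤ b) (hx : x ∈ Icc a b) (hy : y ∈ Icc a b) :
    (primitive w s t y - primitive w s t x) ^ 2 ≤
      (b - a) * ∫ r in a..b, (w t r - w s r) ^ 2 := by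
  wlog hxy : x ≤ y generalizing x y
  · have := this hy hx (le_of_not_ge hxy)
    rwa [← neg_sq, neg_sub] at this
  have hδ := (hw.loc t ht).sub (hw.loc s hs)
  rw [primitive_sub hw hs ht]
  have h2 : 0 ≤ ∫ r in x..y, (w t r - w s r) ^ 2 :=
    intervalIntegral.integral_nonneg hxy fun _ _ => sq_nonneg _
  have h3 : ∫ r in x..y, (w t r - w s r) ^ 2 ≤ ∫ r in a..b, (w t r - w s r) ^ 2 :=
    intervalIntegral.integral_mono_interval hx.1 hxy hy.2
      (Eventually.of_forall fun _ => sq_nonneg _) (hδ.sq a b)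
  refine (hδ.sq_integral_le hxy).trans ?_
  exact mul_le_mul (by linarith [hx.1, hy.2]) h3 h2 (by linarith)

/-- Cauchy–Schwarz on the two cells next to each node; every cell is used from both of its ends,
which gives the factor 2. -/
theorem cellSum_sq_node_le (hw : IsL2Curve T w) {n : ℕ} {h : ℝ} (hh : 0 < h)
    (hn : n * h = 2) {s t : ℝ} (hs : s ∈ Icc 0 T) (ht : t ∈ Icc 0 T) :
    cellSum n (fun j =>
      (primitive w s t ((j : ℝ) * h) - cellMean h (primitive w s t) j) ^ 2 +
      (primitive w s t ((j : ℝ) * h) - cellMean h (primitive w s t) (j + 1)) ^ 2)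
      ≤ 2 * h * sqNorm (fun x => w t x - w s x) := by
  have hδ := (hw.loc t ht).sub (hw.loc s hs)
  have hp : Function.Periodic (fun x => (w t x - w s x) ^ 2) 2 := fun x => by
    simp only [hw.periodic t ht x, hw.periodic s hs x]
  set I : ℤ → ℝ := fun j => ∫ x in (((j : ℝ) - 1) * h)..((j : ℝ) * h), (w t x - w s x) ^ 2 with hI
  have hIp : IsGridPeriodic n I := fun j => by
    have := cellMean_periodic hn hp j
    simp only [hI]
    rw [cellMean_integral hh, cellMean_integral hh, this]
  have hI0 : ∀ j, 0 ≤ I j := fun j =>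
    intervalIntegral.integral_nonneg (cell_le hh j) fun _ _ => sq_nonneg _
  have hc := primitive_continuous hw hs ht
  have key : ∀ i j : ℤ, (j : ℝ) * h ∈ Icc (((i : ℝ) - 1) * h) ((i : ℝ) * h) →
      (primitive w s t ((j : ℝ) * h) - cellMean h (primitive w s t) i) ^ 2 ≤ h * I i := by
    intro i j hl
    have b : |primitive w s t ((j : ℝ) * h) - cellMean h (primitive w s t) i|
        ≤ Real.sqrt (h * I i) := by
      refine abs_sub_cellMean_le hh hc i fun x hx => Real.abs_le_sqrt ?_
      have := sq_primitive_sub_le hw hs ht (cell_le hh i) hx hl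
      rwa [show (i : ℝ) * h - ((i : ℝ) - 1) * h = h by ring] at this
    have := sq_le_sq' (abs_le.1 b).1 (abs_le.1 b).2
    rwa [Real.sq_sqrt (mul_nonneg hh.le (hI0 _))] at this
  have key2 : ∀ j : ℤ, (primitive w s t ((j : ℝ) * h) - cellMean h (primitive w s t) j) ^ 2 +
      (primitive w s t ((j : ℝ) * h) - cellMean h (primitive w s t) (j + 1)) ^ 2
      ≤ h * (I j + I (j + 1)) := fun j => by
    rw [mul_add]
    refine add_le_add (key j j (right_mem_Icc.2 (cell_le hh j))) (key (j + 1) j ?_)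
    push_cast
    constructor <;> nlinarith
  refine (cellSum_mono key2).trans (le_of_eq ?_)
  rw [cellSum_mul, cellSum_add, cellSum_shift hIp]
  simp only [hI]
  rw [cellSum_integral hn hp hδ.sq]
  unfold sqNorm
  ring

theorem cellSum_sq_nodeDefect_le (hw : IsL2Curve T w) {n : ℕ} {h : ℝ} (hh : 0 < h)
    (hn : n * h = 2) {s t : ℝ} (hs : s ∈ Icc 0 T) (ht : t ∈ Icc 0 T) :
    cellSum n (fun j => nodeDefect h w s t j ^ 2) ≤ h * sqNorm (fun x => w t x - w s x) := by
  have h1 := cellSum_sq_node_le hw hh hn hs ht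
  have h2 : cellSum n (fun j => nodeDefect h w s t j ^ 2) ≤ cellSum n (fun j => (1 / 2) *
      ((primitive w s t ((j : ℝ) * h) - cellMean h (primitive w s t) j) ^ 2 +
      (primitive w s t ((j : ℝ) * h) - cellMean h (primitive w s t) (j + 1)) ^ 2)) := by
    refine cellSum_mono fun j => ?_
    unfold nodeDefect
    nlinarith [sq_nonneg (cellMean h (primitive w s t) j - cellMean h (primitive w s t) (j + 1))]
  rw [cellSum_mul] at h2
  linarith

/-- By `flux`, each summand is the square of a difference of two deviations from the same nodal
value. The point is the exchange: spatial jumps of z, integrated in time, are paid for by time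
increments of w. This bounds the viscous term in `IsHolderSolution.consistency`. -/
theorem cellSum_sq_flux_le (hT : 0 < T) (hw : IsWeakPair T w₀ w z) {n : ℕ} {h : ℝ} (hh : 0 < h)
    (hn : n * h = 2) (hh2 : h ≤ 2) {s t : ℝ} (hs : s ∈ Icc 0 T) (ht : t ∈ Icc 0 T) :
    cellSum n (fun j => (∫ r in s..t, (cellMean h (z r) (j + 1) - cellMean h (z r) j)) ^ 2)
      ≤ 4 * h * sqNorm (fun x => w t x - w s x) := by
  have h1 := cellSum_sq_node_le hw.curve_w hh hn hs ht
  have h2 : cellSum n (fun j => (∫ r in s..t, (cellMean h (z r) (j + 1) - cellMean h (z r) j)) ^ 2)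
      ≤ cellSum n (fun j => 2 *
      ((primitive w s t ((j : ℝ) * h) - cellMean h (primitive w s t) j) ^ 2 +
      (primitive w s t ((j : ℝ) * h) - cellMean h (primitive w s t) (j + 1)) ^ 2)) := by
    refine cellSum_mono fun j => ?_
    rw [← hw.flux hT hh hh2 hs ht]
    nlinarith [sq_nonneg (2 * primitive w s t ((j : ℝ) * h) - cellMean h (primitive w s t) j -
      cellMean h (primitive w s t) (j + 1))]
  rw [cellSum_mul] at h2
  linarith

end IsWeakPair

/-! ### Continuity in time from continuity in space -/

theorem mul_le_young {ε : ℝ} (hε : 0 < ε) (x y : ℝ) : x * y ≤ ε * x ^ 2 + 1 / (4 * ε) * y ^ 2 := by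
  have h : ε * x ^ 2 + 1 / (4 * ε) * y ^ 2 - x * y = (2 * ε * x - y) ^ 2 / (4 * ε) := by
    field_simp; ring
  have : 0 ≤ (2 * ε * x - y) ^ 2 / (4 * ε) := by positivity
  linarith

theorem cellSum_mul_le_young {ε : ℝ} (hε : 0 < ε) (n : ℕ) (f g : ℤ → ℝ) :
    cellSum n (fun j => f j * g j) ≤
      ε * cellSum n (fun j => f j ^ 2) + 1 / (4 * ε) * cellSum n (fun j => g j ^ 2) := by
  rw [← cellSum_mul, ← cellSum_mul, ← cellSum_add]
  exact cellSum_mono fun j => mul_le_young hε _ _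

/-- Summation by parts. -/
theorem cellSum_mul_sub {n : ℕ} {f g : ℤ → ℝ} (hf : IsGridPeriodic n f) (hg : IsGridPeriodic n g) :
    cellSum n (fun j => f j * (g j - g (j - 1))) =
      - cellSum n (fun j => g j * (f (j + 1) - f j)) := by
  have h : IsGridPeriodic n (fun j => f (j + 1) * g j) := fun j => by
    beta_reduce
    rw [show j + (n : ℤ) + 1 = j + 1 + n by ring, hf, hg]
  have := cellSum_shift_sub h
  simp only [sub_add_cancel] at this
  have e1 : cellSum n (fun j => f j * (g j - g (j - 1)))
      = cellSum n (fun j => f j * g j) - cellSum n (fun j => f j * g (j - 1)) := by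
    rw [← cellSum_sub]; congr 1; funext j; ring
  have e2 : cellSum n (fun j => g j * (f (j + 1) - f j))
      = cellSum n (fun j => f (j + 1) * g j) - cellSum n (fun j => f j * g j) := by
    rw [← cellSum_sub]; congr 1; funext j; ring
  rw [e1, e2, this]
  ring

theorem IsGridPeriodic.sub {n : ℕ} {f g : ℤ → ℝ} (hf : IsGridPeriodic n f)
    (hg : IsGridPeriodic n g) : IsGridPeriodic n (fun j => f j - g j) := fun j => by
  simp only [hf j, hg j]

theorem IsGridPeriodic.shift {n : ℕ} {f : ℤ → ℝ} (hf : IsGridPeriodic n f) (m : ℤ) :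
    IsGridPeriodic n (fun j => f (j + m)) := fun j => by
  beta_reduce
  rw [show j + (n : ℤ) + m = j + m + n by ring, hf]

theorem IsGridPeriodic.comp {n : ℕ} {f : ℤ → ℝ} (hf : IsGridPeriodic n f) (F : ℝ → ℝ) :
    IsGridPeriodic n (fun j => F (f j)) := fun j => by
  simp only [hf j]

theorem cellSum_sq_sub_le (n : ℕ) (f g : ℤ → ℝ) :
    cellSum n (fun j => (f j - g j) ^ 2) ≤
      2 * cellSum n (fun j => f j ^ 2) + 2 * cellSum n (fun j => g j ^ 2) := by
  rw [← cellSum_mul, ← cellSum_mul, ← cellSum_add]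
  exact cellSum_mono fun j => by nlinarith [sq_nonneg (f j + g j)]

theorem cellSum_sq_add_le (n : ℕ) (f g : ℤ → ℝ) :
    cellSum n (fun j => (f j + g j) ^ 2) ≤
      2 * cellSum n (fun j => f j ^ 2) + 2 * cellSum n (fun j => g j ^ 2) := by
  rw [← cellSum_mul, ← cellSum_mul, ← cellSum_add]
  exact cellSum_mono fun j => by nlinarith [sq_nonneg (f j - g j)]

theorem integral_mul_stepFn {n : ℕ} {h : ℝ} (hh : 0 < h) (hn : n * h = 2) (hn0 : 0 < n)
    {f : ℝ → ℝ} (hf : IsLocL2 f) (hp : Function.Periodic f 2) {U : ℤ → ℝ}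
    (hU : IsGridPeriodic n U) :
    ∫ x in (0 : ℝ)..2, f x * stepFn h U x = cellSum n (fun j => U j * (h * cellMean h f j)) := by
  have hs := stepFn_isLocL2 hn0 h hU
  have hsp := stepFn_periodic hh hn hU
  rw [← cellSum_integral hn (fun x => by simp only [hp x, hsp x]) (hf.mul_integrable hs)]
  congr 1
  funext j
  rw [cell_integral_congr_stepFn hh U (fun x y => f x * y), intervalIntegral.integral_mul_const,
    cellMean_integral hh, mul_comm]

theorem cellSum_integral_comm {n : ℕ} {s t : ℝ} (F : ℝ → ℤ → ℝ)
    (hF : ∀ j, IntervalIntegrable (fun r => F r j) volume s t) :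
    cellSum n (fun j => ∫ r in s..t, F r j) = ∫ r in s..t, cellSum n (F r) := by
  unfold cellSum
  exact (intervalIntegral.integral_finsetSum fun (i : ℕ) _ => hF i).symm

theorem IsL2Curve.intervalIntegrable_cellMean {T : ℝ} {w : ℝ → ℝ → ℝ} (hw : IsL2Curve T w)
    {n : ℕ} {h : ℝ} (hh : 0 < h) (hn : n * h = 2) (j : ℤ) {s t : ℝ} (hs : s ∈ Icc 0 T)
    (ht : t ∈ Icc 0 T) : IntervalIntegrable (fun r => cellMean h (w r) j) volume s t :=
  ((hw.continuousOn_cellMean hh hn j).mono (uIcc_subset_Icc hs ht)).intervalIntegrable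

set_option maxHeartbeats 800000 in
/-- The time increments in a pair `(b f)_t = z_x`, on a mesh of size `h`. -/
theorem IsWeakPair.sqNorm_increment_le {T : ℝ} (hT : 0 < T) {w₀ : ℝ → ℝ} {f z : ℝ → ℝ → ℝ}
    {b : ℝ → ℝ} (hw : IsWeakPair T w₀ (fun t x => b x * f t x) z) (hf : IsL2Curve T f)
    {b_lo b_hi : ℝ} (hb0 : 0 < b_lo) (hb : ∀ x, b_lo ≤ b x ∧ b x ≤ b_hi)
    {γ K : ℝ} {n : ℕ} {h : ℝ} (hh : 0 < h) (hn : n * h = 2)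
    (hfm : ∀ t ∈ Ioo 0 T, HasModulus γ K 0 (f t)) (hzm : ∀ t ∈ Ioo 0 T, HasModulus γ K 0 (z t))
    {s t : ℝ} (hs : s ∈ Ioo 0 T) (ht : t ∈ Ioo 0 T) (hst : s < t) :
    sqNorm (fun x => f t x - f s x) ≤
      (2 / b_lo) * (24 * b_hi ^ 2 / b_lo + 1 / b_lo) * |K| *
        (h ^ (2 * γ) + (t - s) ^ 2 * (h ^ (2 * γ) / h ^ 2)) := by
  have hs' := Ioo_subset_Icc_self hs
  have ht' := Ioo_subset_Icc_self ht
  have hn0 : 0 < n := by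
    rcases Nat.eq_zero_or_pos n with h0 | h0
    · rw [h0] at hn; norm_num at hn
    · exact h0
  have hn1 : (1 : ℝ) ≤ n := by exact_mod_cast hn0
  have hh2 : h ≤ 2 := by nlinarith
  have hbhi : 0 < b_hi := hb0.trans_le ((hb 0).1.trans (hb 0).2)
  set W : ℝ → ℝ → ℝ := fun t x => b x * f t x with hW
  set P := h ^ (2 * γ) with hP
  have hP0 : 0 ≤ P := by positivity
  have lt := hf.loc t ht'
  have ls := hf.loc s hs'
  have pt := hf.periodic t ht'
  have ps := hf.periodic s hs'
  have lδ := lt.sub ls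
  have lW := (hw.curve_w.loc t ht').sub (hw.curve_w.loc s hs')
  have pW : Function.Periodic (fun x => W t x - W s x) 2 := fun x => by
    simp only [hw.curve_w.periodic t ht' x, hw.curve_w.periodic s hs' x]
  set X := sqNorm (fun x => f t x - f s x) with hX
  have hX0 : 0 ≤ X := sqNorm_nonneg _
  have hWX : sqNorm (fun x => W t x - W s x) ≤ b_hi ^ 2 * X := by
    refine sqNorm_mono lW lδ _ fun x => ?_
    simp only [hW]
    rw [← mul_sub, mul_pow]
    have := pow_le_pow_left₀ (hb0.le.trans (hb x).1) (hb x).2 2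
    gcongr
  set F : ℤ → ℝ := fun j => cellMean h (f t) j - cellMean h (f s) j with hF
  have hFp : IsGridPeriodic n F := (cellMean_periodic hn pt).sub (cellMean_periodic hn ps)
  have hFX : cellSum n (fun j => h * F j ^ 2) ≤ X := by
    have := cellSum_sq_cellMean_le hh hn (f := fun x => f t x - f s x)
      (fun x => by simp only [pt x, ps x]) lδ
    simpa only [cellMean_sub lt ls] using this
  have lF := stepFn_isLocL2 hn0 h hFp
  -- Splitting the test function: the equation is available on the step function of cell means `F`,
  -- and the remainder is of order h^γ by the modulus of f.
  set R : ℝ → ℝ := fun x => f t x - f s x - stepFn h F x with hR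
  have lR : IsLocL2 R := lδ.sub lF
  have hRb : sqNorm R ≤ 8 * |K| * P := by
    have h1 := (hfm t ht).sqNorm_sub_cellProj_le pt lt hh hn hn0
    have h2 := (hfm s hs).sqNorm_sub_cellProj_le ps ls hh hn hn0
    have l1 : IsLocL2 (fun x => f t x - cellProj h (f t) x) :=
      lt.sub (stepFn_isLocL2 hn0 h (cellMean_periodic hn pt))
    have l2 : IsLocL2 (fun x => cellProj h (f s) x - f s x) :=
      (stepFn_isLocL2 hn0 h (cellMean_periodic hn ps)).sub ls
    have h3 := sqNorm_add_le l1 l2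
    rw [sqNorm_sub_comm (cellProj h (f s))] at h3
    have e : R = fun x => f t x - cellProj h (f t) x + (cellProj h (f s) x - f s x) := by
      funext x
      simp only [hR, cellProj, stepFn, hF]
      ring
    rw [e]
    linarith
  set κ := nodeDefect h W s t with hκ
  have hκp : IsGridPeriodic n κ := nodeDefect_periodic hT hw hn hs' ht'
  have hκb : cellSum n (fun j => κ j ^ 2) ≤ h * (b_hi ^ 2 * X) :=
    (cellSum_sq_nodeDefect_le hw.curve_w hh hn hs' ht').trans
      (mul_le_mul_of_nonneg_left hWX hh.le)
  -- the increment tested against itself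
  have hlow : b_lo * X ≤ ∫ x in (0 : ℝ)..2, (W t x - W s x) * (f t x - f s x) := by
    rw [hX]
    unfold sqNorm
    rw [← intervalIntegral.integral_const_mul]
    refine intervalIntegral.integral_mono_on (by norm_num) ((lδ.sq 0 2).const_mul _)
      (lW.mul_integrable lδ 0 2) fun x _ => ?_
    simp only [hW]
    rw [← mul_sub, mul_assoc, ← sq]
    exact mul_le_mul_of_nonneg_right (hb x).1 (sq_nonneg _)
  have hsplit : ∫ x in (0 : ℝ)..2, (W t x - W s x) * (f t x - f s x) =
      (∫ x in (0 : ℝ)..2, (W t x - W s x) * R x) +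
        cellSum n (fun j => F j * (h * cellMean h (fun x => W t x - W s x) j)) := by
    rw [← integral_mul_stepFn hh hn hn0 lW pW hFp,
      ← intervalIntegral.integral_add (lW.mul_integrable lR 0 2) (lW.mul_integrable lF 0 2)]
    congr 1
    funext x
    simp only [hR]
    ring
  -- Chosen so that ε times the squared increment of b f is at most b_lo/8 times `X`.
  set ε := b_lo / (8 * b_hi ^ 2) with hε
  have hε0 : 0 < ε := by positivity
  have hεb : ε * b_hi ^ 2 = b_lo / 8 := by rw [hε]; field_simp
  have hb1 : ∫ x in (0 : ℝ)..2, (W t x - W s x) * R x ≤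
      b_lo / 8 * X + 1 / (4 * ε) * (8 * |K| * P) := by
    have h1 : ∫ x in (0 : ℝ)..2, (W t x - W s x) * R x ≤
        ε * sqNorm (fun x => W t x - W s x) + 1 / (4 * ε) * sqNorm R := by
      unfold sqNorm
      rw [← intervalIntegral.integral_const_mul, ← intervalIntegral.integral_const_mul,
        ← intervalIntegral.integral_add ((lW.sq 0 2).const_mul _) ((lR.sq 0 2).const_mul _)]
      exact intervalIntegral.integral_mono_on (by norm_num) (lW.mul_integrable lR 0 2)
        (((lW.sq 0 2).const_mul _).add ((lR.sq 0 2).const_mul _)) fun x _ => mul_le_young hε0 _ _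
    refine h1.trans (add_le_add ?_ ?_)
    · rw [← hεb, mul_assoc]
      exact mul_le_mul_of_nonneg_left hWX hε0.le
    · exact mul_le_mul_of_nonneg_left hRb (by positivity)
  have hzi : ∀ j, IntervalIntegrable (fun r => cellMean h (z r) j) volume s t := fun j =>
    hw.curve_z.intervalIntegrable_cellMean hh hn j hs' ht'
  have hsum : cellSum n (fun j => F j * (h * cellMean h (fun x => W t x - W s x) j)) =
      (∫ r in s..t, cellSum n (fun j =>
        F j * ((cellMean h (z r) (j + 1) - cellMean h (z r) (j - 1)) / 2))) +
        cellSum n (fun j => F j * (κ j - κ (j - 1))) := by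
    rw [← cellSum_integral_comm _ fun j => (((hzi (j + 1)).sub (hzi (j - 1))).div_const 2).const_mul
      (F j), ← cellSum_add]
    congr 1
    funext j
    rw [cellMean_sub (hw.curve_w.loc t ht') (hw.curve_w.loc s hs'),
      hw.cellMean_sub_eq hT hh hh2 hs' ht', intervalIntegral.integral_const_mul,
      intervalIntegral.integral_div]
    ring
  have hb2 : cellSum n (fun j => F j * (κ j - κ (j - 1))) ≤
      b_lo / 8 * X + 1 / (4 * ε) * (4 * |K| * P) := by
    -- By parts the difference falls on `F`, whose jumps are controlled by the modulus. The defects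
    -- have squared sum of order h X, so Young's inequality takes the weight ε/h.
    rw [cellSum_mul_sub hFp hκp]
    have h1 := cellSum_mul_le_young (div_pos hε0 hh) n (fun j => κ j)
      (fun j => - (F (j + 1) - F j))
    have e1 : cellSum n (fun j => κ j * (-(F (j + 1) - F j))) =
        - cellSum n (fun j => κ j * (F (j + 1) - F j)) := by
      rw [← neg_one_mul, ← cellSum_mul]; congr 1; funext j; ring
    rw [e1] at h1
    have h2 : ε / h * cellSum n (fun j => κ j ^ 2) ≤ b_lo / 8 * X := by
      refine (mul_le_mul_of_nonneg_left hκb (by positivity)).trans (le_of_eq ?_)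
      rw [← hεb]; field_simp
    have h3 : cellSum n (fun j => h * (-(F (j + 1) - F j)) ^ 2) ≤ 4 * |K| * P := by
      have m1 := (hfm t ht).cellSum_sq_diff_le pt lt hh hn
      have m2 := (hfm s hs).cellSum_sq_diff_le ps ls hh hn
      have m3 := cellSum_sq_sub_le n (fun j => cellMean h (f t) (j + 1) - cellMean h (f t) j)
        (fun j => cellMean h (f s) (j + 1) - cellMean h (f s) j)
      rw [cellSum_mul] at m1 m2 ⊢
      have e : ∀ j, (-(F (j + 1) - F j)) ^ 2 = (cellMean h (f t) (j + 1) - cellMean h (f t) j -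
          (cellMean h (f s) (j + 1) - cellMean h (f s) j)) ^ 2 := fun j => by
        simp only [hF]; ring
      simp only [e]
      nlinarith
    rw [cellSum_mul] at h3
    have h4 : 1 / (4 * (ε / h)) * cellSum n (fun j => (-(F (j + 1) - F j)) ^ 2) =
        1 / (4 * ε) * (h * cellSum n (fun j => (-(F (j + 1) - F j)) ^ 2)) := by
      field_simp
    rw [h4] at h1
    have h5 := mul_le_mul_of_nonneg_left h3 (by positivity : 0 ≤ 1 / (4 * ε))
    linarith
  have hts : 0 < t - s := sub_pos.2 hst
  have hb3 : ∫ r in s..t, cellSum n (fun j =>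
        F j * ((cellMean h (z r) (j + 1) - cellMean h (z r) (j - 1)) / 2)) ≤
      b_lo / 4 * X + (t - s) ^ 2 / b_lo * (|K| * (P / h ^ 2)) := by
    -- Integrated over [s, t] this weight costs exactly b_lo/4 times `X`.
    set θ := b_lo / (4 * (t - s)) with hθ
    have hθ0 : 0 < θ := by positivity
    have hpt : ∀ r ∈ Icc s t, cellSum n (fun j =>
        F j * ((cellMean h (z r) (j + 1) - cellMean h (z r) (j - 1)) / 2)) ≤
        θ * X + 1 / (4 * θ) * (|K| * (P / h ^ 2)) := by
      intro r hr
      have hr1 : r ∈ Ioo 0 T := ⟨hs.1.trans_le hr.1, hr.2.trans_lt ht.2⟩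
      have hr2 := Ioo_subset_Icc_self hr1
      have lz := hw.curve_z.loc r hr2
      have pz := hw.curve_z.periodic r hr2
      set m := cellMean h (z r) with hm
      have hmp : IsGridPeriodic n m := cellMean_periodic hn pz
      have m1 := (hzm r hr1).cellSum_sq_diff_le pz lz hh hn
      rw [← hm, ← hP] at m1
      have h1 := cellSum_mul_le_young (mul_pos hθ0 hh) n F (fun j => (m (j + 1) - m (j - 1)) / 2)
      have h2 : cellSum n (fun j => ((m (j + 1) - m (j - 1)) / 2) ^ 2) ≤
          cellSum n (fun j => (m (j + 1) - m j) ^ 2) := by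
        have e1 : cellSum n (fun j => (m j - m (j - 1)) ^ 2) =
            cellSum n (fun j => (m (j + 1) - m j) ^ 2) := by
          have hq : IsGridPeriodic n (fun j => (m (j + 1) - m j) ^ 2) :=
            ((hmp.shift 1).sub hmp).comp (· ^ 2)
          rw [← cellSum_shift_sub hq]
          simp
        have e2 : cellSum n (fun j => ((m (j + 1) - m (j - 1)) / 2) ^ 2) ≤
            (1 / 2) * cellSum n (fun j => (m (j + 1) - m j) ^ 2) +
            (1 / 2) * cellSum n (fun j => (m j - m (j - 1)) ^ 2) := by
          rw [← cellSum_mul, ← cellSum_mul, ← cellSum_add]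
          exact cellSum_mono fun j => by
            nlinarith [sq_nonneg ((m (j + 1) - m j) - (m j - m (j - 1)))]
        rw [e1] at e2
        linarith
      rw [cellSum_mul] at hFX m1
      have h3 : cellSum n (fun j => (m (j + 1) - m j) ^ 2) ≤ |K| * P / h := by
        rw [le_div_iff₀ hh]; linarith
      have h4 : θ * h * cellSum n (fun j => F j ^ 2) ≤ θ * X := by
        rw [mul_assoc]; exact mul_le_mul_of_nonneg_left hFX hθ0.le
      have h5 : 1 / (4 * (θ * h)) * cellSum n (fun j => ((m (j + 1) - m (j - 1)) / 2) ^ 2) ≤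
          1 / (4 * θ) * (|K| * (P / h ^ 2)) := by
        refine (mul_le_mul_of_nonneg_left (h2.trans h3) (by positivity)).trans (le_of_eq ?_)
        field_simp
      linarith
    have hint : IntervalIntegrable (fun r => cellSum n (fun j =>
        F j * ((cellMean h (z r) (j + 1) - cellMean h (z r) (j - 1)) / 2))) volume s t := by
      unfold cellSum
      have := IntervalIntegrable.sum (μ := volume) (a := s) (b := t) (Finset.range n)
        (f := fun (i : ℕ) r => F i * ((cellMean h (z r) (i + 1) - cellMean h (z r) (i - 1)) / 2))
        fun i _ => (((hzi (i + 1)).sub (hzi (i - 1))).div_const 2).const_mul (F i)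
      simpa only [Finset.sum_fn] using this
    refine (intervalIntegral.integral_mono_on hst.le hint (by simp) hpt).trans (le_of_eq ?_)
    rw [intervalIntegral.integral_const, smul_eq_mul, hθ]
    field_simp
  -- The three contributions b_lo/8, b_lo/8 and b_lo/4 are absorbed into the coercive term b_lo X,
  -- and one half of it remains.
  have hfin : b_lo / 2 * X ≤ 1 / (4 * ε) * (12 * |K| * P) +
      (t - s) ^ 2 / b_lo * (|K| * (P / h ^ 2)) := by
    rw [hsplit, hsum] at hlow
    linarith
  have e3 : 1 / (4 * ε) * (12 * |K| * P) = 24 * b_hi ^ 2 / b_lo * (|K| * P) := by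
    rw [hε]; field_simp; ring
  rw [e3] at hfin
  set Q := (t - s) ^ 2 * (P / h ^ 2) with hQ
  have hQ0 : 0 ≤ Q := by positivity
  have e4 : (t - s) ^ 2 / b_lo * (|K| * (P / h ^ 2)) = 1 / b_lo * (|K| * Q) := by rw [hQ]; ring
  rw [e4] at hfin
  have hX2 : X = (2 / b_lo) * (b_lo / 2 * X) := by field_simp
  rw [hX2]
  have h6 : b_lo / 2 * X ≤ (24 * b_hi ^ 2 / b_lo + 1 / b_lo) * (|K| * (P + Q)) := by
    have a1 : 0 ≤ 24 * b_hi ^ 2 / b_lo * (|K| * Q) := by positivity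
    have a2 : 0 ≤ 1 / b_lo * (|K| * P) := by positivity
    have a3 : (24 * b_hi ^ 2 / b_lo + 1 / b_lo) * (|K| * (P + Q)) =
        24 * b_hi ^ 2 / b_lo * (|K| * P) + 24 * b_hi ^ 2 / b_lo * (|K| * Q) +
        1 / b_lo * (|K| * P) + 1 / b_lo * (|K| * Q) := by ring
    linarith
  calc (2 / b_lo) * (b_lo / 2 * X)
      ≤ (2 / b_lo) * ((24 * b_hi ^ 2 / b_lo + 1 / b_lo) * (|K| * (P + Q))) :=
        mul_le_mul_of_nonneg_left h6 (by positivity)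
    _ = _ := by ring

/-- Every length below `T` is comparable to a mesh size. -/
theorem exists_mesh_size {T τ : ℝ} (hτ : 0 < τ) (hτT : τ ≤ T) :
    ∃ (n : ℕ) (h : ℝ), 0 < h ∧ n * h = 2 ∧ h ≤ τ ∧ τ / h ≤ (2 + T) / 2 := by
  set n := ⌈2 / τ⌉₊ with hn
  have hn0 : 0 < n := Nat.ceil_pos.2 (by positivity)
  have hnr : (0 : ℝ) < n := by exact_mod_cast hn0
  have h1 : 2 / τ ≤ n := Nat.le_ceil _
  have h2 : (n : ℝ) < 2 / τ + 1 := Nat.ceil_lt_add_one (by positivity)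
  refine ⟨n, 2 / n, by positivity, by field_simp, ?_, ?_⟩
  · rw [div_le_iff₀ hτ] at h1
    rw [div_le_iff₀ hnr]
    linarith
  · have h3 : n * τ < 2 + τ := by
      have := mul_lt_mul_of_pos_right h2 hτ
      rw [add_mul, div_mul_cancel₀ _ hτ.ne'] at this
      linarith
    rw [div_div_eq_mul_div]
    linarith

theorem IsL2Curve.sqNorm_sub_le {T : ℝ} {f : ℝ → ℝ → ℝ} (hf : IsL2Curve T f) {r s t : ℝ}
    (hr : r ∈ Icc 0 T) (hs : s ∈ Icc 0 T) (ht : t ∈ Icc 0 T) :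
    sqNorm (fun x => f r x - f t x) ≤
      2 * sqNorm (fun x => f s x - f r x) + 2 * sqNorm (fun x => f s x - f t x) := by
  have := sqNorm_triangle (hf.loc r hr) (hf.loc s hs) (hf.loc t ht)
  rwa [sqNorm_sub_comm (f r) (f s)] at this

/-- Continuity in time of order `γ` extends from an open interval to its closure. -/
theorem IsL2Curve.holder_extend {T : ℝ} (hT : 0 < T) {f : ℝ → ℝ → ℝ} (hf : IsL2Curve T f)
    {γ C : ℝ} (hγ : 0 < γ)
    (h : ∀ s ∈ Ioo 0 T, ∀ t ∈ Ioo 0 T,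
      sqNorm (fun x => f t x - f s x) ≤ C * |t - s| ^ (2 * γ)) :
    ∀ s ∈ Icc 0 T, ∀ t ∈ Icc 0 T,
      sqNorm (fun x => f t x - f s x) ≤ 4 * C * |t - s| ^ (2 * γ) := by
  -- One of the two times is moved to the closed interval in each pass, and each pass doubles the
  -- constant; two passes give the factor 4.
  have step : ∀ (S : Set ℝ), S ⊆ Icc 0 T → ∀ D : ℝ,
      (∀ s ∈ S, ∀ t ∈ Ioo 0 T, sqNorm (fun x => f t x - f s x) ≤ D * |t - s| ^ (2 * γ)) →
      ∀ s ∈ S, ∀ t ∈ Icc 0 T, sqNorm (fun x => f t x - f s x) ≤ 2 * D * |t - s| ^ (2 * γ) := by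
    intro S hS D hD s hs t ht
    have hne : (𝓝[Ioo 0 T] t).NeBot := by
      rw [← mem_closure_iff_nhdsWithin_neBot, closure_Ioo hT.ne]; exact ht
    have h1 : Tendsto (fun r => sqNorm (fun x => f r x - f t x)) (𝓝[Ioo 0 T] t) (𝓝 0) :=
      (hf.cont t ht).mono_left (nhdsWithin_mono _ Ioo_subset_Icc_self)
    have h2 : Tendsto (fun r => |r - s| ^ (2 * γ)) (𝓝[Ioo 0 T] t) (𝓝 (|t - s| ^ (2 * γ))) := by
      have : Continuous fun r : ℝ => |r - s| ^ (2 * γ) :=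
        (continuous_id.sub continuous_const).abs.rpow_const fun _ => Or.inr (by positivity)
      exact (this.tendsto t).mono_left nhdsWithin_le_nhds
    have h3 := (h1.const_mul 2).add ((h2.const_mul D).const_mul 2)
    rw [mul_zero, zero_add, ← mul_assoc] at h3
    refine ge_of_tendsto h3 ?_
    filter_upwards [self_mem_nhdsWithin] with r hr
    have h4 := hf.sqNorm_sub_le ht (Ioo_subset_Icc_self hr) (hS hs)
    have h5 := hD s hs r hr
    linarith
  have h1 := step (Ioo 0 T) Ioo_subset_Icc_self C h
  have h2 := step (Icc 0 T) le_rfl (2 * C) fun s hs t ht => by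
    have := h1 t ht s hs
    rwa [sqNorm_sub_comm, abs_sub_comm] at this
  intro s hs t ht
  have := h2 s hs t ht
  linarith

/-- In a pair `(b f)_t = z_x`, continuity of order `γ` in space implies the same in time. -/
theorem exists_time_holder {T : ℝ} (hT : 0 < T) {b_lo b_hi : ℝ} (hb0 : 0 < b_lo) {γ : ℝ}
    (hγ : 0 < γ) (K : ℝ) :
    ∃ C, 0 ≤ C ∧ ∀ (b : ℝ → ℝ), (∀ x, b_lo ≤ b x ∧ b x ≤ b_hi) →
      ∀ (w₀ : ℝ → ℝ) (f z : ℝ → ℝ → ℝ),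
      IsWeakPair T w₀ (fun t x => b x * f t x) z → IsL2Curve T f →
      (∀ t ∈ Ioo 0 T, HasModulus γ K 0 (f t)) → (∀ t ∈ Ioo 0 T, HasModulus γ K 0 (z t)) →
      ∀ s ∈ Icc 0 T, ∀ t ∈ Icc 0 T,
        sqNorm (fun x => f t x - f s x) ≤ C * |t - s| ^ (2 * γ) := by
  set D := (2 / b_lo) * (24 * b_hi ^ 2 / b_lo + 1 / b_lo) * |K| with hD
  have hD0 : 0 ≤ D := by positivity
  set D' := D * (1 + ((2 + T) / 2) ^ 2) with hD'
  refine ⟨4 * D', by positivity, fun b hb w₀ f z hw hf hfm hzm => ?_⟩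
  refine hf.holder_extend hT hγ ?_
  have main : ∀ s ∈ Ioo 0 T, ∀ t ∈ Ioo 0 T, s < t →
      sqNorm (fun x => f t x - f s x) ≤ D' * |t - s| ^ (2 * γ) := by
    intro s hs t ht hst
    have hτ : 0 < t - s := sub_pos.2 hst
    -- A mesh size comparable to t − s balances h^(2γ) against (t − s)² h^(2γ−2).
    obtain ⟨n, h, hh, hn, hle, hratio⟩ := exists_mesh_size hτ
      (by linarith [hs.1, ht.2] : t - s ≤ T)
    have h1 := hw.sqNorm_increment_le hT hf hb0 hb hh hn hfm hzm hs ht hst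
    refine h1.trans ?_
    rw [← hD, hD', abs_of_pos hτ, mul_assoc D]
    refine mul_le_mul_of_nonneg_left ?_ hD0
    have e : h ^ (2 * γ) + (t - s) ^ 2 * (h ^ (2 * γ) / h ^ 2) =
        (1 + ((t - s) / h) ^ 2) * h ^ (2 * γ) := by
      field_simp
    rw [e]
    have h2 : h ^ (2 * γ) ≤ (t - s) ^ (2 * γ) := Real.rpow_le_rpow hh.le hle (by positivity)
    have h3 : ((t - s) / h) ^ 2 ≤ ((2 + T) / 2) ^ 2 :=
      pow_le_pow_left₀ (by positivity) hratio 2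
    exact mul_le_mul (by linarith) h2 (by positivity) (by positivity)
  intro s hs t ht
  rcases lt_trichotomy s t with h | h | h
  · exact main s hs t ht h
  · subst h
    have : sqNorm (fun x => f s x - f s x) = 0 := by simp [sqNorm]
    rw [this]
    positivity
  · rw [sqNorm_sub_comm, abs_sub_comm]
    exact main t ht s hs h

/-! ### The discrete energy estimate -/

theorem neg_two_mul_le {A : ℝ} (hA : 0 < A) (f c : ℝ) :
    -(2 * (f * c)) ≤ f ^ 2 / A + A * c ^ 2 := by
  have h1 : f ^ 2 / A + A * c ^ 2 + 2 * (f * c) = (f + A * c) ^ 2 / A := by field_simp; ring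
  have h2 : 0 ≤ (f + A * c) ^ 2 / A := by positivity
  linarith

theorem two_mul_mul_le {h : ℝ} (hh : 0 < h) (R X : ℝ) :
    2 * (R * X) ≤ h / 10 * X ^ 2 + 10 / h * R ^ 2 := by
  have h1 : h / 10 * X ^ 2 + 10 / h * R ^ 2 - 2 * (R * X) = (h * X - 10 * R) ^ 2 / (10 * h) := by
    field_simp; ring
  have h2 : 0 ≤ (h * X - 10 * R) ^ 2 / (10 * h) := by positivity
  linarith

/-- Summation by parts, written cell by cell: the centered coupling of e and f is conservative, the
viscosity yields −h(X² + Y²), and the flux residuals move onto the forward quotients. What remains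
is one expression at a cell minus its value at the preceding cell, so it cancels over a period. -/
theorem energy_telescope {h : ℝ} (hh : h ≠ 0) (e f X Xm Y Ym R Rm S Sm : ℝ) :
    2 * (e * ((Y + Ym) / 2 + (X - Xm) / 2) - e * ((R - Rm) / h)) +
      2 * (f * ((X + Xm) / 2 + (Y - Ym) / 2) - f * ((S - Sm) / h)) =
      -h * (X ^ 2 + Y ^ 2) + 2 * (R * X) + 2 * (S * Y) +
      (((e + h * X) * X + (f + h * Y) * Y + (e * (f + h * Y) + f * (e + h * X)) / h
          - 2 / h * ((e + h * X) * R + (f + h * Y) * S)) -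
        (e * Xm + f * Ym + ((e - h * Xm) * f + (f - h * Ym) * e) / h
          - 2 / h * (e * Rm + f * Sm))) := by
  field_simp
  ring

/-- The cell-wise energy balance of one step of the scheme with flux residuals `R`, `S` and a
source `c`; `X`, `Y` are the forward difference quotients of the errors `e`, `f`, and the suffix
`m` marks values at the preceding cell. -/
theorem energy_balance_cell {h k A : ℝ} (hh : 0 < h) (hk : 0 < k) (hA : 0 < A)
    (h1 : 2 * k * (2 * A + 1) ≤ h) (h2 : 2 * k * (A / 4 + 5 / 4) ≤ h)
    (em e ep fm f fp Rm R Sm S c X Xm Y Ym : ℝ) (hX : h * X = ep - e) (hXm : h * Xm = e - em)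
    (hY : h * Y = fp - f) (hYm : h * Ym = f - fm) :
    (e + k * ((Y + Ym) / 2 + (X - Xm) / 2 - (R - Rm) / h)) ^ 2 +
      (f + k * (A * ((X + Xm) / 2 + (Y - Ym) / 2 - (S - Sm) / h - c))) ^ 2 / A ≤
    (1 + k) * (e ^ 2 + f ^ 2 / A) +
      k * (12 / h * (R ^ 2 + S ^ 2) + 2 / h * (Rm ^ 2 + Sm ^ 2) + (h + A) * c ^ 2) +
      k * ((ep * X + fp * Y + (e * fp + f * ep) / h - 2 / h * (ep * R + fp * S)
          - 9 / 20 * h * (X - Y) ^ 2) -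
        (e * Xm + f * Ym + (em * f + fm * e) / h - 2 / h * (e * Rm + f * Sm)
          - 9 / 20 * h * (Xm - Ym) ^ 2)) := by
  obtain rfl : ep = e + h * X := by linarith
  obtain rfl : em = e - h * Xm := by linarith
  obtain rfl : fp = f + h * Y := by linarith
  obtain rfl : fm = f - h * Ym := by linarith
  set m1 := (Y + Ym) / 2 + (X - Xm) / 2 with hm1
  set m2 := (X + Xm) / 2 + (Y - Ym) / 2 with hm2
  set r := (R - Rm) / h with hr
  set s := (S - Sm) / h with hs
  -- Both right-hand sides `m1`, `m2` are half of X + Y plus or minus half of Xm − Ym, so the same Q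
  -- bounds both squares.
  set Q := (X + Y) ^ 2 + (Xm - Ym) ^ 2 with hQ
  have hQ0 : 0 ≤ Q := by positivity
  have q1 : m1 ^ 2 ≤ Q / 2 := by
    rw [hm1, hQ]; linarith only [sq_nonneg ((X + Y) / 2 - (Ym - Xm) / 2)]
  have q2 : m2 ^ 2 ≤ Q / 2 := by
    rw [hm2, hQ]; linarith only [sq_nonneg ((X + Y) / 2 - (Xm - Ym) / 2)]
  have kA0 : 0 < k * A := mul_pos hk hA
  have kA : k * A ≤ h / 4 := by linarith only [h1, hk]
  have kk : k ≤ 2 / 5 * h := by linarith only [h2, kA0]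
  -- The first CFL bound gives k A + k/2 ≤ h/4, the second k/2 ≤ h/5. That 9/20 is below 1/2 is what
  -- leaves viscosity for the residuals.
  have kkA : k + k * A ≤ 9 / 20 * h := by linarith only [h1, kk]
  have hr2 : r ^ 2 ≤ 2 / h ^ 2 * (R ^ 2 + Rm ^ 2) := by
    rw [hr, div_pow, div_mul_eq_mul_div, div_le_div_iff_of_pos_right (by positivity)]
    linarith only [sq_nonneg (R + Rm)]
  have hs2 : s ^ 2 ≤ 2 / h ^ 2 * (S ^ 2 + Sm ^ 2) := by
    rw [hs, div_pow, div_mul_eq_mul_div, div_le_div_iff_of_pos_right (by positivity)]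
    linarith only [sq_nonneg (S + Sm)]
  have exp1 : (e + k * (m1 - r)) ^ 2 = e ^ 2 + 2 * k * (e * m1 - e * r) + k * (k * (m1 - r) ^ 2) := by
    ring
  have exp2 : (f + k * (A * (m2 - s - c))) ^ 2 / A =
      f ^ 2 / A + 2 * k * (f * m2 - f * s - f * c) + k * (k * A * (m2 - s - c) ^ 2) := by
    field_simp
    ring
  have quad1 : k * (m1 - r) ^ 2 ≤ k * Q + 8 / (5 * h) * (R ^ 2 + Rm ^ 2) := by
    have a1 : (m1 - r) ^ 2 ≤ 2 * m1 ^ 2 + 2 * r ^ 2 := by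
      have a0 : 2 * m1 ^ 2 + 2 * r ^ 2 - (m1 - r) ^ 2 = (m1 + r) ^ 2 := by ring
      have := sq_nonneg (m1 + r)
      linarith only [a0, this]
    have a2 : k * (2 * r ^ 2) ≤ 2 / 5 * h * (2 * (2 / h ^ 2 * (R ^ 2 + Rm ^ 2))) :=
      mul_le_mul kk (by linarith only [hr2]) (by positivity) (by positivity)
    have a3 : 2 / 5 * h * (2 * (2 / h ^ 2 * (R ^ 2 + Rm ^ 2))) =
        8 / (5 * h) * (R ^ 2 + Rm ^ 2) := by field_simp; ring
    have a4 : k * (m1 - r) ^ 2 ≤ k * (2 * m1 ^ 2 + 2 * r ^ 2) := mul_le_mul_of_nonneg_left a1 hk.le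
    have a5 : k * (2 * m1 ^ 2) ≤ k * Q := mul_le_mul_of_nonneg_left (by linarith only [q1]) hk.le
    linarith only [a2, a3, a4, a5]
  have quad2 : k * A * (m2 - s - c) ^ 2 ≤ k * A * Q + 2 / h * (S ^ 2 + Sm ^ 2) + h * c ^ 2 := by
    have a1 : (m2 - s - c) ^ 2 ≤ 2 * m2 ^ 2 + 4 * s ^ 2 + 4 * c ^ 2 := by
      have a0 : 2 * m2 ^ 2 + 4 * s ^ 2 + 4 * c ^ 2 - (m2 - s - c) ^ 2 =
          (m2 + s + c) ^ 2 + 2 * (s - c) ^ 2 := by ring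
      have : 0 ≤ (m2 + s + c) ^ 2 + 2 * (s - c) ^ 2 := by positivity
      linarith only [a0, this]
    have a2 : k * A * (4 * s ^ 2 + 4 * c ^ 2) ≤
        h / 4 * (4 * (2 / h ^ 2 * (S ^ 2 + Sm ^ 2)) + 4 * c ^ 2) :=
      mul_le_mul kA (by linarith only [hs2]) (by positivity) (by positivity)
    have a3 : h / 4 * (4 * (2 / h ^ 2 * (S ^ 2 + Sm ^ 2)) + 4 * c ^ 2) =
        2 / h * (S ^ 2 + Sm ^ 2) + h * c ^ 2 := by field_simp
    have a4 := mul_le_mul_of_nonneg_left a1 kA0.le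
    have a5 : k * A * (2 * m2 ^ 2) ≤ k * A * Q := mul_le_mul_of_nonneg_left (by linarith only [q2]) kA0.le
    linarith only [a2, a3, a4, a5]
  have quadQ : k * Q + k * A * Q ≤ 9 / 20 * h * Q := by
    have := mul_le_mul_of_nonneg_right kkA hQ0
    linarith only [this]
  have src := neg_two_mul_le hA f c
  have yR := two_mul_mul_le hh R X
  have yS := two_mul_mul_le hh S Y
  have c8 : 8 / (5 * h) * (R ^ 2 + Rm ^ 2) ≤ 2 / h * (R ^ 2 + Rm ^ 2) := by
    refine mul_le_mul_of_nonneg_right ?_ (by positivity)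
    rw [div_le_div_iff₀ (by positivity) hh]; linarith only [hh]
  have tele := energy_telescope hh.ne' e f X Xm Y Ym R Rm S Sm
  rw [← hm1, ← hm2, ← hr, ← hs] at tele
  -- Q mixes two cells. Adding (X − Y)² to the telescoping flux charges 9/10 h (X² + Y²) to the
  -- present cell; the last h/10 pays for Young's inequality in `yR` and `yS`.
  have hQe : 9 / 20 * h * Q + 9 / 20 * h * (X - Y) ^ 2 =
      9 / 10 * h * (X ^ 2 + Y ^ 2) + 9 / 20 * h * (Xm - Ym) ^ 2 := by rw [hQ]; ring
  rw [exp1, exp2]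
  have fin : 2 * (e * m1 - e * r) + k * (m1 - r) ^ 2 + 2 * (f * m2 - f * s - f * c) +
      k * A * (m2 - s - c) ^ 2 ≤ (e ^ 2 + f ^ 2 / A) +
      (12 / h * (R ^ 2 + S ^ 2) + 2 / h * (Rm ^ 2 + Sm ^ 2) + (h + A) * c ^ 2) +
      (((e + h * X) * X + (f + h * Y) * Y + (e * (f + h * Y) + f * (e + h * X)) / h
          - 2 / h * ((e + h * X) * R + (f + h * Y) * S) - 9 / 20 * h * (X - Y) ^ 2) -
        (e * Xm + f * Ym + ((e - h * Xm) * f + (f - h * Ym) * e) / h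
          - 2 / h * (e * Rm + f * Sm) - 9 / 20 * h * (Xm - Ym) ^ 2)) := by
    have e12 : 12 / h * (R ^ 2 + S ^ 2) = 10 / h * R ^ 2 + 10 / h * S ^ 2 +
        2 / h * R ^ 2 + 2 / h * S ^ 2 := by ring
    have he2 := sq_nonneg e
    linarith only [e12, he2, quad1, quad2, quadQ, src, yR, yS, c8, tele, hQe]
  have := mul_le_mul_of_nonneg_left fin hk.le
  linarith only [this]

/-- The discrete energy estimate for one step of the scheme. -/
theorem energy_step {n : ℕ} {h k : ℝ} (hh : 0 < h) (hk : 0 < k) {A : ℤ → ℝ} (hA : ∀ j, 0 < A j)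
    (cfl : ∀ j, 2 * k * max (2 * A j + 1) (A j / 4 + 5 / 4) ≤ h)
    {e f e' f' R S c : ℤ → ℝ} (he : IsGridPeriodic n e) (hf : IsGridPeriodic n f)
    (hR : IsGridPeriodic n R) (hS : IsGridPeriodic n S)
    (he' : ∀ j, e' j = e j + k * (Dcent h f j + h / 2 * Dplus h (Dminus h e) j - Dminus h R j))
    (hf' : ∀ j, f' j = f j + k * (A j *
      (Dcent h e j + h / 2 * Dplus h (Dminus h f) j - Dminus h S j - c j))) :
    cellSum n (fun j => e' j ^ 2 + f' j ^ 2 / A j) ≤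
      (1 + k) * cellSum n (fun j => e j ^ 2 + f j ^ 2 / A j) +
      k * (14 / h * cellSum n (fun j => R j ^ 2 + S j ^ 2) +
        cellSum n (fun j => (h + A j) * c j ^ 2)) := by
  set X := Dplus h e with hX
  set Y := Dplus h f with hY
  have hXp : IsGridPeriodic n X := fun j => by
    simp only [hX, Dplus]; rw [show j + (n : ℤ) + 1 = j + 1 + n by ring, he, he]
  have hYp : IsGridPeriodic n Y := fun j => by
    simp only [hY, Dplus]; rw [show j + (n : ℤ) + 1 = j + 1 + n by ring, hf, hf]
  set H : ℤ → ℝ := fun j => e (j + 1) * X j + f (j + 1) * Y j +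
    (e j * f (j + 1) + f j * e (j + 1)) / h - 2 / h * (e (j + 1) * R j + f (j + 1) * S j)
    - 9 / 20 * h * (X j - Y j) ^ 2 with hH
  have hHp : IsGridPeriodic n H := fun j => by
    simp only [hH]
    rw [show j + (n : ℤ) + 1 = j + 1 + n by ring]
    simp only [he _, hf _, hXp _, hYp _, hR _, hS _]
  set B : ℤ → ℝ := fun j => R j ^ 2 + S j ^ 2 with hB
  have hBp : IsGridPeriodic n B := fun j => by simp only [hB, hR j, hS j]
  have key : ∀ j, e' j ^ 2 + f' j ^ 2 / A j ≤ ((1 + k) * (e j ^ 2 + f j ^ 2 / A j) +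
      k * (12 / h * B j + 2 / h * B (j - 1) + (h + A j) * c j ^ 2)) + k * (H j - H (j - 1)) := by
    intro j
    have c1 : 2 * k * (2 * A j + 1) ≤ h := le_trans
      (mul_le_mul_of_nonneg_left (le_max_left _ _) (by positivity)) (cfl j)
    have c2 : 2 * k * (A j / 4 + 5 / 4) ≤ h := le_trans
      (mul_le_mul_of_nonneg_left (le_max_right _ _) (by positivity)) (cfl j)
    have := energy_balance_cell hh hk (hA j) c1 c2 (e (j - 1)) (e j) (e (j + 1)) (f (j - 1)) (f j)
      (f (j + 1)) (R (j - 1)) (R j) (S (j - 1)) (S j) (c j) (X j) (X (j - 1)) (Y j) (Y (j - 1))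
      (by simp only [hX, Dplus]; field_simp) (by simp only [hX, Dplus, sub_add_cancel]; field_simp)
      (by simp only [hY, Dplus]; field_simp) (by simp only [hY, Dplus, sub_add_cancel]; field_simp)
    simp only [hH, hB, sub_add_cancel]
    have q1 : e' j = e j + k * ((Y j + Y (j - 1)) / 2 + (X j - X (j - 1)) / 2 -
        (R j - R (j - 1)) / h) := by
      rw [he' j]
      simp only [hX, hY, Dplus, Dminus, Dcent, sub_add_cancel, add_sub_cancel_right]
      field_simp
      ring
    have q2 : f' j = f j + k * (A j * ((X j + X (j - 1)) / 2 + (Y j - Y (j - 1)) / 2 -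
        (S j - S (j - 1)) / h - c j)) := by
      rw [hf' j]
      simp only [hX, hY, Dplus, Dminus, Dcent, sub_add_cancel, add_sub_cancel_right]
      field_simp
      ring
    rw [q1, q2]
    exact this
  have e1 := cellSum_shift_sub hBp
  have e2 := cellSum_shift_sub hHp
  refine (cellSum_mono key).trans (le_of_eq ?_)
  rw [cellSum_add n (fun j => (1 + k) * (e j ^ 2 + f j ^ 2 / A j) +
      k * (12 / h * B j + 2 / h * B (j - 1) + (h + A j) * c j ^ 2)),
    cellSum_add n (fun j => (1 + k) * (e j ^ 2 + f j ^ 2 / A j)), cellSum_mul, cellSum_mul,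
    cellSum_mul, cellSum_sub, e2, cellSum_add n (fun j => 12 / h * B j + 2 / h * B (j - 1)),
    cellSum_add n (fun j => 12 / h * B j), cellSum_mul n _ B,
    cellSum_mul n _ (fun j => B (j - 1)), e1]
  ring

/-! ### Time averages of the exact solution -/

/-- Jensen's inequality for time integrals of grid functions. -/
theorem cellSum_sq_integral_le {n : ℕ} {a b B : ℝ} (hab : a ≤ b) {F : ℝ → ℤ → ℝ}
    (hF : ∀ j, ContinuousOn (fun r => F r j) (Icc a b))
    (hB : ∀ r ∈ Icc a b, cellSum n (fun j => F r j ^ 2) ≤ B) :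
    cellSum n (fun j => (∫ r in a..b, F r j) ^ 2) ≤ (b - a) ^ 2 * B := by
  have hc : ∀ j, ContinuousOn (fun r => F r j) (uIcc a b) := fun j => by
    rw [uIcc_of_le hab]; exact hF j
  have h2 : ∀ j, IntervalIntegrable (fun r => F r j ^ 2) volume a b := fun j =>
    ((hc j).pow 2).intervalIntegrable
  have h1 : cellSum n (fun j => (∫ r in a..b, F r j) ^ 2) ≤
      cellSum n (fun j => (b - a) * ∫ r in a..b, F r j ^ 2) :=
    cellSum_mono fun j => sq_integral_le (hc j).intervalIntegrable (h2 j) hab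
  refine h1.trans ?_
  rw [cellSum_mul, cellSum_integral_comm _ h2, sq, mul_assoc]
  refine mul_le_mul_of_nonneg_left ?_ (by linarith)
  have hint : IntervalIntegrable (fun r => cellSum n (fun j => F r j ^ 2)) volume a b := by
    refine ContinuousOn.intervalIntegrable ?_
    unfold cellSum
    exact continuousOn_finsetSum _ fun i _ => (hc i).pow 2
  refine (intervalIntegral.integral_mono_on hab hint (by simp) hB).trans (le_of_eq ?_)
  simp

/-- The time average over `[s, s + τ]` of the cell means of `f`. -/
def avgMean (h τ : ℝ) (f : ℝ → ℝ → ℝ) (s : ℝ) (j : ℤ) : ℝ :=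
  (1 / τ) * ∫ r in s..(s + τ), cellMean h (f r) j

section avgMean

variable {T τ h : ℝ} {n : ℕ} {f : ℝ → ℝ → ℝ}

theorem avgMean_periodic (hf : IsL2Curve T f) (hn : n * h = 2) (hτ : 0 ≤ τ) {s : ℝ} (hs : 0 ≤ s)
    (hsT : s + τ ≤ T) : IsGridPeriodic n (avgMean h τ f s) := by
  intro j
  unfold avgMean
  congr 1
  refine intervalIntegral.integral_congr fun r hr => ?_
  rw [uIcc_of_le (by linarith)] at hr
  exact cellMean_periodic hn (hf.periodic r ⟨hs.trans hr.1, hr.2.trans hsT⟩) j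

/-- Overlapping windows cancel: moving the window by t − s is the same as integrating shifts by τ
over [s, t]. The averages are therefore Lipschitz in time, with a constant governed by increments
over τ. -/
theorem avgMean_sub_avgMean (hf : IsL2Curve T f) (hh : 0 < h) (hn : n * h = 2) (hτ : 0 ≤ τ)
    {s t : ℝ} (hs : 0 ≤ s) (hst : s ≤ t) (ht : t + τ ≤ T) (j : ℤ) :
    avgMean h τ f t j - avgMean h τ f s j =
      (1 / τ) * ∫ r in s..t, (cellMean h (f (r + τ)) j - cellMean h (f r) j) := by
  have hi : ∀ {a b : ℝ}, a ∈ Icc 0 T → b ∈ Icc 0 T →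
      IntervalIntegrable (fun r => cellMean h (f r) j) volume a b := fun ha hb =>
    hf.intervalIntegrable_cellMean hh hn j ha hb
  have ms : s ∈ Icc 0 T := ⟨hs, by linarith⟩
  have mt : t ∈ Icc 0 T := ⟨by linarith, by linarith⟩
  have msτ : s + τ ∈ Icc 0 T := ⟨by linarith, by linarith⟩
  have mtτ : t + τ ∈ Icc 0 T := ⟨by linarith, by linarith⟩
  have hsh : IntervalIntegrable (fun r => cellMean h (f (r + τ)) j) volume s t := by
    have := (hi msτ mtτ).comp_add_right τ
    simpa using this
  rw [intervalIntegral.integral_sub hsh (hi ms mt),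
    intervalIntegral.integral_comp_add_right (fun r => cellMean h (f r) j)]
  unfold avgMean
  rw [← mul_sub]
  congr 1
  have e1 := intervalIntegral.integral_add_adjacent_intervals (hi ms mt) (hi mt mtτ)
  have e2 := intervalIntegral.integral_add_adjacent_intervals (hi ms msτ) (hi msτ mtτ)
  linarith

theorem continuousOn_shift {g : ℝ → ℝ} {a b : ℝ} (hg : ContinuousOn g (Icc 0 T)) (hτ : 0 ≤ τ)
    (ha : 0 ≤ a) (hb : b + τ ≤ T) : ContinuousOn (fun r => g (r + τ)) (Icc a b) :=
  hg.comp (continuous_id.add continuous_const).continuousOn fun r hr =>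
    ⟨by linarith [hr.1], by linarith [hr.2]⟩

theorem avgMean_continuousOn (hf : IsL2Curve T f) (hh : 0 < h) (hn : n * h = 2) (hτ : 0 ≤ τ)
    {a b : ℝ} (ha : 0 ≤ a) (hb : b + τ ≤ T) (j : ℤ) :
    ContinuousOn (fun r => avgMean h τ f r j) (Icc a b) := by
  rcases lt_or_ge b a with hab | hab
  · rw [Icc_eq_empty (not_le.2 hab)]; exact continuousOn_empty _
  have hg := hf.continuousOn_cellMean hh hn j
  have h1 : ContinuousOn (fun r => cellMean h (f (r + τ)) j - cellMean h (f r) j) (Icc a b) :=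
    (continuousOn_shift hg hτ ha hb).sub (hg.mono (Icc_subset_Icc ha (by linarith)))
  have h2 : ContinuousOn (fun t => ∫ r in a..t, (cellMean h (f (r + τ)) j - cellMean h (f r) j))
      (Icc a b) := by
    have := intervalIntegral.continuousOn_primitive_interval (μ := volume) (a := a) (b := b)
      (f := fun r => cellMean h (f (r + τ)) j - cellMean h (f r) j) (by
        rw [uIcc_of_le hab]; exact h1.integrableOn_Icc)
    rwa [uIcc_of_le hab] at this
  refine ((h2.const_mul (1 / τ)).add (continuousOn_const (c := avgMean h τ f a j))).congr
    fun r hr => ?_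
  have := avgMean_sub_avgMean hf hh hn hτ ha hr.1 (by linarith [hr.2] : r + τ ≤ T) j
  simp only [Pi.add_apply]
  linarith

/-- The time averages are Lipschitz continuous in time. -/
theorem cellSum_sq_avgMean_sub_le (hf : IsL2Curve T f) (hh : 0 < h) (hn : n * h = 2) (hτ : 0 < τ)
    {B : ℝ} (hB : ∀ r, 0 ≤ r → r + τ ≤ T → sqNorm (fun x => f (r + τ) x - f r x) ≤ B)
    {s t : ℝ} (hs : 0 ≤ s) (hst : s ≤ t) (ht : t + τ ≤ T) :
    cellSum n (fun j => (avgMean h τ f t j - avgMean h τ f s j) ^ 2) ≤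
      (t - s) ^ 2 * (B / (h * τ ^ 2)) := by
  simp only [avgMean_sub_avgMean hf hh hn hτ.le hs hst ht, mul_pow]
  rw [cellSum_mul]
  have hg := fun j => hf.continuousOn_cellMean hh hn j
  have := cellSum_sq_integral_le (n := n) (B := B / h) hst
    (F := fun r j => cellMean h (f (r + τ)) j - cellMean h (f r) j)
    (fun j => (continuousOn_shift (hg j) hτ.le hs ht).sub
      ((hg j).mono (Icc_subset_Icc hs (by linarith)))) ?_
  · refine (mul_le_mul_of_nonneg_left this (by positivity)).trans (le_of_eq ?_)
    field_simp
  · intro r hr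
    have m1 : r ∈ Icc 0 T := ⟨hs.trans hr.1, by linarith [hr.2]⟩
    have m2 : r + τ ∈ Icc 0 T := ⟨by linarith [hr.1], by linarith [hr.2]⟩
    have l1 := hf.loc _ m1
    have l2 := hf.loc _ m2
    have h1 := cellSum_sq_cellMean_le hh hn (f := fun x => f (r + τ) x - f r x)
      (fun x => by simp only [hf.periodic _ m1 x, hf.periodic _ m2 x]) (l2.sub l1)
    rw [cellSum_mul] at h1
    simp only [cellMean_sub l2 l1] at h1
    rw [le_div_iff₀ hh]
    linarith [hB r m1.1 m2.2]

/-- The distance between time averages and point values. -/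
theorem cellSum_sq_cellMean_sub_avgMean_le (hf : IsL2Curve T f) (hh : 0 < h) (hn : n * h = 2)
    (hτ : 0 < τ) {B t s : ℝ} (ht : t ∈ Icc 0 T) (hs : 0 ≤ s) (hsτ : s + τ ≤ T)
    (hB : ∀ r ∈ Icc s (s + τ), sqNorm (fun x => f t x - f r x) ≤ B) :
    cellSum n (fun j => h * (cellMean h (f t) j - avgMean h τ f s j) ^ 2) ≤ B := by
  have hg := fun j => (hf.continuousOn_cellMean hh hn j).mono (Icc_subset_Icc hs hsτ)
  have hsτ' : s ≤ s + τ := by linarith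
  have e : ∀ j, cellMean h (f t) j - avgMean h τ f s j =
      (1 / τ) * ∫ r in s..(s + τ), (cellMean h (f t) j - cellMean h (f r) j) := fun j => by
    rw [intervalIntegral.integral_sub (by simp)
      (hf.intervalIntegrable_cellMean hh hn j ⟨hs, by linarith⟩ ⟨by linarith, hsτ⟩)]
    unfold avgMean
    simp only [intervalIntegral.integral_const, smul_eq_mul]
    field_simp
    ring
  simp only [e, mul_pow]
  rw [cellSum_mul, cellSum_mul]
  have := cellSum_sq_integral_le (n := n) (B := B / h) hsτ'
    (F := fun r j => cellMean h (f t) j - cellMean h (f r) j)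
    (fun j => continuousOn_const.sub (hg j)) ?_
  · calc _ ≤ h * ((1 / τ) ^ 2 * ((s + τ - s) ^ 2 * (B / h))) := by
          gcongr
      _ = B := by field_simp; ring
  · intro r hr
    have m1 : r ∈ Icc 0 T := ⟨hs.trans hr.1, by linarith [hr.2]⟩
    have l1 := hf.loc _ m1
    have l2 := hf.loc _ ht
    have h1 := cellSum_sq_cellMean_le hh hn (f := fun x => f t x - f r x)
      (fun x => by simp only [hf.periodic _ m1 x, hf.periodic _ ht x]) (l2.sub l1)
    rw [cellSum_mul] at h1
    simp only [cellMean_sub l2 l1] at h1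
    rw [le_div_iff₀ hh]
    linarith [hB r hr]

end avgMean

/-! ### Continuity of the node defects in time -/

open IsWeakPair in
-- The defect is linear in the increment, so Cauchy–Schwarz on the two cells next to the node
-- applies to the difference. The bound is needed only for continuity in time, so that defects can
-- be integrated.
theorem sq_nodeDefect_sub_le {T : ℝ} {w : ℝ → ℝ → ℝ} (hw : IsL2Curve T w) {h : ℝ} (hh : 0 < h)
    (hh2 : h ≤ 2) {s t s' t' : ℝ} (hs : s ∈ Icc 0 T) (ht : t ∈ Icc 0 T) (hs' : s' ∈ Icc 0 T)
    (ht' : t' ∈ Icc 0 T) (j : ℤ) :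
    (nodeDefect h w s t j - nodeDefect h w s' t' j) ^ 2 ≤
      4 * h * sqNorm (fun x => (w t x - w s x) - (w t' x - w s' x)) := by
  set g : ℝ → ℝ := fun x => (w t x - w s x) - (w t' x - w s' x) with hg
  have l1 := (hw.loc t ht).sub (hw.loc s hs)
  have l2 := (hw.loc t' ht').sub (hw.loc s' hs')
  have lg : IsLocL2 g := l1.sub l2
  set G : ℝ → ℝ := fun x => primitive w s t x - primitive w s' t' x with hG
  have hGc : Continuous G := (primitive_continuous hw hs ht).sub (primitive_continuous hw hs' ht')
  have hGsub : ∀ x y, G y - G x = ∫ r in x..y, g r := fun x y => by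
    simp only [hG, hg]
    rw [intervalIntegral.integral_sub (l1.integrable x y) (l2.integrable x y),
      ← primitive_sub hw hs ht, ← primitive_sub hw hs' ht']
    ring
  set I := ∫ r in (((j : ℝ) - 1) * h)..(((j : ℝ) + 1) * h), g r ^ 2 with hI
  have hle : ((j : ℝ) - 1) * h ≤ ((j : ℝ) + 1) * h := by nlinarith
  have hpt : ∀ x y, x ∈ Icc (((j : ℝ) - 1) * h) (((j : ℝ) + 1) * h) →
      y ∈ Icc (((j : ℝ) - 1) * h) (((j : ℝ) + 1) * h) → x ≤ y → (G y - G x) ^ 2 ≤ 2 * h * I := by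
    intro x y hx hy hxy
    rw [hGsub]
    refine (lg.sq_integral_le hxy).trans ?_
    refine mul_le_mul (by linarith [hx.1, hy.2]) ?_ ?_ (by linarith)
    · exact intervalIntegral.integral_mono_interval hx.1 hxy hy.2
        (Eventually.of_forall fun _ => sq_nonneg _) (lg.sq _ _)
    · exact intervalIntegral.integral_nonneg hxy fun _ _ => sq_nonneg _
  have hjm : (j : ℝ) * h ∈ Icc (((j : ℝ) - 1) * h) (((j : ℝ) + 1) * h) := by
    constructor <;> nlinarith
  have b1 : |G ((j : ℝ) * h) - cellMean h G j| ≤ Real.sqrt (2 * h * I) := by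
    refine abs_sub_cellMean_le hh hGc j fun x hx => Real.abs_le_sqrt ?_
    exact hpt x _ ⟨hx.1, hx.2.trans hjm.2⟩ hjm hx.2
  have b2 : |G ((j : ℝ) * h) - cellMean h G (j + 1)| ≤ Real.sqrt (2 * h * I) := by
    refine abs_sub_cellMean_le hh hGc (j + 1) fun x hx => Real.abs_le_sqrt ?_
    push_cast at hx
    rw [add_sub_cancel_right] at hx
    rw [← neg_sq, neg_sub]
    exact hpt _ x hjm ⟨hjm.1.trans hx.1, hx.2⟩ hx.1
  have hI0 : 0 ≤ I := intervalIntegral.integral_nonneg hle fun _ _ => sq_nonneg _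
  have hp : Function.Periodic (fun x => g x ^ 2) 2 := fun x => by
    simp only [hg, hw.periodic t ht x, hw.periodic s hs x, hw.periodic t' ht' x,
      hw.periodic s' hs' x]
  -- Two cells can be longer than one period, namely when h = 2, so the comparison uses two periods.
  have hI2 : I ≤ 2 * sqNorm g := by
    have p1 := hp.intervalIntegral_add_eq (((j : ℝ) - 1) * h) 0
    have p2 := hp.intervalIntegral_add_eq (((j : ℝ) - 1) * h + 2) 0
    have p3 := intervalIntegral.integral_add_adjacent_intervals
      (lg.sq (((j : ℝ) - 1) * h) (((j : ℝ) - 1) * h + 2))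
      (lg.sq (((j : ℝ) - 1) * h + 2) (((j : ℝ) - 1) * h + 2 + 2))
    rw [zero_add] at p1 p2
    have : I ≤ ∫ r in (((j : ℝ) - 1) * h)..(((j : ℝ) - 1) * h + 2 + 2), g r ^ 2 :=
      intervalIntegral.integral_mono_interval le_rfl hle (by nlinarith)
        (Eventually.of_forall fun _ => sq_nonneg _) (lg.sq _ _)
    unfold sqNorm
    linarith
  have e : nodeDefect h w s t j - nodeDefect h w s' t' j =
      ((G ((j : ℝ) * h) - cellMean h G j) + (G ((j : ℝ) * h) - cellMean h G (j + 1))) / 2 := by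
    have c := cellMean_sub (h := h) (IsLocL2.of_continuous (primitive_continuous hw hs ht))
      (IsLocL2.of_continuous (primitive_continuous hw hs' ht'))
    simp only [hG, nodeDefect, c]
    ring
  have b3 : |nodeDefect h w s t j - nodeDefect h w s' t' j| ≤ Real.sqrt (2 * h * I) := by
    rw [e, abs_le]
    have c1 := abs_le.1 b1
    have c2 := abs_le.1 b2
    constructor <;> linarith [c1.1, c1.2, c2.1, c2.2]
  have := sq_le_sq' (abs_le.1 b3).1 (abs_le.1 b3).2
  rw [Real.sq_sqrt (by positivity)] at this
  nlinarith

open IsWeakPair in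
theorem nodeDefect_continuousOn {T : ℝ} {w : ℝ → ℝ → ℝ} (hw : IsL2Curve T w) {h τ : ℝ}
    (hh : 0 < h) (hh2 : h ≤ 2) (hτ : 0 ≤ τ) {a b : ℝ} (ha : 0 ≤ a) (hb : b + τ ≤ T) (j : ℤ) :
    ContinuousOn (fun r => nodeDefect h w r (r + τ) j) (Icc a b) := by
  intro r hr
  have m1 : ∀ {r}, r ∈ Icc a b → r ∈ Icc 0 T := fun hr =>
    ⟨ha.trans hr.1, by linarith [hr.2]⟩
  have m2 : ∀ {r}, r ∈ Icc a b → r + τ ∈ Icc 0 T := fun hr =>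
    ⟨by linarith [hr.1], by linarith [hr.2]⟩
  have t1 : Tendsto (fun s => sqNorm (fun x => w s x - w r x)) (𝓝[Icc a b] r) (𝓝 0) :=
    (hw.cont r (m1 hr)).mono_left (nhdsWithin_mono _ fun _ h => m1 h)
  have t2 : Tendsto (fun s => sqNorm (fun x => w (s + τ) x - w (r + τ) x)) (𝓝[Icc a b] r)
      (𝓝 0) := by
    refine (hw.cont (r + τ) (m2 hr)).comp (tendsto_nhdsWithin_iff.2 ⟨?_, ?_⟩)
    · exact ((continuous_add_const τ).tendsto r).mono_left nhdsWithin_le_nhds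
    · filter_upwards [self_mem_nhdsWithin] with s hs using m2 hs
  unfold ContinuousWithinAt
  rw [tendsto_iff_dist_tendsto_zero]
  have h0 := (((t2.const_mul 2).add (t1.const_mul 2)).const_mul (4 * h)).sqrt
  rw [mul_zero, add_zero, mul_zero, Real.sqrt_zero] at h0
  refine tendsto_of_tendsto_of_tendsto_of_le_of_le' tendsto_const_nhds h0
    (Eventually.of_forall fun s => dist_nonneg) ?_
  filter_upwards [self_mem_nhdsWithin] with s hs
  rw [Real.dist_eq]
  refine Real.abs_le_sqrt ((sq_nodeDefect_sub_le hw hh hh2 (m1 hs) (m2 hs) (m1 hr) (m2 hr) j).trans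
    (mul_le_mul_of_nonneg_left ?_ (by positivity)))
  have h1 := sqNorm_add_le ((hw.loc _ (m2 hs)).sub (hw.loc _ (m2 hr)))
    ((hw.loc _ (m1 hr)).sub (hw.loc _ (m1 hs)))
  rw [sqNorm_sub_comm (w r)] at h1
  refine (le_of_eq ?_).trans h1
  congr 1
  funext x
  ring

/-! ### Consistency of the scheme -/

open IsWeakPair in
/-- The time averages of an equation `w_t = z_x` satisfy the centered semi-discrete equation up to
a small flux residual. -/
theorem IsWeakPair.exists_flux_residual {T : ℝ} (hT : 0 < T) {w₀ : ℝ → ℝ} {w z : ℝ → ℝ → ℝ}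
    (hw : IsWeakPair T w₀ w z) {n : ℕ} {h τ k : ℝ} (hh : 0 < h) (hn : n * h = 2) (hh2 : h ≤ 2)
    (hτ : 0 < τ) (hk : 0 < k) (hkh : k ≤ h) {Bw Bz : ℝ}
    (hBw : ∀ r, 0 ≤ r → r + τ ≤ T → sqNorm (fun x => w (r + τ) x - w r x) ≤ Bw)
    (hBz : ∀ r, 0 ≤ r → r + τ ≤ T → sqNorm (fun x => z (r + τ) x - z r x) ≤ Bz)
    {s : ℝ} (hs : 0 ≤ s) (hsT : s + k + τ ≤ T) :
    ∃ R : ℤ → ℝ, IsGridPeriodic n R ∧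
      (∀ j, avgMean h τ w (s + k) j =
        avgMean h τ w s j + k * (Dcent h (avgMean h τ z s) j + Dminus h R j)) ∧
      cellSum n (fun j => R j ^ 2) ≤ 2 * h * (Bw + Bz) / τ ^ 2 := by
  set Z := avgMean h τ z with hZ
  set ρ : ℝ → ℤ → ℝ := fun r => nodeDefect h w r (r + τ) with hρ
  -- The flux residual at time r: the error of freezing the averaged flux at the start s of the
  -- step, as an explicit scheme does, plus the node defect divided by the window length.
  set F : ℝ → ℤ → ℝ := fun r j => ((Z r j - Z s j) + (Z r (j + 1) - Z s (j + 1))) / 2 + ρ r j / τ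
    with hF
  have hsk : s ≤ s + k := by linarith
  have m1 : ∀ {r}, r ∈ Icc s (s + k) → r ∈ Icc 0 T := fun hr =>
    ⟨hs.trans hr.1, by linarith [hr.2]⟩
  have m2 : ∀ {r}, r ∈ Icc s (s + k) → r + τ ∈ Icc 0 T := fun hr =>
    ⟨by linarith [hr.1], by linarith [hr.2]⟩
  have hZp : ∀ r ∈ Icc s (s + k), IsGridPeriodic n (Z r) := fun r hr =>
    avgMean_periodic hw.curve_z hn hτ.le (m1 hr).1 (m2 hr).2
  have hρp : ∀ r ∈ Icc s (s + k), IsGridPeriodic n (ρ r) := fun r hr =>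
    nodeDefect_periodic hT hw hn (m1 hr) (m2 hr)
  have hs0 : s ∈ Icc s (s + k) := ⟨le_rfl, hsk⟩
  have hFp : ∀ r ∈ Icc s (s + k), IsGridPeriodic n (F r) := fun r hr j => by
    simp only [hF]
    rw [show j + (n : ℤ) + 1 = j + 1 + n by ring]
    simp only [hZp r hr _, hZp s hs0 _, hρp r hr _]
  have hFc : ∀ j, ContinuousOn (fun r => F r j) (Icc s (s + k)) := fun j => by
    have c1 := fun j => avgMean_continuousOn hw.curve_z hh hn hτ.le hs hsT j
    have c2 := nodeDefect_continuousOn hw.curve_w hh hh2 hτ.le hs hsT j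
    exact (((((c1 j).sub continuousOn_const).add
      ((c1 (j + 1)).sub continuousOn_const)).div_const 2).add (c2.div_const τ))
  have hFi : ∀ j, IntervalIntegrable (fun r => F r j) volume s (s + k) := fun j => by
    refine ContinuousOn.intervalIntegrable ?_
    rw [uIcc_of_le hsk]; exact hFc j
  have hFb : ∀ r ∈ Icc s (s + k), cellSum n (fun j => F r j ^ 2) ≤
      2 * h * (Bw + Bz) / τ ^ 2 := by
    intro r hr
    set a : ℤ → ℝ := fun j => Z r j - Z s j with ha
    have hap : IsGridPeriodic n a := (hZp r hr).sub (hZp s hs0)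
    have b1 : cellSum n (fun j => a j ^ 2) ≤ k ^ 2 * (Bz / (h * τ ^ 2)) := by
      refine (cellSum_sq_avgMean_sub_le hw.curve_z hh hn hτ hBz hs hr.1 (m2 hr).2).trans ?_
      have hBz0 : 0 ≤ Bz := (sqNorm_nonneg _).trans (hBz s hs (by linarith))
      have : (r - s) ^ 2 ≤ k ^ 2 := pow_le_pow_left₀ (by linarith [hr.1]) (by linarith [hr.2]) 2
      exact mul_le_mul_of_nonneg_right this (by positivity)
    have b2 : cellSum n (fun j => ρ r j ^ 2) ≤ h * Bw :=
      (cellSum_sq_nodeDefect_le hw.curve_w hh hn (m1 hr) (m2 hr)).trans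
        (mul_le_mul_of_nonneg_left (hBw r (m1 hr).1 (m2 hr).2) hh.le)
    have b3 : cellSum n (fun j => ((a j + a (j + 1)) / 2) ^ 2) ≤ cellSum n (fun j => a j ^ 2) := by
      have e1 : cellSum n (fun j => a (j + 1) ^ 2) = cellSum n (fun j => a j ^ 2) :=
        cellSum_shift (hap.comp (· ^ 2))
      have e2 : cellSum n (fun j => ((a j + a (j + 1)) / 2) ^ 2) ≤
          cellSum n (fun j => (1 / 2) * (a j ^ 2 + a (j + 1) ^ 2)) :=
        cellSum_mono fun j => by nlinarith [sq_nonneg (a j - a (j + 1))]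
      rw [cellSum_mul, cellSum_add, e1] at e2
      linarith
    have b4 := cellSum_sq_add_le n (fun j => (a j + a (j + 1)) / 2) (fun j => ρ r j / τ)
    have b5 : cellSum n (fun j => (ρ r j / τ) ^ 2) ≤ h * Bw / τ ^ 2 := by
      have e : ∀ j, (ρ r j / τ) ^ 2 = 1 / τ ^ 2 * ρ r j ^ 2 := fun j => by ring
      simp only [e]
      rw [cellSum_mul]
      calc _ ≤ 1 / τ ^ 2 * (h * Bw) := mul_le_mul_of_nonneg_left b2 (by positivity)
        _ = h * Bw / τ ^ 2 := by ring
    -- Here k ≤ h turns k²/h into h, so freezing in time costs no more than the defects.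
    have b6 : k ^ 2 * (Bz / (h * τ ^ 2)) ≤ h * Bz / τ ^ 2 := by
      have hBz0 : 0 ≤ Bz := (sqNorm_nonneg _).trans (hBz s hs (by linarith))
      have e : h * Bz / τ ^ 2 = h ^ 2 * (Bz / (h * τ ^ 2)) := by field_simp
      rw [e]
      exact mul_le_mul_of_nonneg_right (pow_le_pow_left₀ hk.le hkh 2) (by positivity)
    calc cellSum n (fun j => F r j ^ 2) ≤ 2 * (h * Bz / τ ^ 2) + 2 * (h * Bw / τ ^ 2) := by
          refine b4.trans ?_
          linarith
      _ = 2 * h * (Bw + Bz) / τ ^ 2 := by ring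
  -- The residual of the step is the mean of the instantaneous residuals over the step.
  refine ⟨fun j => (1 / k) * ∫ r in s..(s + k), F r j, fun j => ?_, fun j => ?_, ?_⟩
  · beta_reduce
    congr 1
    refine intervalIntegral.integral_congr fun r hr => ?_
    rw [uIcc_of_le hsk] at hr
    exact hFp r hr j
  · have e1 := avgMean_sub_avgMean hw.curve_w hh hn hτ.le hs hsk hsT j
    have e2 : ∫ r in s..(s + k), (cellMean h (w (r + τ)) j - cellMean h (w r) j) =
        ∫ r in s..(s + k), ((τ / h) * (F r j - F r (j - 1)) + τ * Dcent h (Z s) j) := by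
      refine intervalIntegral.integral_congr fun r hr => ?_
      rw [uIcc_of_le hsk] at hr
      have e3 := hw.cellMean_sub_eq hT hh hh2 (m1 hr) (m2 hr) j
      rw [intervalIntegral.integral_sub
        (hw.curve_z.intervalIntegrable_cellMean hh hn (j + 1) (m1 hr) (m2 hr))
        (hw.curve_z.intervalIntegrable_cellMean hh hn (j - 1) (m1 hr) (m2 hr))] at e3
      have e4 : ∀ i, ∫ ρ in r..(r + τ), cellMean h (z ρ) i = τ * Z r i := fun i => by
        simp only [hZ, avgMean]; field_simp
      rw [e4, e4] at e3
      simp only [hF, hρ, Dcent, sub_add_cancel]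
      rw [← mul_right_inj' hh.ne', e3]
      field_simp
      ring
    rw [e2, intervalIntegral.integral_add (((hFi j).sub (hFi (j - 1))).const_mul _) (by simp),
      intervalIntegral.integral_const_mul, intervalIntegral.integral_sub (hFi j) (hFi (j - 1)),
      intervalIntegral.integral_const, smul_eq_mul] at e1
    simp only [Dminus]
    rw [sub_eq_iff_eq_add] at e1
    rw [e1]
    field_simp
    ring
  · have := cellSum_sq_integral_le hsk hFc hFb
    simp only [mul_pow]
    rw [cellSum_mul]
    refine (mul_le_mul_of_nonneg_left this (by positivity)).trans (le_of_eq ?_)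
    field_simp
    ring

/-- The exact solution and the bounds that enter the consistency estimate. -/
structure IsHolderSolution (T : ℝ) (b : ℝ → ℝ) (b_lo b_hi γ C : ℝ) (u₀ v₀ : ℝ → ℝ)
    (u v : ℝ → ℝ → ℝ) : Prop where
  pair_u : IsWeakPair T u₀ u v
  pair_v : IsWeakPair T (fun x => b x * v₀ x) (fun t x => b x * v t x) u
  lo_pos : 0 < b_lo
  bounds : ∀ x, b_lo ≤ b x ∧ b x ≤ b_hi
  nonneg : 0 ≤ C
  holder_u : ∀ s ∈ Icc 0 T, ∀ t ∈ Icc 0 T,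
    sqNorm (fun x => u t x - u s x) ≤ C * |t - s| ^ (2 * γ)
  holder_v : ∀ s ∈ Icc 0 T, ∀ t ∈ Icc 0 T,
    sqNorm (fun x => v t x - v s x) ≤ C * |t - s| ^ (2 * γ)

namespace IsHolderSolution

variable {T : ℝ} {b : ℝ → ℝ} {b_lo b_hi γ C : ℝ} {u₀ v₀ : ℝ → ℝ} {u v : ℝ → ℝ → ℝ}

theorem abs_le (hs : IsHolderSolution T b b_lo b_hi γ C u₀ v₀ u v) (x : ℝ) : |b x| ≤ b_hi := by
  rw [abs_of_pos (hs.lo_pos.trans_le (hs.bounds x).1)]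
  exact (hs.bounds x).2

theorem curve_v (hs : IsHolderSolution T b b_lo b_hi γ C u₀ v₀ u v) : IsL2Curve T v :=
  hs.pair_u.curve_z

theorem curve_u (hs : IsHolderSolution T b b_lo b_hi γ C u₀ v₀ u v) : IsL2Curve T u :=
  hs.pair_u.curve_w

theorem increment_mul_le (hs : IsHolderSolution T b b_lo b_hi γ C u₀ v₀ u v) {s t : ℝ}
    (ms : s ∈ Icc 0 T) (mt : t ∈ Icc 0 T) :
    sqNorm (fun x => b x * v t x - b x * v s x) ≤ b_hi ^ 2 * (C * |t - s| ^ (2 * γ)) := by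
  refine le_trans ?_ (mul_le_mul_of_nonneg_left (hs.holder_v s ms t mt) (sq_nonneg _))
  refine sqNorm_mono ((hs.pair_v.curve_w.loc t mt).sub (hs.pair_v.curve_w.loc s ms))
    ((hs.curve_v.loc t mt).sub (hs.curve_v.loc s ms)) _ fun x => ?_
  rw [← mul_sub, mul_pow]
  have := pow_le_pow_left₀ (abs_nonneg _) (hs.abs_le x) 2
  rw [sq_abs] at this
  gcongr

/-- Time averages of the exact solution satisfy the scheme up to flux residuals `R`, `S` and a
source `c` that is due to the variation of the coefficient over a cell. -/
theorem consistency (hT : 0 < T) (hs : IsHolderSolution T b b_lo b_hi γ C u₀ v₀ u v) {n : ℕ}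
    {h τ k ε : ℝ} (hh : 0 < h) (hn : n * h = 2) (hh2 : h ≤ 2) (hτ : 0 < τ) (hk : 0 < k)
    (hkh : k ≤ h) {A : ℤ → ℝ} (hA : ∀ j, 0 < A j)
    (hAb : ∀ (j : ℤ), ∀ x ∈ Icc (((j : ℝ) - 1) * h) ((j : ℝ) * h), |1 / A j - b x| ≤ ε)
    {s : ℝ} (hs0 : 0 ≤ s) (hsT : s + k + τ ≤ T) :
    ∃ R S c : ℤ → ℝ, IsGridPeriodic n R ∧ IsGridPeriodic n S ∧
      (∀ j, avgMean h τ u (s + k) j = avgMean h τ u s j + k * (Dcent h (avgMean h τ v s) j +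
        h / 2 * Dplus h (Dminus h (avgMean h τ u s)) j + Dminus h R j)) ∧
      (∀ j, avgMean h τ v (s + k) j = avgMean h τ v s j + k * (A j *
        (Dcent h (avgMean h τ u s) j + h / 2 * Dplus h (Dminus h (avgMean h τ v s)) j +
          Dminus h S j + c j))) ∧
      cellSum n (fun j => R j ^ 2 + S j ^ 2) ≤
        (14 + 6 * b_hi ^ 2) * h * (C * τ ^ (2 * γ)) / τ ^ 2 ∧
      cellSum n (fun j => h * c j ^ 2) ≤ ε ^ 2 * (C * τ ^ (2 * γ)) / τ ^ 2 := by
  set B := C * τ ^ (2 * γ) with hB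
  have hB0 : 0 ≤ B := mul_nonneg hs.nonneg (by positivity)
  have mem : ∀ r, 0 ≤ r → r + τ ≤ T → r ∈ Icc 0 T ∧ r + τ ∈ Icc 0 T := fun r h0 h1 =>
    ⟨⟨h0, by linarith⟩, ⟨by linarith, h1⟩⟩
  have hBu : ∀ r, 0 ≤ r → r + τ ≤ T → sqNorm (fun x => u (r + τ) x - u r x) ≤ B := by
    intro r h0 h1
    have := hs.holder_u r (mem r h0 h1).1 (r + τ) (mem r h0 h1).2
    rwa [add_sub_cancel_left, abs_of_pos hτ] at this
  have hBv : ∀ r, 0 ≤ r → r + τ ≤ T → sqNorm (fun x => v (r + τ) x - v r x) ≤ B := by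
    intro r h0 h1
    have := hs.holder_v r (mem r h0 h1).1 (r + τ) (mem r h0 h1).2
    rwa [add_sub_cancel_left, abs_of_pos hτ] at this
  have hBw : ∀ r, 0 ≤ r → r + τ ≤ T →
      sqNorm (fun x => b x * v (r + τ) x - b x * v r x) ≤ b_hi ^ 2 * B := by
    intro r h0 h1
    have := hs.increment_mul_le (mem r h0 h1).1 (mem r h0 h1).2
    rwa [add_sub_cancel_left, abs_of_pos hτ] at this
  obtain ⟨R, hRp, hR, hRb⟩ := hs.pair_u.exists_flux_residual hT hh hn hh2 hτ hk hkh hBu hBv hs0 hsT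
  obtain ⟨S, hSp, hS, hSb⟩ := hs.pair_v.exists_flux_residual hT hh hn hh2 hτ hk hkh hBw hBu hs0 hsT
  have ms := mem s hs0 (by linarith)
  have hPp := avgMean_periodic hs.curve_u hn hτ.le hs0 ms.2.2
  have hQp := avgMean_periodic hs.curve_v hn hτ.le hs0 ms.2.2
  set P := avgMean h τ u s with hP
  set Q := avgMean h τ v s with hQ
  set W : ℝ → ℤ → ℝ := avgMean h τ (fun t x => b x * v t x) with hW
  -- The viscous flux is absent from the exact equation, so it joins the residuals. In each
  -- component it is bounded by time increments of the conserved variable in the other equation.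
  have visc : ∀ (w₀ : ℝ → ℝ) (w z : ℝ → ℝ → ℝ), IsWeakPair T w₀ w z → ∀ D,
      sqNorm (fun x => w (s + τ) x - w s x) ≤ D →
      cellSum n (fun j => ((avgMean h τ z s (j + 1) - avgMean h τ z s j) / 2) ^ 2) ≤
        h * D / τ ^ 2 := by
    intro w₀ w z hw D hD
    have h1 := hw.cellSum_sq_flux_le hT hh hn hh2 ms.1 ms.2
    have e : ∀ j, ((avgMean h τ z s (j + 1) - avgMean h τ z s j) / 2) ^ 2 =
        1 / (4 * τ ^ 2) *
          (∫ r in s..(s + τ), (cellMean h (z r) (j + 1) - cellMean h (z r) j)) ^ 2 := fun j => by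
      rw [intervalIntegral.integral_sub
        (hw.curve_z.intervalIntegrable_cellMean hh hn (j + 1) ms.1 ms.2)
        (hw.curve_z.intervalIntegrable_cellMean hh hn j ms.1 ms.2)]
      unfold avgMean
      field_simp
      ring
    simp only [e]
    rw [cellSum_mul]
    calc _ ≤ 1 / (4 * τ ^ 2) * (4 * h * D) := by gcongr; exact h1.trans (by gcongr)
      _ = h * D / τ ^ 2 := by field_simp
  have hPv := visc _ _ _ hs.pair_v _ (hBw s hs0 ms.2.2)
  have hQv := visc _ _ _ hs.pair_u _ (hBu s hs0 ms.2.2)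
  rw [← hP] at hPv
  rw [← hQ] at hQv
  -- The exact equation evolves the cell means of b v, the scheme those of v divided by `A j`; `c`
  -- is the mismatch of the two rates.
  set c : ℤ → ℝ := fun j => (1 / k) * ((avgMean h τ v (s + k) j - Q j) / A j -
    (W (s + k) j - W s j)) with hc
  refine ⟨fun j => R j - (P (j + 1) - P j) / 2, fun j => S j - (Q (j + 1) - Q j) / 2, c,
    hRp.sub (((hPp.shift 1).sub hPp).comp (· / 2)), hSp.sub (((hQp.shift 1).sub hQp).comp (· / 2)),
    fun j => ?_, fun j => ?_, ?_, ?_⟩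
  · rw [hR j]
    simp only [Dplus, Dminus, sub_add_cancel, add_sub_cancel_right]
    field_simp
    ring
  · have hAj := (hA j).ne'
    simp only [hc]
    rw [hS j]
    simp only [Dplus, Dminus, sub_add_cancel, add_sub_cancel_right]
    field_simp
    ring
  · have r1 := cellSum_sq_sub_le n R (fun j => (P (j + 1) - P j) / 2)
    have r2 := cellSum_sq_sub_le n S (fun j => (Q (j + 1) - Q j) / 2)
    rw [cellSum_add]
    -- The u equation contributes 8 + 2 b_hi², the v equation 6 + 4 b_hi².
    calc _ ≤ (2 * (2 * h * (B + B) / τ ^ 2) + 2 * (h * (b_hi ^ 2 * B) / τ ^ 2)) +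
          (2 * (2 * h * (b_hi ^ 2 * B + B) / τ ^ 2) + 2 * (h * B / τ ^ 2)) := by linarith
      _ = (14 + 6 * b_hi ^ 2) * h * B / τ ^ 2 := by ring
  · have hsk : s ≤ s + k := by linarith
    have lmem : ∀ {r}, r ∈ Icc s (s + k) → r ∈ Icc 0 T ∧ r + τ ∈ Icc 0 T := fun hr =>
      mem _ (hs0.trans hr.1) (by linarith [hr.2])
    -- The integrand is the cell mean of (1/A_j − b)(v(r + τ) − v(r)), hence ε times a time
    -- increment.
    set F : ℝ → ℤ → ℝ := fun r j =>
      (cellMean h (v (r + τ)) j - cellMean h (v r) j) / A j -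
        (cellMean h (fun x => b x * v (r + τ) x) j - cellMean h (fun x => b x * v r x) j) with hF
    have cv := fun j => hs.curve_v.continuousOn_cellMean hh hn j
    have cw := fun j => hs.pair_v.curve_w.continuousOn_cellMean hh hn j
    have sub0 : Icc s (s + k) ⊆ Icc 0 T := fun r hr => (lmem hr).1
    have hFc : ∀ j, ContinuousOn (fun r => F r j) (Icc s (s + k)) := fun j =>
      (((continuousOn_shift (cv j) hτ.le hs0 hsT).sub ((cv j).mono sub0)).div_const _).sub
        ((continuousOn_shift (cw j) hτ.le hs0 hsT).sub ((cw j).mono sub0))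
    have ci : ∀ {g : ℝ → ℝ}, ContinuousOn g (Icc s (s + k)) →
        IntervalIntegrable g volume s (s + k) := fun hg => by
      refine ContinuousOn.intervalIntegrable ?_
      rwa [uIcc_of_le hsk]
    have hcF : ∀ j, c j = (1 / (k * τ)) * ∫ r in s..(s + k), F r j := fun j => by
      have i1 : IntervalIntegrable (fun r => cellMean h (v (r + τ)) j - cellMean h (v r) j)
          volume s (s + k) := ci ((continuousOn_shift (cv j) hτ.le hs0 hsT).sub ((cv j).mono sub0))
      have i2 : IntervalIntegrable (fun r => cellMean h (fun x => b x * v (r + τ) x) j -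
          cellMean h (fun x => b x * v r x) j) volume s (s + k) :=
        ci ((continuousOn_shift (cw j) hτ.le hs0 hsT).sub ((cw j).mono sub0))
      simp only [hc, hF, hW, hQ]
      rw [avgMean_sub_avgMean hs.curve_v hh hn hτ.le hs0 hsk hsT,
        avgMean_sub_avgMean hs.pair_v.curve_w hh hn hτ.le hs0 hsk hsT,
        intervalIntegral.integral_sub (i1.div_const _) i2, intervalIntegral.integral_div]
      field_simp
    have hFb : ∀ r ∈ Icc s (s + k), cellSum n (fun j => F r j ^ 2) ≤ ε ^ 2 * B / h := by
      intro r hr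
      have m := lmem hr
      have l1 := hs.curve_v.loc _ m.1
      have l2 := hs.curve_v.loc _ m.2
      have lb1 := hs.pair_v.curve_w.loc _ m.1
      have lb2 := hs.pair_v.curve_w.loc _ m.2
      have lδ := l2.sub l1
      have lbδ : IsLocL2 (fun x => b x * v (r + τ) x - b x * v r x) := lb2.sub lb1
      have hp : Function.Periodic (fun x => (v (r + τ) x - v r x) ^ 2) 2 := fun x => by
        simp only [hs.curve_v.periodic _ m.1 x, hs.curve_v.periodic _ m.2 x]
      have key : ∀ j, F r j ^ 2 ≤ (ε ^ 2 / h) *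
          ∫ x in (((j : ℝ) - 1) * h)..((j : ℝ) * h), (v (r + τ) x - v r x) ^ 2 := by
        intro j
        have lg := (lδ.const_mul (1 / A j)).sub lbδ
        have e : F r j = cellMean h (fun x => 1 / A j * (v (r + τ) x - v r x) -
            (b x * v (r + τ) x - b x * v r x)) j := by
          rw [cellMean_sub (lδ.const_mul (1 / A j)) lbδ, cellMean_const_mul, cellMean_sub l2 l1,
            cellMean_sub lb2 lb1]
          simp only [hF]
          ring
        have h1 := sq_cellMean_le hh lg j
        rw [← e] at h1
        have h2 : ∫ x in (((j : ℝ) - 1) * h)..((j : ℝ) * h), (1 / A j * (v (r + τ) x - v r x) -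
            (b x * v (r + τ) x - b x * v r x)) ^ 2 ≤
            ε ^ 2 * ∫ x in (((j : ℝ) - 1) * h)..((j : ℝ) * h), (v (r + τ) x - v r x) ^ 2 := by
          rw [← intervalIntegral.integral_const_mul]
          refine intervalIntegral.integral_mono_on (cell_le hh j) (lg.sq _ _)
            ((lδ.sq _ _).const_mul _) fun x hx => ?_
          have h3 := pow_le_pow_left₀ (abs_nonneg _) (hAb j x hx) 2
          rw [sq_abs] at h3
          rw [← mul_sub, ← sub_mul, mul_pow]
          exact mul_le_mul_of_nonneg_right h3 (sq_nonneg _)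
        rw [div_mul_eq_mul_div, le_div_iff₀ hh]
        linarith
      refine (cellSum_mono key).trans ?_
      rw [cellSum_mul, cellSum_integral hn hp lδ.sq]
      calc _ ≤ ε ^ 2 / h * B := mul_le_mul_of_nonneg_left (hBv r m.1.1 m.2.2) (by positivity)
        _ = ε ^ 2 * B / h := by ring
    have := cellSum_sq_integral_le hsk hFc hFb
    simp only [hcF, mul_pow]
    rw [cellSum_mul, cellSum_mul]
    calc _ ≤ h * ((1 / (k * τ)) ^ 2 * ((s + k - s) ^ 2 * (ε ^ 2 * B / h))) := by gcongr
      _ = ε ^ 2 * B / τ ^ 2 := by field_simp; ring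

end IsHolderSolution

/-! ### Error estimate for grid solutions -/

/-- Periodic grid functions that satisfy the viscous centered scheme with coefficient `A`. -/
structure IsGridSolution (n : ℕ) (h k : ℝ) (A : ℤ → ℝ) (U V : ℕ → ℤ → ℝ) : Prop where
  periodic_u : ∀ i, IsGridPeriodic n (U i)
  periodic_v : ∀ i, IsGridPeriodic n (V i)
  step_u : ∀ i j, U (i + 1) j =
    U i j + k * (Dcent h (V i) j + h / 2 * Dplus h (Dminus h (U i)) j)
  step_v : ∀ i j, V (i + 1) j =
    V i j + k * (A j * (Dcent h (U i) j + h / 2 * Dplus h (Dminus h (V i)) j))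

/-- The discrete `L²` distance of two pairs of grid functions. -/
def gridDist (n : ℕ) (h : ℝ) (U V P Q : ℤ → ℝ) : ℝ :=
  cellSum n fun j => h * ((U j - P j) ^ 2 + (V j - Q j) ^ 2)

/-- The discrete energy distance of two pairs of grid functions. -/
def gridEnergy (n : ℕ) (h : ℝ) (A U V P Q : ℤ → ℝ) : ℝ :=
  cellSum n fun j => h * ((U j - P j) ^ 2 + (V j - Q j) ^ 2 / A j)

theorem gridDist_nonneg {n : ℕ} {h : ℝ} (hh : 0 < h) (U V P Q : ℤ → ℝ) :
    0 ≤ gridDist n h U V P Q :=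
  cellSum_nonneg fun _ => by positivity

theorem gridEnergy_nonneg {n : ℕ} {h : ℝ} (hh : 0 < h) {A : ℤ → ℝ} (hA : ∀ j, 0 < A j)
    (U V P Q : ℤ → ℝ) : 0 ≤ gridEnergy n h A U V P Q :=
  cellSum_nonneg fun j => by have := hA j; positivity

theorem gridDist_triangle (n : ℕ) {h : ℝ} (hh : 0 < h) (U V P Q X Y : ℤ → ℝ) :
    gridDist n h U V P Q ≤ 2 * gridDist n h U V X Y + 2 * gridDist n h X Y P Q := by
  unfold gridDist
  rw [← cellSum_mul, ← cellSum_mul, ← cellSum_add]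
  refine cellSum_mono fun j => ?_
  have : (U j - P j) ^ 2 + (V j - Q j) ^ 2 ≤ 2 * ((U j - X j) ^ 2 + (V j - Y j) ^ 2) +
      2 * ((X j - P j) ^ 2 + (Y j - Q j) ^ 2) := by
    nlinarith [sq_nonneg (U j - X j - (X j - P j)), sq_nonneg (V j - Y j - (Y j - Q j))]
  nlinarith [mul_le_mul_of_nonneg_left this hh.le]

theorem gridDist_comm (n : ℕ) (h : ℝ) (U V P Q : ℤ → ℝ) :
    gridDist n h U V P Q = gridDist n h P Q U V := by
  unfold gridDist
  congr 1
  funext j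
  ring

theorem gridEnergy_le_gridDist {n : ℕ} {h b : ℝ} (hh : 0 < h) {A : ℤ → ℝ}
    (hA : ∀ j, 1 / A j ≤ b) (hb : 0 ≤ b) (U V P Q : ℤ → ℝ) :
    gridEnergy n h A U V P Q ≤ (1 + b) * gridDist n h U V P Q := by
  unfold gridDist gridEnergy
  rw [← cellSum_mul]
  refine cellSum_mono fun j => ?_
  have h1 : (V j - Q j) ^ 2 / A j ≤ b * (V j - Q j) ^ 2 := by
    have := mul_le_mul_of_nonneg_left (hA j) (sq_nonneg (V j - Q j))
    rw [mul_one_div] at this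
    linarith
  have h2 : (U j - P j) ^ 2 + (V j - Q j) ^ 2 / A j ≤
      (1 + b) * ((U j - P j) ^ 2 + (V j - Q j) ^ 2) := by
    nlinarith [mul_nonneg hb (sq_nonneg (U j - P j)), sq_nonneg (V j - Q j)]
  nlinarith [mul_le_mul_of_nonneg_left h2 hh.le]

theorem gridDist_le_gridEnergy {n : ℕ} {h b : ℝ} (hh : 0 < h) {A : ℤ → ℝ} (hA0 : ∀ j, 0 < A j)
    (hA : ∀ j, b ≤ 1 / A j) (hb : 0 < b) (U V P Q : ℤ → ℝ) :
    gridDist n h U V P Q ≤ (1 + 1 / b) * gridEnergy n h A U V P Q := by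
  unfold gridDist gridEnergy
  rw [← cellSum_mul]
  refine cellSum_mono fun j => ?_
  have h1 : b * (V j - Q j) ^ 2 ≤ (V j - Q j) ^ 2 / A j := by
    have := mul_le_mul_of_nonneg_left (hA j) (sq_nonneg (V j - Q j))
    rw [mul_one_div] at this
    linarith
  have h0 : 0 ≤ (V j - Q j) ^ 2 / A j := div_nonneg (sq_nonneg _) (hA0 j).le
  have h3 : (V j - Q j) ^ 2 ≤ 1 / b * ((V j - Q j) ^ 2 / A j) := by
    rw [one_div_mul_eq_div, le_div_iff₀ hb]; linarith
  have h2 : (U j - P j) ^ 2 + (V j - Q j) ^ 2 ≤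
      (1 + 1 / b) * ((U j - P j) ^ 2 + (V j - Q j) ^ 2 / A j) := by
    have : 0 ≤ 1 / b * (U j - P j) ^ 2 := by positivity
    nlinarith
  nlinarith [mul_le_mul_of_nonneg_left h2 hh.le]

namespace IsHolderSolution

variable {T : ℝ} {b : ℝ → ℝ} {b_lo b_hi γ C : ℝ} {u₀ v₀ : ℝ → ℝ} {u v : ℝ → ℝ → ℝ}
  {n : ℕ} {h τ k ε : ℝ} {A : ℤ → ℝ}

theorem gridDist_avgMean_le (hs : IsHolderSolution T b b_lo b_hi γ C u₀ v₀ u v) (hγ : 0 < γ)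
    (hh : 0 < h) (hn : n * h = 2) (hτ : 0 < τ) {s t ρ : ℝ} (ht : t ∈ Icc 0 T) (hs0 : 0 ≤ s)
    (hsτ : s + τ ≤ T) (hρ : ∀ r ∈ Icc s (s + τ), |t - r| ≤ ρ) :
    gridDist n h (cellMean h (u t)) (cellMean h (v t)) (avgMean h τ u s) (avgMean h τ v s) ≤
      2 * C * ρ ^ (2 * γ) := by
  have key : ∀ r ∈ Icc s (s + τ), r ∈ Icc 0 T ∧ C * |t - r| ^ (2 * γ) ≤ C * ρ ^ (2 * γ) :=
    fun r hr => ⟨⟨hs0.trans hr.1, hr.2.trans hsτ⟩, mul_le_mul_of_nonneg_left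
      (Real.rpow_le_rpow (abs_nonneg _) (hρ r hr) (by positivity)) hs.nonneg⟩
  have h1 := cellSum_sq_cellMean_sub_avgMean_le hs.curve_u hh hn hτ ht hs0 hsτ
    (fun r hr => (hs.holder_u r (key r hr).1 t ht).trans (key r hr).2)
  have h2 := cellSum_sq_cellMean_sub_avgMean_le hs.curve_v hh hn hτ ht hs0 hsτ
    (fun r hr => (hs.holder_v r (key r hr).1 t ht).trans (key r hr).2)
  unfold gridDist
  simp only [mul_add]
  rw [cellSum_add]
  linarith

/-- The errors solve the scheme with the residuals of `consistency`. The weight h of the norm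
cancels the 1/h that `energy_step` puts on the fluxes, so these enter as h τ^(2γ−2) and the
coefficient as ε² τ^(2γ−2). -/
theorem gridEnergy_step (hT : 0 < T) (hs : IsHolderSolution T b b_lo b_hi γ C u₀ v₀ u v)
    (hh : 0 < h) (hn : n * h = 2) (hh2 : h ≤ 2) (hτ : 0 < τ) (hk : 0 < k)
    (hkh : k ≤ h) (hA : ∀ j, 0 < A j) (hAlo : ∀ j, b_lo ≤ 1 / A j)
    (hAb : ∀ (j : ℤ), ∀ x ∈ Icc (((j : ℝ) - 1) * h) ((j : ℝ) * h), |1 / A j - b x| ≤ ε)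
    (cfl : ∀ j, 2 * k * max (2 * A j + 1) (A j / 4 + 5 / 4) ≤ h)
    {U V : ℕ → ℤ → ℝ} (hU : IsGridSolution n h k A U V) (i : ℕ)
    {s : ℝ} (hs0 : 0 ≤ s) (hsT : s + k + τ ≤ T) :
    gridEnergy n h A (U (i + 1)) (V (i + 1)) (avgMean h τ u (s + k)) (avgMean h τ v (s + k)) ≤
      (1 + k) * gridEnergy n h A (U i) (V i) (avgMean h τ u s) (avgMean h τ v s) +
      k * ((14 * (14 + 6 * b_hi ^ 2) + 2 + 1 / b_lo) * C *
        ((h + ε ^ 2) * τ ^ (2 * γ) / τ ^ 2)) := by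
  obtain ⟨R, S, c, hR, hS, hP, hQ, hRS, hcb⟩ :=
    hs.consistency hT hh hn hh2 hτ hk hkh hA hAb hs0 hsT
  have pP := avgMean_periodic hs.curve_u hn hτ.le hs0 (by linarith : s + τ ≤ T)
  have pQ := avgMean_periodic hs.curve_v hn hτ.le hs0 (by linarith : s + τ ≤ T)
  set P := avgMean h τ u s with hPdef
  set Q := avgMean h τ v s with hQdef
  have est := energy_step hh hk hA cfl (c := c)
    (e := fun j => U i j - P j) (f := fun j => V i j - Q j)
    (e' := fun j => U (i + 1) j - avgMean h τ u (s + k) j)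
    (f' := fun j => V (i + 1) j - avgMean h τ v (s + k) j)
    ((hU.periodic_u i).sub pP) ((hU.periodic_v i).sub pQ) hR hS
    (fun j => by
      simp only [hU.step_u, hP]
      simp only [Dcent, Dplus, Dminus]
      ring)
    (fun j => by
      simp only [hU.step_v, hQ]
      simp only [Dcent, Dplus, Dminus]
      ring)
  have hc2 : cellSum n (fun j => (h + A j) * c j ^ 2) ≤
      (2 + 1 / b_lo) * cellSum n (fun j => c j ^ 2) := by
    rw [← cellSum_mul]
    refine cellSum_mono fun j => mul_le_mul_of_nonneg_right (add_le_add hh2 ?_) (sq_nonneg _)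
    rw [le_div_iff₀ hs.lo_pos, mul_comm]
    have := hAlo j
    rwa [le_div_iff₀ (hA j)] at this
  rw [cellSum_mul] at hcb
  unfold gridEnergy
  rw [cellSum_mul, cellSum_mul]
  have hb0 : 0 ≤ 1 / b_lo := by have := hs.lo_pos; positivity
  have hq : 0 ≤ τ ^ (2 * γ) / τ ^ 2 := by positivity
  set G := cellSum n fun j => (U i j - P j) ^ 2 + (V i j - Q j) ^ 2 / A j
  have e1 : 14 * cellSum n (fun j => R j ^ 2 + S j ^ 2) ≤
      14 * (14 + 6 * b_hi ^ 2) * C * (h * (τ ^ (2 * γ) / τ ^ 2)) := by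
    calc _ ≤ 14 * _ := mul_le_mul_of_nonneg_left hRS (by norm_num)
      _ = _ := by ring
  have e2 : (2 + 1 / b_lo) * (h * cellSum n fun j => c j ^ 2) ≤
      (2 + 1 / b_lo) * C * (ε ^ 2 * (τ ^ (2 * γ) / τ ^ 2)) := by
    calc _ ≤ (2 + 1 / b_lo) * _ := mul_le_mul_of_nonneg_left hcb (by positivity)
      _ = _ := by ring
  have hC := hs.nonneg
  calc _ ≤ h * ((1 + k) * G + k * (14 / h * cellSum n (fun j => R j ^ 2 + S j ^ 2) +
        (2 + 1 / b_lo) * cellSum n (fun j => c j ^ 2))) := by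
        refine mul_le_mul_of_nonneg_left (est.trans ?_) hh.le
        gcongr
    _ = (1 + k) * (h * G) + k * (14 * cellSum n (fun j => R j ^ 2 + S j ^ 2) +
        (2 + 1 / b_lo) * (h * cellSum n (fun j => c j ^ 2))) := by
        field_simp
    _ ≤ (1 + k) * (h * G) + k * (14 * (14 + 6 * b_hi ^ 2) * C * (h * (τ ^ (2 * γ) / τ ^ 2)) +
        (2 + 1 / b_lo) * C * (ε ^ 2 * (τ ^ (2 * γ) / τ ^ 2))) := by gcongr
    _ ≤ _ := by
        refine (add_le_add_iff_left _).2 (mul_le_mul_of_nonneg_left ?_ hk.le)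
        have p1 : 0 ≤ 14 * (14 + 6 * b_hi ^ 2) * C * (ε ^ 2 * (τ ^ (2 * γ) / τ ^ 2)) := by
          positivity
        have p2 : 0 ≤ (2 + 1 / b_lo) * C * (h * (τ ^ (2 * γ) / τ ^ 2)) := by positivity
        have e3 : (14 * (14 + 6 * b_hi ^ 2) + 2 + 1 / b_lo) * C *
            ((h + ε ^ 2) * τ ^ (2 * γ) / τ ^ 2) =
          14 * (14 + 6 * b_hi ^ 2) * C * (h * (τ ^ (2 * γ) / τ ^ 2)) +
          (2 + 1 / b_lo) * C * (ε ^ 2 * (τ ^ (2 * γ) / τ ^ 2)) +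
          14 * (14 + 6 * b_hi ^ 2) * C * (ε ^ 2 * (τ ^ (2 * γ) / τ ^ 2)) +
          (2 + 1 / b_lo) * C * (h * (τ ^ (2 * γ) / τ ^ 2)) := by ring
        rw [e3]
        linarith

/-- Discrete Grönwall. Step index and averaging window start independently of each other, because
`gridDist_le` may change the window midway. -/
theorem gridEnergy_iterate (hT : 0 < T) (hs : IsHolderSolution T b b_lo b_hi γ C u₀ v₀ u v)
    (hh : 0 < h) (hn : n * h = 2) (hh2 : h ≤ 2) (hτ : 0 < τ) (hk : 0 < k)
    (hkh : k ≤ h) (hA : ∀ j, 0 < A j) (hAlo : ∀ j, b_lo ≤ 1 / A j)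
    (hAb : ∀ (j : ℤ), ∀ x ∈ Icc (((j : ℝ) - 1) * h) ((j : ℝ) * h), |1 / A j - b x| ≤ ε)
    (cfl : ∀ j, 2 * k * max (2 * A j + 1) (A j / 4 + 5 / 4) ≤ h)
    {U V : ℕ → ℤ → ℝ} (hU : IsGridSolution n h k A U V) (i₀ i : ℕ)
    {s : ℝ} (hs0 : 0 ≤ s) (hsT : s + i * k + τ ≤ T) :
    gridEnergy n h A (U (i₀ + i)) (V (i₀ + i)) (avgMean h τ u (s + i * k))
        (avgMean h τ v (s + i * k)) ≤
      Real.exp T * (gridEnergy n h A (U i₀) (V i₀) (avgMean h τ u s) (avgMean h τ v s) +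
        T * ((14 * (14 + 6 * b_hi ^ 2) + 2 + 1 / b_lo) * C *
        ((h + ε ^ 2) * τ ^ (2 * γ) / τ ^ 2))) := by
  have hC := hs.nonneg
  have hb := hs.lo_pos
  set M := (14 * (14 + 6 * b_hi ^ 2) + 2 + 1 / b_lo) * C * ((h + ε ^ 2) * τ ^ (2 * γ) / τ ^ 2)
    with hM
  have hM0 : 0 ≤ M := by positivity
  set G := gridEnergy n h A (U i₀) (V i₀) (avgMean h τ u s) (avgMean h τ v s) with hG
  have hG0 : 0 ≤ G := gridEnergy_nonneg hh hA _ _ _ _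
  have main : ∀ i : ℕ, s + i * k + τ ≤ T →
      gridEnergy n h A (U (i₀ + i)) (V (i₀ + i)) (avgMean h τ u (s + i * k))
        (avgMean h τ v (s + i * k)) ≤ (1 + k) ^ i * (G + i * k * M) := by
    intro i
    induction i with
    | zero => intro _; simp [hG]
    | succ i ih =>
      intro hi
      push_cast at hi
      have e : s + ((i + 1 : ℕ) : ℝ) * k = s + i * k + k := by push_cast; ring
      have h1 := gridEnergy_step hT hs hh hn hh2 hτ hk hkh hA hAlo hAb cfl hU (i₀ + i)
        (s := s + i * k) (by positivity) (by linarith)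
      rw [e, ← add_assoc]
      refine h1.trans ?_
      have h2 := ih (by linarith)
      have h3 : (1 : ℝ) ≤ (1 + k) ^ (i + 1) := one_le_pow₀ (by linarith)
      have h4 : k * M ≤ (1 + k) ^ (i + 1) * (k * M) := le_mul_of_one_le_left (by positivity) h3
      calc _ ≤ (1 + k) * ((1 + k) ^ i * (G + i * k * M)) + (1 + k) ^ (i + 1) * (k * M) := by
            gcongr
        _ = _ := by push_cast; ring
  refine (main i hsT).trans ?_
  have hik : i * k ≤ T := by linarith
  have hexp : (1 + k) ^ i ≤ Real.exp T := by
    calc (1 + k) ^ i ≤ Real.exp k ^ i :=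
          pow_le_pow_left₀ (by linarith) (by linarith [Real.add_one_le_exp k]) i
      _ = Real.exp (i * k) := by rw [← Real.exp_nat_mul]
      _ ≤ Real.exp T := Real.exp_le_exp.2 hik
  gcongr

/-- The constant of the grid error estimate. -/
def gridConst (T b_lo b_hi C : ℝ) : ℝ :=
  1 + 2 * (1 + b_hi) * (1 + 2 * C) + 2 * (1 + 1 / b_lo) * (1 + 2 * C) +
    Real.exp T * (1 + T * ((14 * (14 + 6 * b_hi ^ 2) + 2 + 1 / b_lo) * C))

set_option maxHeartbeats 800000 in
/-- Error of a grid solution against the cell means of the exact solution, with a free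
averaging length `τ`. -/
theorem gridDist_le (hT : 0 < T) (hs : IsHolderSolution T b b_lo b_hi γ C u₀ v₀ u v)
    (hγ : 0 < γ)
    (hh : 0 < h) (hn : n * h = 2) (hh2 : h ≤ 2) (hτ : 0 < τ) (hτT : 3 * τ ≤ T) (hk : 0 < k)
    (hkh : k ≤ h) (hA : ∀ j, 0 < A j) (hAlo : ∀ j, b_lo ≤ 1 / A j) (hAhi : ∀ j, 1 / A j ≤ b_hi)
    (hAb : ∀ (j : ℤ), ∀ x ∈ Icc (((j : ℝ) - 1) * h) ((j : ℝ) * h), |1 / A j - b x| ≤ ε)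
    (cfl : ∀ j, 2 * k * max (2 * A j + 1) (A j / 4 + 5 / 4) ≤ h)
    {U V : ℕ → ℤ → ℝ} (hU : IsGridSolution n h k A U V) {i : ℕ} (hi : i * k + k ≤ T)
    {t : ℝ} (ht : t ∈ Icc 0 T) (hit : i * k ≤ t) (hit' : t ≤ i * k + k) :
    gridDist n h (U i) (V i) (cellMean h (u t)) (cellMean h (v t)) ≤
      gridConst T b_lo b_hi C ^ 6 *
        (gridDist n h (U 0) (V 0) (cellMean h (u 0)) (cellMean h (v 0)) +
          ((τ + k) ^ (2 * γ) + (h + ε ^ 2) * τ ^ (2 * γ) / τ ^ 2)) := by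
  have hC := hs.nonneg
  have hb := hs.lo_pos
  have hbhi : 0 ≤ b_hi := (hs.lo_pos.le.trans (hs.bounds 0).1).trans (hs.bounds 0).2
  set Z : ℕ → ℝ → ℝ := fun i t => gridDist n h (U i) (V i) (cellMean h (u t)) (cellMean h (v t))
    with hZ
  set E : ℕ → ℝ → ℝ := fun i s =>
    gridEnergy n h A (U i) (V i) (avgMean h τ u s) (avgMean h τ v s) with hE
  set Γ := (τ + k) ^ (2 * γ) + (h + ε ^ 2) * τ ^ (2 * γ) / τ ^ 2 with hΓ
  set M := gridConst T b_lo b_hi C with hM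
  have hsrc : 0 ≤ (h + ε ^ 2) * τ ^ (2 * γ) / τ ^ 2 := by positivity
  have hΓ0 : 0 ≤ Γ := by positivity
  have q1 : 0 ≤ 2 * (1 + b_hi) * (1 + 2 * C) := by positivity
  have q2 : 0 ≤ 2 * (1 + 1 / b_lo) * (1 + 2 * C) := by positivity
  have q3 : 0 ≤ Real.exp T * (1 + T * ((14 * (14 + 6 * b_hi ^ 2) + 2 + 1 / b_lo) * C)) := by
    positivity
  have hM1 : 1 ≤ M := by rw [hM, gridConst]; linarith
  have hZ0 : ∀ i t, 0 ≤ Z i t := fun i t => gridDist_nonneg hh _ _ _ _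
  have hE0 : ∀ i s, 0 ≤ E i s := fun i s => gridEnergy_nonneg hh hA _ _ _ _
  -- With Γ added on both sides every estimate becomes a multiplication by `M`, so a chain of them
  -- is a power of `M`.
  have grow : ∀ {x y c : ℝ}, 0 ≤ y → 0 ≤ c → c + 1 ≤ M → x ≤ c * (y + Γ) →
      x + Γ ≤ M * (y + Γ) := by
    intro x y c hy hc hcM hx
    have := mul_le_mul_of_nonneg_right hcM (add_nonneg hy hΓ0)
    linarith
  have avg : ∀ {s t}, t ∈ Icc 0 T → 0 ≤ s → s + τ ≤ T →
      (∀ r ∈ Icc s (s + τ), |t - r| ≤ τ + k) →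
      gridDist n h (cellMean h (u t)) (cellMean h (v t)) (avgMean h τ u s) (avgMean h τ v s) ≤
        2 * C * Γ := fun ht hs0 hsτ hr =>
    (hs.gridDist_avgMean_le hγ hh hn hτ ht hs0 hsτ hr).trans
      (mul_le_mul_of_nonneg_left (by linarith) (by positivity))
  have toE : ∀ {i s t}, t ∈ Icc 0 T → 0 ≤ s → s + τ ≤ T →
      (∀ r ∈ Icc s (s + τ), |t - r| ≤ τ + k) → E i s + Γ ≤ M * (Z i t + Γ) := by
    intro i s t ht hs0 hsτ hr
    have h1 := avg ht hs0 hsτ hr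
    refine grow (hZ0 i t) q1 (by rw [hM, gridConst]; linarith) ?_
    calc E i s ≤ (1 + b_hi) * _ := gridEnergy_le_gridDist hh hAhi hbhi _ _ _ _
      _ ≤ (1 + b_hi) * (2 * Z i t + 2 * (2 * C * Γ)) := by
          refine mul_le_mul_of_nonneg_left ((gridDist_triangle n hh _ _ _ _ (cellMean h (u t))
            (cellMean h (v t))).trans ?_) (by positivity)
          linarith
      _ ≤ (1 + b_hi) * (2 * (1 + 2 * C) * (Z i t + Γ)) := by
          refine mul_le_mul_of_nonneg_left ?_ (by positivity)
          nlinarith [mul_nonneg hC (hZ0 i t), hZ0 i t]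
      _ = _ := by ring
  have toZ : ∀ {i s t}, t ∈ Icc 0 T → 0 ≤ s → s + τ ≤ T →
      (∀ r ∈ Icc s (s + τ), |t - r| ≤ τ + k) → Z i t + Γ ≤ M * (E i s + Γ) := by
    intro i s t ht hs0 hsτ hr
    have h1 := avg ht hs0 hsτ hr
    rw [gridDist_comm] at h1
    refine grow (hE0 i s) q2 (by rw [hM, gridConst]; linarith) ?_
    have h2 := gridDist_le_gridEnergy (n := n) hh hA hAlo hb (U i) (V i) (avgMean h τ u s)
      (avgMean h τ v s)
    have h4 : (1 : ℝ) ≤ 1 + 1 / b_lo := by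
      have : 0 ≤ 1 / b_lo := by positivity
      linarith
    calc Z i t ≤ 2 * ((1 + 1 / b_lo) * E i s) + 2 * (2 * C * Γ) := by
          refine (gridDist_triangle n hh _ _ _ _ (avgMean h τ u s) (avgMean h τ v s)).trans ?_
          linarith
      _ ≤ 2 * ((1 + 1 / b_lo) * E i s) + 2 * ((1 + 1 / b_lo) * (2 * C * Γ)) := by
          have : 2 * C * Γ ≤ (1 + 1 / b_lo) * (2 * C * Γ) :=
            le_mul_of_one_le_left (by positivity) h4
          linarith
      _ = 2 * (1 + 1 / b_lo) * (E i s + 2 * C * Γ) := by ring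
      _ ≤ 2 * (1 + 1 / b_lo) * ((1 + 2 * C) * (E i s + Γ)) := by
          refine mul_le_mul_of_nonneg_left ?_ (by positivity)
          nlinarith [mul_nonneg hC (hE0 i s), hE0 i s]
      _ = _ := by ring
  have run : ∀ (i₀ i : ℕ) {s : ℝ}, 0 ≤ s → s + i * k + τ ≤ T →
      E (i₀ + i) (s + i * k) + Γ ≤ M * (E i₀ s + Γ) := by
    intro i₀ i s hs0 hsT
    refine grow (hE0 _ _) q3 (by rw [hM, gridConst]; linarith) ?_
    refine (gridEnergy_iterate hT hs hh hn hh2 hτ hk hkh hA hAlo hAb cfl hU i₀ i hs0 hsT).trans ?_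
    rw [mul_assoc (Real.exp T)]
    refine mul_le_mul_of_nonneg_left ?_ (Real.exp_pos T).le
    set X := T * ((14 * (14 + 6 * b_hi ^ 2) + 2 + 1 / b_lo) * C) with hX
    have hX0 : 0 ≤ X := by positivity
    have h1 : X * ((h + ε ^ 2) * τ ^ (2 * γ) / τ ^ 2) ≤ X * Γ :=
      mul_le_mul_of_nonneg_left (le_add_of_nonneg_left (by positivity)) hX0
    have h2 : 0 ≤ X * E i₀ s := mul_nonneg hX0 (hE0 _ _)
    calc _ = E i₀ s + X * ((h + ε ^ 2) * τ ^ (2 * γ) / τ ^ 2) := by rw [hX]; ring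
      _ ≤ _ := by nlinarith
  have start : E 0 0 + Γ ≤ M * (Z 0 0 + Γ) := by
    refine toE ⟨le_rfl, hT.le⟩ le_rfl (by linarith) fun r hr => ?_
    rw [_root_.abs_le]; constructor <;> linarith [hr.1, hr.2]
  suffices hfin : Z i t + Γ ≤ M ^ 6 * (Z 0 0 + Γ) by linarith
  have hM0 : 0 ≤ M := by linarith
  have hZΓ : 0 ≤ Z 0 0 + Γ := add_nonneg (hZ0 _ _) hΓ0
  have hik : (0 : ℝ) ≤ i * k := by positivity
  -- The windows look forward in time; the question is whether the one at the final step still fits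
  -- into [0, T].
  rcases le_or_gt ((i : ℝ) * k) (T - τ) with hcase | hcase
  · have h1 := run 0 i (s := 0) le_rfl (by linarith)
    rw [zero_add, zero_add] at h1
    have h2 : Z i t + Γ ≤ M * (E i (i * k) + Γ) := by
      refine toZ ht hik (by linarith) fun r hr => ?_
      rw [_root_.abs_le]; constructor <;> linarith [hr.1, hr.2]
    calc Z i t + Γ ≤ M * (M * (M * (Z 0 0 + Γ))) := by
          refine h2.trans (mul_le_mul_of_nonneg_left (h1.trans ?_) hM0)
          exact mul_le_mul_of_nonneg_left start hM0
      _ = M ^ 3 * (Z 0 0 + Γ) := by ring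
      _ ≤ M ^ 6 * (Z 0 0 + Γ) := by
          gcongr
          · norm_num
  · have hkτ : k < τ := by linarith
    -- Near T the forward window does not fit. It is used for the first m steps only, until a
    -- backward window [m k − τ, m k] exists; the run then continues with backward windows, at the
    -- price of one exchange through point values. Since m k ≤ 2τ, the condition 3τ ≤ T makes the
    -- first run admissible.
    set m := ⌈τ / k⌉₊ with hm
    have hm1 : τ ≤ m * k := by
      have : τ / k ≤ m := Nat.le_ceil _
      rwa [div_le_iff₀ hk] at this
    have hm2 : m * k ≤ 2 * τ := by
      have : (m : ℝ) < τ / k + 1 := Nat.ceil_lt_add_one (by positivity)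
      have := mul_lt_mul_of_pos_right this hk
      rw [add_mul, div_mul_cancel₀ _ hk.ne'] at this
      linarith
    have hmi : m ≤ i := by
      have : (m : ℝ) * k < i * k := by linarith
      have := lt_of_mul_lt_mul_right this hk.le
      exact_mod_cast this.le
    obtain ⟨l, rfl⟩ := Nat.exists_eq_add_of_le hmi
    push_cast at *
    have h1 := run 0 m (s := 0) le_rfl (by linarith)
    rw [zero_add, zero_add] at h1
    have hmT : (m : ℝ) * k ∈ Icc 0 T := ⟨by positivity, by linarith⟩
    have h2 : Z m (m * k) + Γ ≤ M * (E m (m * k) + Γ) := by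
      refine toZ hmT hmT.1 (by linarith) fun r hr => ?_
      rw [_root_.abs_le]; constructor <;> linarith [hr.1, hr.2]
    have h3 : E m (m * k - τ) + Γ ≤ M * (Z m (m * k) + Γ) := by
      refine toE hmT (by linarith) (by linarith) fun r hr => ?_
      rw [_root_.abs_le]; constructor <;> linarith [hr.1, hr.2]
    have h4 := run m l (s := m * k - τ) (by linarith) (by linarith)
    have hlk : 0 ≤ (l : ℝ) * k := by positivity
    have h5 : Z (m + l) t + Γ ≤ M * (E (m + l) (m * k - τ + l * k) + Γ) := by
      refine toZ ht (by linarith) (by linarith) fun r hr => ?_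
      rw [_root_.abs_le]; constructor <;> linarith [hr.1, hr.2]
    calc Z (m + l) t + Γ ≤ M * (M * (M * (M * (M * (M * (Z 0 0 + Γ)))))) := by
          refine h5.trans (mul_le_mul_of_nonneg_left (h4.trans ?_) hM0)
          refine mul_le_mul_of_nonneg_left (h3.trans ?_) hM0
          refine mul_le_mul_of_nonneg_left (h2.trans ?_) hM0
          refine mul_le_mul_of_nonneg_left (h1.trans ?_) hM0
          exact mul_le_mul_of_nonneg_left start hM0
      _ = M ^ 6 * (Z 0 0 + Γ) := by ring

end IsHolderSolution

/-! ### Cell means of the coefficient -/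

theorem cellMean_mem_bounds {a : ℝ → ℝ} (hac : Continuous a) {a_lo a_hi : ℝ}
    (ha : ∀ x, a_lo ≤ a x ∧ a x ≤ a_hi) {h : ℝ} (hh : 0 < h) (j : ℤ) :
    a_lo ≤ cellMean h a j ∧ cellMean h a j ≤ a_hi := by
  have key : ∀ c : ℝ, ∫ _ in (((j : ℝ) - 1) * h)..((j : ℝ) * h), c = h * c := fun c => by
    rw [intervalIntegral.integral_const, smul_eq_mul]; ring
  have i0 : ∀ c : ℝ, IntervalIntegrable (fun _ => c) volume (((j : ℝ) - 1) * h) ((j : ℝ) * h) :=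
    fun c => continuous_const.intervalIntegrable _ _
  have i1 := hac.intervalIntegrable (μ := volume) (((j : ℝ) - 1) * h) ((j : ℝ) * h)
  have h1 := intervalIntegral.integral_mono_on (cell_le hh j) (i0 a_lo) i1 fun x _ => (ha x).1
  have h2 := intervalIntegral.integral_mono_on (cell_le hh j) i1 (i0 a_hi) fun x _ => (ha x).2
  rw [key] at h1 h2
  unfold cellMean
  rw [one_div_mul_eq_div, le_div_iff₀ hh, div_le_iff₀ hh]
  constructor <;> linarith

theorem abs_cellMean_sub_le {a : ℝ → ℝ} {L α : ℝ≥0} (hL : HolderWith L α a) (hac : Continuous a)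
    {h : ℝ} (hh : 0 < h) (j : ℤ) {x : ℝ} (hx : x ∈ Icc (((j : ℝ) - 1) * h) ((j : ℝ) * h)) :
    |cellMean h a j - a x| ≤ L * h ^ (α : ℝ) := by
  have hdist : ∀ y ∈ Icc (((j : ℝ) - 1) * h) ((j : ℝ) * h), |a y - a x| ≤ L * h ^ (α : ℝ) := by
    intro y hy
    have h1 := hL.dist_le_of_le (x := y) (y := x) (d := h) (by
      rw [Real.dist_eq, abs_le]
      constructor <;> nlinarith [hx.1, hx.2, hy.1, hy.2])
    rwa [Real.dist_eq] at h1
  -- The Hölder bounds hold on this cell only. Clamping a to them gives a function bounded on the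
  -- whole line with the same cell mean.
  have hb := cellMean_mem_bounds (a := fun y => max (min (a y) (a x + L * h ^ (α : ℝ)))
    (a x - L * h ^ (α : ℝ))) (by fun_prop) (a_lo := a x - L * h ^ (α : ℝ))
    (a_hi := a x + L * h ^ (α : ℝ)) (fun y => ⟨le_max_right _ _, max_le (min_le_right _ _) (by
      have : 0 ≤ L * h ^ (α : ℝ) := by positivity
      linarith)⟩) hh j
  have e : cellMean h (fun y => max (min (a y) (a x + L * h ^ (α : ℝ)))
      (a x - L * h ^ (α : ℝ))) j = cellMean h a j := by
    unfold cellMean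
    congr 1
    refine intervalIntegral.integral_congr fun y hy => ?_
    rw [uIcc_of_le (cell_le hh j)] at hy
    have := abs_le.1 (hdist y hy)
    rw [min_eq_left (by linarith), max_eq_left (by linarith)]
  rw [e] at hb
  rw [abs_le]
  constructor <;> linarith [hb.1, hb.2]

theorem abs_inv_cellMean_sub_le {a : ℝ → ℝ} {L α : ℝ≥0} (hL : HolderWith L α a)
    (hac : Continuous a) {a_lo a_hi : ℝ} (h0 : 0 < a_lo) (ha : ∀ x, a_lo ≤ a x ∧ a x ≤ a_hi)
    {h : ℝ} (hh : 0 < h) (j : ℤ) {x : ℝ} (hx : x ∈ Icc (((j : ℝ) - 1) * h) ((j : ℝ) * h)) :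
    |1 / cellMean h a j - 1 / a x| ≤ L / a_lo ^ 2 * h ^ (α : ℝ) := by
  have h1 := abs_cellMean_sub_le hL hac hh j hx
  have hA := (cellMean_mem_bounds hac ha hh j).1
  have hax := (ha x).1
  have pA : 0 < cellMean h a j := h0.trans_le hA
  have px : 0 < a x := h0.trans_le hax
  rw [div_sub_div _ _ pA.ne' px.ne', abs_div, abs_of_pos (mul_pos pA px), one_mul, mul_one,
    abs_sub_comm, div_mul_eq_mul_div]
  have : a_lo ^ 2 ≤ cellMean h a j * a x := by
    rw [sq]; exact mul_le_mul hA hax h0.le pA.le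
  gcongr

namespace IsMesh

variable {a : ℝ → ℝ} {T : ℝ} {Nx N : ℕ} {h k : ℝ}

theorem dx_le (hm : IsMesh a T Nx N h k) : h ≤ 2 := by
  have h1 := hm.fill_space
  have h2 : Nx ≠ 0 := by rintro rfl; simp at h1
  have h3 : (1 : ℝ) ≤ Nx := by exact_mod_cast Nat.one_le_iff_ne_zero.2 h2
  nlinarith [hm.dx_pos]

theorem nx_pos (hm : IsMesh a T Nx N h k) : 0 < Nx := by
  have h1 := hm.fill_space
  refine Nat.pos_of_ne_zero ?_
  rintro rfl
  simp at h1

theorem dt_le (hm : IsMesh a T Nx N h k) (hA : 0 ≤ cellMean h a 0) : k ≤ h := by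
  have h1 := hm.cfl 0
  have h2 := mul_le_mul_of_nonneg_left (le_max_left (2 * cellMean h a 0 + 1)
    (cellMean h a 0 / 4 + 5 / 4)) (by linarith [hm.dt_pos] : 0 ≤ 2 * k)
  nlinarith [hm.dt_pos, mul_nonneg hm.dt_pos.le hA]

/-- As t < T = N k, the step that contains t is one of the first N and ends no later than T. -/
theorem floor_mul_le (hm : IsMesh a T Nx N h k) {t : ℝ} (ht : t ∈ Ioo 0 T) :
    (⌊t / k⌋₊ : ℝ) * k ≤ t ∧ t ≤ ⌊t / k⌋₊ * k + k ∧ ⌊t / k⌋₊ * k + k ≤ T := by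
  have hk := hm.dt_pos
  have h0 : 0 ≤ t / k := div_nonneg ht.1.le hk.le
  have h1 := Nat.floor_le h0
  have h2 := Nat.lt_floor_add_one (t / k)
  rw [le_div_iff₀ hk] at h1
  rw [div_lt_iff₀ hk] at h2
  refine ⟨h1, by linarith, ?_⟩
  have h3 : ⌊t / k⌋₊ < N := by
    have : (⌊t / k⌋₊ : ℝ) * k < N * k := by rw [hm.fill_time]; linarith [ht.2]
    exact_mod_cast lt_of_mul_lt_mul_right this hk.le
  have h4 : ((⌊t / k⌋₊ : ℝ) + 1) ≤ N := by exact_mod_cast h3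
  rw [← hm.fill_time]
  nlinarith

end IsMesh

/-! ### Convergence rate -/

/-- The exact solution as it enters the error estimate: Hölder continuous in time, with a modulus
of continuity in space. -/
structure IsRegularSolution (a : ℝ → ℝ) (T a_lo a_hi γ C K : ℝ) (u₀ v₀ : ℝ → ℝ)
    (u v : ℝ → ℝ → ℝ) : Prop where
  holder : IsHolderSolution T (fun x => 1 / a x) (1 / a_hi) (1 / a_lo) γ C u₀ v₀ u v
  modulus_u : ∀ t ∈ Ioo 0 T, HasModulus γ K 0 (u t)
  modulus_v : ∀ t ∈ Ioo 0 T, HasModulus γ K 0 (v t)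

theorem sqNorm_sub_stepFn_le {γ K : ℝ} {w : ℝ → ℝ} (hm : HasModulus γ K 0 w)
    (hp : Function.Periodic w 2) (hw : IsLocL2 w) {h : ℝ} (hh : 0 < h) {n : ℕ}
    (hn : n * h = 2) (hn0 : 0 < n) {U : ℤ → ℝ} (hU : IsGridPeriodic n U) :
    sqNorm (fun x => w x - stepFn h U x) ≤
      4 * |K| * h ^ (2 * γ) + 2 * cellSum n (fun j => h * (U j - cellMean h w j) ^ 2) := by
  have hcp := cellMean_periodic hn hp
  have h1 := sqNorm_triangle hw (stepFn_isLocL2 hn0 h hcp) (stepFn_isLocL2 hn0 h hU)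
  have h2 := hm.sqNorm_sub_cellProj_le hp hw hh hn hn0
  have h3 : sqNorm (fun x => stepFn h (cellMean h w) x - stepFn h U x) =
      cellSum n (fun j => h * (U j - cellMean h w j) ^ 2) := by
    rw [sqNorm_sub_comm, ← sqNorm_stepFn hh hn hn0 (hU.sub hcp)]
    rfl
  rw [h3] at h1
  unfold cellProj at h2
  linarith

/-- The window is τ = (T/6) h^s. The conditions s ≤ 1/2 and s ≤ α make h and h^(2α) at most a
constant times τ², so the residual terms (h + h^(2α)) τ^(2γ−2) are no larger than the averaging
error τ^(2γ). -/
theorem exists_error_bound {T : ℝ} (hT : 0 < T) {a : ℝ → ℝ} {L α : ℝ≥0} (hL : HolderWith L α a)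
    (hα : 0 < α) (hα1 : α ≤ 1)
    {a_lo a_hi : ℝ} (h0 : 0 < a_lo) (ha : ∀ x, a_lo ≤ a x ∧ a x ≤ a_hi) {γ : ℝ} (hγ : 0 < γ)
    (hγ1 : γ ≤ 1) (C K : ℝ) {s : ℝ} (hs : 0 < s) (hs2 : s ≤ 1 / 2) (hsα : s ≤ α) :
    ∃ M, 0 ≤ M ∧ ∀ u₀ v₀ u v, IsRegularSolution a T a_lo a_hi γ C K u₀ v₀ u v →
      ∀ n N h k, IsMesh a T n N h k → ∀ U V, IsGridSolution n h k (cellMean h a) U V →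
      ∀ t ∈ Ioo 0 T,
        sqNorm (fun x => u t x - stepFn h (U ⌊t / k⌋₊) x) +
          sqNorm (fun x => v t x - stepFn h (V ⌊t / k⌋₊) x) ≤
        M * (gridDist n h (U 0) (V 0) (cellMean h (u 0)) (cellMean h (v 0)) +
          h ^ (2 * (s * γ))) := by
  -- Since h ≤ 2 gives h^s ≤ 2, the factor 1/6 ensures 3τ ≤ T on every mesh.
  set c₀ := T / 6 with hc₀
  set Λ := (L : ℝ) / a_lo ^ 2 with hΛ
  set G := IsHolderSolution.gridConst T (1 / a_hi) (1 / a_lo) C ^ 6 with hG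
  have hG0 : 0 ≤ G := by rw [hG]; positivity
  set M₁ := (c₀ + 2) ^ (2 * γ) + (2 + Λ ^ 2 * 4) * c₀ ^ (2 * γ) / c₀ ^ 2 with hM₁
  have hc₀pos : 0 < c₀ := by positivity
  have hM₁0 : 0 ≤ M₁ := by positivity
  refine ⟨8 * |K| * 4 + 2 * G * (1 + M₁), by positivity, fun u₀ v₀ u v hsol n N h k hm U V hU
    t ht => ?_⟩
  have hh := hm.dx_pos
  have hk := hm.dt_pos
  have hn := hm.fill_space
  have hn0 := hm.nx_pos
  have hh2 := hm.dx_le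
  have hac := hL.continuous hα
  have hAb := fun j => cellMean_mem_bounds hac ha hh j
  have hA : ∀ j, 0 < cellMean h a j := fun j => h0.trans_le (hAb j).1
  have hkh := hm.dt_le (hA 0).le
  have hhi : 0 < a_hi := (hA 0).trans_le (hAb 0).2
  have mt : t ∈ Icc 0 T := Ioo_subset_Icc_self ht
  set y := h ^ s with hy
  have hy0 : 0 < y := by positivity
  -- The mesh size may exceed 1, so each comparison of powers of h costs a constant.
  have pow_le : ∀ r : ℝ, 0 ≤ r → r ≤ 2 → h ^ r ≤ 4 := fun r hr0 hr => by
    calc h ^ r ≤ 2 ^ r := Real.rpow_le_rpow hh.le hh2 hr0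
      _ ≤ 2 ^ (2 : ℝ) := Real.rpow_le_rpow_of_exponent_le (by norm_num) hr
      _ = 4 := by norm_num
  have pow_le_one : ∀ r : ℝ, 0 ≤ r → r ≤ 1 → h ^ r ≤ 2 := fun r hr0 hr => by
    calc h ^ r ≤ 2 ^ r := Real.rpow_le_rpow hh.le hh2 hr0
      _ ≤ 2 ^ (1 : ℝ) := Real.rpow_le_rpow_of_exponent_le (by norm_num) hr
      _ = 2 := by norm_num
  have hy2 : y ≤ 2 := pow_le_one s hs.le (by linarith)
  have hhy : h ≤ 2 * y := by
    have e : h = h ^ (1 - s) * h ^ s := by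
      rw [← Real.rpow_add hh]; simp
    rw [e]
    exact mul_le_mul_of_nonneg_right (pow_le_one _ (by linarith) (by linarith)) hy0.le
  have hysq : y ^ 2 = h ^ (2 * s) := by
    rw [hy, ← Real.rpow_natCast, ← Real.rpow_mul hh.le]; congr 1; push_cast; ring
  have hhy2 : h ≤ 2 * y ^ 2 := by
    have e : h = h ^ (1 - 2 * s) * h ^ (2 * s) := by
      rw [← Real.rpow_add hh]; simp
    rw [hysq]
    nth_rewrite 1 [e]
    exact mul_le_mul_of_nonneg_right (pow_le_one _ (by linarith) (by linarith)) (by positivity)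
  have hεy : (h ^ (α : ℝ)) ^ 2 ≤ 4 * y ^ 2 := by
    have e : (h ^ (α : ℝ)) ^ 2 = h ^ (2 * α - 2 * s : ℝ) * h ^ (2 * s) := by
      rw [← Real.rpow_add hh, ← Real.rpow_natCast, ← Real.rpow_mul hh.le]
      congr 1; push_cast; ring
    have hα1' : (α : ℝ) ≤ 1 := by exact_mod_cast hα1
    rw [hysq, e]
    exact mul_le_mul_of_nonneg_right (pow_le _ (by linarith) (by linarith)) (by positivity)
  have hyγ : y ^ (2 * γ) = h ^ (2 * (s * γ)) := by
    rw [hy, ← Real.rpow_mul hh.le]; congr 1; ring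
  have hτ : 0 < c₀ * y := by positivity
  have hτT : 3 * (c₀ * y) ≤ T := by rw [hc₀]; nlinarith
  obtain ⟨f1, f2, f3⟩ := hm.floor_mul_le ht
  have est := hsol.holder.gridDist_le hT hγ hh hn hh2 hτ hτT hk hkh hA
    (fun j => one_div_le_one_div_of_le (hA j) (hAb j).2)
    (fun j => one_div_le_one_div_of_le h0 (hAb j).1)
    (fun j x hx => abs_inv_cellMean_sub_le hL hac h0 ha hh j hx) hm.cfl hU f3 mt f1 f2
  have g1 : (c₀ * y + k) ^ (2 * γ) ≤ (c₀ + 2) ^ (2 * γ) * y ^ (2 * γ) := by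
    rw [← Real.mul_rpow (by positivity) hy0.le]
    exact Real.rpow_le_rpow (by positivity) (by linarith) (by positivity)
  have g2 : (h + (Λ * h ^ (α : ℝ)) ^ 2) * (c₀ * y) ^ (2 * γ) / (c₀ * y) ^ 2 ≤
      (2 + Λ ^ 2 * 4) * c₀ ^ (2 * γ) / c₀ ^ 2 * y ^ (2 * γ) := by
    rw [Real.mul_rpow hc₀pos.le hy0.le]
    have : h + (Λ * h ^ (α : ℝ)) ^ 2 ≤ (2 + Λ ^ 2 * 4) * y ^ 2 := by
      rw [mul_pow]
      nlinarith [mul_le_mul_of_nonneg_left hεy (sq_nonneg Λ)]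
    calc _ ≤ (2 + Λ ^ 2 * 4) * y ^ 2 * (c₀ ^ (2 * γ) * y ^ (2 * γ)) / (c₀ * y) ^ 2 := by gcongr
      _ = _ := by field_simp
  have g3 : h ^ (2 * γ) ≤ 4 * y ^ (2 * γ) := by
    calc h ^ (2 * γ) ≤ (2 * y) ^ (2 * γ) := Real.rpow_le_rpow hh.le hhy (by positivity)
      _ = 2 ^ (2 * γ) * y ^ (2 * γ) := Real.mul_rpow (by norm_num) hy0.le
      _ ≤ 2 ^ (2 : ℝ) * y ^ (2 * γ) := by
          gcongr
          · norm_num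
          · linarith
      _ = 4 * y ^ (2 * γ) := by norm_num
  have eu := sqNorm_sub_stepFn_le (hsol.modulus_u t ht) (hsol.holder.curve_u.periodic t mt)
    (hsol.holder.curve_u.loc t mt) hh hn hn0 (hU.periodic_u ⌊t / k⌋₊)
  have ev := sqNorm_sub_stepFn_le (hsol.modulus_v t ht) (hsol.holder.curve_v.periodic t mt)
    (hsol.holder.curve_v.loc t mt) hh hn hn0 (hU.periodic_v ⌊t / k⌋₊)
  rw [← hyγ]
  set E₀ := gridDist n h (U 0) (V 0) (cellMean h (u 0)) (cellMean h (v 0)) with hE₀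
  have hE₀0 : 0 ≤ E₀ := gridDist_nonneg hh _ _ _ _
  have split : gridDist n h (U ⌊t / k⌋₊) (V ⌊t / k⌋₊) (cellMean h (u t)) (cellMean h (v t)) =
      cellSum n (fun j => h * (U ⌊t / k⌋₊ j - cellMean h (u t) j) ^ 2) +
      cellSum n (fun j => h * (V ⌊t / k⌋₊ j - cellMean h (v t) j) ^ 2) := by
    unfold gridDist
    simp only [mul_add]
    rw [cellSum_add]
  rw [split] at est
  have est' := est.trans (mul_le_mul_of_nonneg_left (add_le_add_right (add_le_add g1 g2) E₀) hG0)
  have hyp : 0 ≤ y ^ (2 * γ) := by positivity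
  have p1 : 0 ≤ 8 * |K| * 4 * E₀ := by positivity
  have p2 : 0 ≤ 2 * G * M₁ * E₀ := by positivity
  have p3 : 0 ≤ 2 * G * y ^ (2 * γ) := by positivity
  have p4 := mul_le_mul_of_nonneg_left g3 (by positivity : 0 ≤ 8 * |K|)
  have e5 : G * (E₀ + ((c₀ + 2) ^ (2 * γ) * y ^ (2 * γ) +
      (2 + Λ ^ 2 * 4) * c₀ ^ (2 * γ) / c₀ ^ 2 * y ^ (2 * γ))) =
      G * E₀ + G * M₁ * y ^ (2 * γ) := by rw [hM₁]; ring
  rw [e5] at est'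
  have e6 : (8 * |K| * 4 + 2 * G * (1 + M₁)) * (E₀ + y ^ (2 * γ)) =
      8 * |K| * 4 * E₀ + 2 * G * M₁ * E₀ + 2 * G * y ^ (2 * γ) + 8 * |K| * (4 * y ^ (2 * γ)) +
      2 * (G * E₀ + G * M₁ * y ^ (2 * γ)) := by ring
  rw [e6]
  linarith

/-! ### The scheme started from cell means -/

theorem cellMean_congr_ae {f g : ℝ → ℝ} (hfg : ∀ᵐ x, f x = g x) (h : ℝ) :
    cellMean h f = cellMean h g := by
  funext j
  unfold cellMean
  congr 1
  refine intervalIntegral.integral_congr_ae ?_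
  filter_upwards [hfg] with x hx _ using hx

theorem cellMean_const {h : ℝ} (hh : 0 < h) (c : ℝ) (j : ℤ) : cellMean h (fun _ => c) j = c := by
  unfold cellMean
  rw [intervalIntegral.integral_const, smul_eq_mul]
  field_simp
  ring

theorem scheme_isGridSolution {a u₀ v₀ : ℝ → ℝ} (ha : Function.Periodic a 2)
    (hu : Function.Periodic u₀ 2) (hv : Function.Periodic v₀ 2) {n : ℕ} {h : ℝ}
    (hn : n * h = 2) (k : ℝ) :
    IsGridSolution n h k (cellMean h a) (fun i => (scheme a u₀ v₀ h k i).1)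
      (fun i => (scheme a u₀ v₀ h k i).2) := by
  have hA := cellMean_periodic hn ha
  have key : ∀ i, IsGridPeriodic n (scheme a u₀ v₀ h k i).1 ∧
      IsGridPeriodic n (scheme a u₀ v₀ h k i).2 := by
    intro i
    induction i with
    | zero => exact ⟨cellMean_periodic hn hu, cellMean_periodic hn hv⟩
    | succ i ih =>
      obtain ⟨pu, pv⟩ := ih
      constructor <;> intro j <;>
        simp only [scheme, Dcent, Dplus, Dminus, add_sub_cancel_right,
          show j + (n : ℤ) + 1 = j + 1 + n by ring,
          show j + (n : ℤ) - 1 = j - 1 + n by ring, pu _, pv _, hA _]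
  exact ⟨fun i => (key i).1, fun i => (key i).2, fun _ _ => rfl, fun _ _ => rfl⟩

/-! ### Constant states and arbitrarily fine meshes -/

theorem scheme_const {a u₀ v₀ : ℝ → ℝ} {h k c d : ℝ} (hc : cellMean h u₀ = fun _ => c)
    (hd : cellMean h v₀ = fun _ => d) (i : ℕ) :
    scheme a u₀ v₀ h k i = (fun _ => c, fun _ => d) := by
  induction i with
  | zero => simp [scheme, hc, hd]
  | succ i ih => simp [scheme, ih, Dcent, Dplus, Dminus]

theorem isGridSolution_const (n : ℕ) (h k : ℝ) (A : ℤ → ℝ) (c d : ℝ) :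
    IsGridSolution n h k A (fun _ _ => c) (fun _ _ => d) :=
  ⟨fun _ _ => rfl, fun _ _ => rfl, fun _ _ => by simp [Dcent, Dplus, Dminus],
    fun _ _ => by simp [Dcent, Dplus, Dminus]⟩

/-- A step function with a modulus of continuity of order larger than `1/2` at all scales is
constant. -/
theorem HasModulus.stepFn_const {γ K h : ℝ} {n : ℕ} {U : ℤ → ℝ} (hγ : 1 / 2 < γ)
    (hm : HasModulus γ K 0 (stepFn h U)) (hU : IsGridPeriodic n U) (hh : 0 < h)
    (hn : n * h = 2) (hn0 : 0 < n) : U = fun _ => U 0 := by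
  have hloc := stepFn_isLocL2 hn0 h hU
  have hper := stepFn_periodic hh hn hU
  have step : ∀ j, U (j + 1) = U j := by
    intro j
    -- A shift by σ < h sees each jump on an interval of length σ, so σ times the squared jump is at
    -- most |K| σ^(2γ). Dividing by σ and letting σ → 0 removes the jump, as 2γ > 1.
    have bound : ∀ σ ∈ Ioo 0 h, (U (j + 1) - U j) ^ 2 ≤ |K| * σ ^ (2 * γ - 1) := by
      intro σ hσ
      have h1 := hm.sqNorm_le hloc hσ.1 hσ.1.le (abs_of_pos hσ.1).le
      set g : ℝ → ℝ := fun x => (stepFn h U (x + σ) - stepFn h U x) ^ 2 with hg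
      have hgl : ∀ a b, IntervalIntegrable g volume a b := ((hloc.comp_add_right σ).sub hloc).sq
      have hgp : Function.Periodic g 2 := fun x => by
        simp only [hg, show x + 2 + σ = x + σ + 2 by ring, hper (x + σ), hper x]
      have hh2 : h ≤ 2 := by
        have : (1 : ℝ) ≤ n := by exact_mod_cast hn0
        nlinarith
      have h2 : sqNorm (fun x => stepFn h U (x + σ) - stepFn h U x) =
          ∫ x in (j * h - σ)..(j * h - σ + 2), g x := by
        rw [hgp.intervalIntegral_add_eq _ 0, zero_add]; rfl
      have h3 : ∫ x in (j * h - σ)..(j * h), g x = σ * (U (j + 1) - U j) ^ 2 := by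
        have : ∫ x in (j * h - σ)..(j * h), g x =
            ∫ _ in (j * h - σ)..(j * h), (U (j + 1) - U j) ^ 2 := by
          refine intervalIntegral.integral_congr_ae ?_
          have : ∀ᵐ x : ℝ, x ≠ j * h := Measure.ae_ne volume _
          filter_upwards [this] with x hx hx'
          rw [uIoc_of_le (by linarith [hσ.1])] at hx'
          have hlt : x < j * h := lt_of_le_of_ne hx'.2 hx
          simp only [hg]
          rw [stepFn_eq hh U (j := j) ⟨by nlinarith [hx'.1, hσ.2], hlt⟩,
            stepFn_eq hh U (j := j + 1) ⟨by push_cast; linarith [hx'.1], by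
              push_cast; nlinarith [hσ.2]⟩]
        rw [this, intervalIntegral.integral_const, smul_eq_mul]
        ring
      have h4 : ∫ x in (j * h - σ)..(j * h), g x ≤ ∫ x in (j * h - σ)..(j * h - σ + 2), g x := by
        rw [← intervalIntegral.integral_add_adjacent_intervals (hgl (j * h - σ) (j * h))
          (hgl (j * h) (j * h - σ + 2))]
        have : 0 ≤ ∫ x in (j * h : ℝ)..(j * h - σ + 2), g x :=
          intervalIntegral.integral_nonneg (by linarith [hσ.2]) fun x _ => sq_nonneg _
        linarith
      rw [h3, ← h2] at h4
      have h5 : |K| * σ ^ (2 * γ) = σ * (|K| * σ ^ (2 * γ - 1)) := by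
        have : σ ^ (2 * γ) = σ ^ (2 * γ - 1) * σ := by
          rw [Real.rpow_sub_one hσ.1.ne']; field_simp [hσ.1.ne']
        rw [this]; ring
      rw [h5] at h1
      exact le_of_mul_le_mul_left (h4.trans h1) hσ.1
    have lim : Tendsto (fun σ : ℝ => |K| * σ ^ (2 * γ - 1)) (𝓝[>] 0) (𝓝 0) := by
      have : Tendsto (fun σ : ℝ => |K| * σ ^ (2 * γ - 1)) (𝓝 0)
          (𝓝 (|K| * (0 : ℝ) ^ (2 * γ - 1))) :=
        ((Real.continuousAt_rpow_const 0 _ (Or.inr (by linarith))).tendsto).const_mul _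
      rw [Real.zero_rpow (by linarith), mul_zero] at this
      exact this.mono_left nhdsWithin_le_nhds
    have h6 : (U (j + 1) - U j) ^ 2 ≤ 0 := by
      refine ge_of_tendsto lim ?_
      filter_upwards [Ioo_mem_nhdsGT hh] with σ hσ using bound σ hσ
    have h7 : (U (j + 1) - U j) ^ 2 = 0 := le_antisymm h6 (sq_nonneg _)
    have := pow_eq_zero_iff two_ne_zero |>.1 h7
    linarith
  funext j
  induction j using Int.induction_on with
  | zero => rfl
  | succ i ih => rw [step, ih]
  | pred i ih => rw [← ih, ← step, sub_add_cancel]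

theorem exists_fine_mesh {a : ℝ → ℝ} (hac : Continuous a) {a_lo a_hi : ℝ} (h0 : 0 < a_lo)
    (ha : ∀ x, a_lo ≤ a x ∧ a x ≤ a_hi) {T : ℝ} (hT : 0 < T) {η : ℝ} (hη : 0 < η) :
    ∃ n N h k, IsMesh a T n N h k ∧ h ≤ η := by
  obtain ⟨n, h, hh, hn, hle, -⟩ := exists_mesh_size (lt_min hη hT) (min_le_right η T)
  have hhi : 0 < a_hi := (h0.trans_le (ha 0).1).trans_le (ha 0).2
  set N := ⌈T * (4 * a_hi + 4) / h⌉₊ with hN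
  have hN0 : 0 < N := Nat.ceil_pos.2 (by positivity)
  have hNr : (0 : ℝ) < N := by exact_mod_cast hN0
  have h1 : T * (4 * a_hi + 4) / h ≤ N := Nat.le_ceil _
  refine ⟨n, N, h, T / N, ⟨hh, by positivity, hn, by field_simp, fun j => ?_⟩,
    hle.trans (min_le_left _ _)⟩
  have hA := cellMean_mem_bounds hac ha hh j
  have h2 : max (2 * cellMean h a j + 1) (cellMean h a j / 4 + 5 / 4) ≤ 2 * a_hi + 2 :=
    max_le (by linarith) (by linarith)
  calc _ ≤ 2 * (T / N) * (2 * a_hi + 2) := by gcongr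
    _ = T * (4 * a_hi + 4) / N := by ring
    _ ≤ h := by
        rw [div_le_iff₀ hh] at h1
        rw [div_le_iff₀ hNr]
        linarith

namespace IsRegularSolution

variable {a : ℝ → ℝ} {T a_lo a_hi γ C K : ℝ} {u₀ v₀ : ℝ → ℝ} {u v : ℝ → ℝ → ℝ}

theorem cellMean_u (hT : 0 < T) (hs : IsRegularSolution a T a_lo a_hi γ C K u₀ v₀ u v) (h : ℝ) :
    cellMean h u₀ = cellMean h (u 0) :=
  (cellMean_congr_ae (hs.holder.pair_u.ae_eq_init hT) h).symm

theorem cellMean_v (hT : 0 < T) (h0 : 0 < a_lo) (ha : ∀ x, a_lo ≤ a x ∧ a x ≤ a_hi)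
    (hs : IsRegularSolution a T a_lo a_hi γ C K u₀ v₀ u v) (h : ℝ) :
    cellMean h v₀ = cellMean h (v 0) := by
  refine (cellMean_congr_ae ?_ h).symm
  filter_upwards [hs.holder.pair_v.ae_eq_init hT] with x hx
  have : 1 / a x ≠ 0 := one_div_ne_zero (h0.trans_le (ha x).1).ne'
  exact mul_left_cancel₀ this hx

/-- The spatial modulus is assumed at interior times only. A detour through a time r ≤ h costs, by
continuity in time, no more than the same power of h. -/
theorem sqNorm_init_sub_cellProj_le {w : ℝ → ℝ → ℝ} (hT : 0 < T) (hγ : 0 < γ) (hC : 0 ≤ C)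
    (hw : IsL2Curve T w) (hm : ∀ t ∈ Ioo 0 T, HasModulus γ K 0 (w t))
    (hH : ∀ s ∈ Icc 0 T, ∀ t ∈ Icc 0 T,
      sqNorm (fun x => w t x - w s x) ≤ C * |t - s| ^ (2 * γ))
    {n : ℕ} {h : ℝ} (hh : 0 < h) (hn : n * h = 2) (hn0 : 0 < n) :
    sqNorm (fun x => w 0 x - stepFn h (cellMean h (w 0)) x) ≤
      (6 * C + 8 * |K|) * h ^ (2 * γ) := by
  set r := min h (T / 2) with hr
  have hr0 : 0 < r := lt_min hh (by positivity)
  have hrT : r ∈ Ioo 0 T := ⟨hr0, (min_le_right _ _).trans_lt (by linarith)⟩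
  have m0 : (0 : ℝ) ∈ Icc 0 T := ⟨le_rfl, hT.le⟩
  have mr := Ioo_subset_Icc_self hrT
  have hcp := cellMean_periodic hn (hw.periodic 0 m0)
  have h1 := sqNorm_triangle (hw.loc 0 m0) (hw.loc r mr) (stepFn_isLocL2 hn0 h hcp)
  have h2 := sqNorm_sub_stepFn_le (hm r hrT) (hw.periodic r mr) (hw.loc r mr) hh hn hn0 hcp
  have h3 : cellSum n (fun j => h * (cellMean h (w 0) j - cellMean h (w r) j) ^ 2) ≤
      sqNorm (fun x => w 0 x - w r x) := by
    simp only [← cellMean_sub (hw.loc 0 m0) (hw.loc r mr)]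
    exact cellSum_sq_cellMean_le hh hn (fun x => by
      simp only [hw.periodic 0 m0 x, hw.periodic r mr x]) ((hw.loc 0 m0).sub (hw.loc r mr))
  have h4 := hH r mr 0 m0
  have h5 : C * |0 - r| ^ (2 * γ) ≤ C * h ^ (2 * γ) := by
    rw [zero_sub, abs_neg, abs_of_pos hr0]
    exact mul_le_mul_of_nonneg_left
      (Real.rpow_le_rpow hr0.le (min_le_left _ _) (by positivity)) hC
  have h6 : (6 * C + 8 * |K|) * h ^ (2 * γ) = 6 * (C * h ^ (2 * γ)) + 2 * (4 * |K| * h ^ (2 * γ)) := by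
    ring
  rw [h6]
  linarith

end IsRegularSolution

/-- Stability of constant states. -/
theorem exists_const_stability {T : ℝ} (hT : 0 < T) {a : ℝ → ℝ} {L α : ℝ≥0}
    (hL : HolderWith L α a) (hα : 0 < α) (hα1 : α ≤ 1)
    {a_lo a_hi : ℝ} (h0 : 0 < a_lo) (ha : ∀ x, a_lo ≤ a x ∧ a x ≤ a_hi) {γ : ℝ} (hγ : 0 < γ)
    (hγ1 : γ ≤ 1) (C K : ℝ) :
    ∃ M, 0 ≤ M ∧ ∀ u₀ v₀ u v, IsRegularSolution a T a_lo a_hi γ C K u₀ v₀ u v →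
      ∀ c d : ℝ, ∀ t ∈ Ioo 0 T,
        sqNorm (fun x => u t x - c) + sqNorm (fun x => v t x - d) ≤
        M * (sqNorm (fun x => u 0 x - c) + sqNorm (fun x => v 0 x - d)) := by
  have hα0 : (0 : ℝ) < α := hα
  have hs : 0 < min (1 / 2 : ℝ) α := lt_min (by norm_num) hα0
  obtain ⟨M, hM0, hM⟩ := exists_error_bound hT hL hα hα1 h0 ha hγ hγ1 C K hs (min_le_left _ _)
    (min_le_right _ _)
  refine ⟨M, hM0, fun u₀ v₀ u v hsol c d t ht => ?_⟩
  set r := 2 * (min (1 / 2 : ℝ) α * γ) with hr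
  have hr0 : 0 < r := by positivity
  set Y := sqNorm (fun x => u 0 x - c) + sqNorm (fun x => v 0 x - d) with hY
  have m0 : (0 : ℝ) ∈ Icc 0 T := ⟨le_rfl, hT.le⟩
  have bound : ∀ η ∈ Ioi (0 : ℝ), sqNorm (fun x => u t x - c) + sqNorm (fun x => v t x - d) ≤
      M * (Y + η ^ r) := by
    intro η hη
    obtain ⟨n, N, h, k, hm, hle⟩ := exists_fine_mesh (hL.continuous hα) h0 ha hT hη
    have hh := hm.dx_pos
    -- Constants solve the scheme on every mesh, so the mesh can be refined at will; the power of h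
    -- disappears in the limit. Any admissible positive s serves here, hence the minimum of 1/2 and
    -- α.
    have h1 := hM u₀ v₀ u v hsol n N h k hm _ _ (isGridSolution_const n h k _ c d) t ht
    refine h1.trans (mul_le_mul_of_nonneg_left (add_le_add ?_
      (Real.rpow_le_rpow hh.le hle hr0.le)) hM0)
    have key : ∀ {w : ℝ → ℝ → ℝ}, IsL2Curve T w → ∀ c : ℝ,
        cellSum n (fun j => h * (c - cellMean h (w 0) j) ^ 2) ≤ sqNorm (fun x => w 0 x - c) := by
      intro w hw c
      have h2 := cellSum_sq_cellMean_le hh hm.fill_space (f := fun x => w 0 x - c)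
        (fun x => by simp only [hw.periodic 0 m0 x]) ((hw.loc 0 m0).sub (IsLocL2.const c))
      refine le_trans (le_of_eq ?_) h2
      congr 1
      funext j
      rw [cellMean_sub (hw.loc 0 m0) (IsLocL2.const c), cellMean_const hh]
      ring
    unfold gridDist
    simp only [mul_add]
    rw [cellSum_add]
    exact add_le_add (key hsol.holder.curve_u c) (key hsol.holder.curve_v d)
  have lim : Tendsto (fun η : ℝ => M * (Y + η ^ r)) (𝓝[>] 0) (𝓝 (M * Y)) := by
    have : Tendsto (fun η : ℝ => M * (Y + η ^ r)) (𝓝 0) (𝓝 (M * (Y + (0 : ℝ) ^ r))) :=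
      (((Real.continuousAt_rpow_const 0 _ (Or.inr hr0.le)).tendsto).const_add _).const_mul _
    rw [Real.zero_rpow hr0.ne', add_zero] at this
    exact this.mono_left nhdsWithin_le_nhds
  refine ge_of_tendsto lim ?_
  filter_upwards [self_mem_nhdsWithin] with η hη using bound η hη

/-! ### The rate: two regimes of the exponents -/

/-- The convergence rate of the viscous centered scheme in squared norms. -/
theorem exists_scheme_rate {T : ℝ} (hT : 0 < T) {a : ℝ → ℝ} (hap : Function.Periodic a 2)
    {L α : ℝ≥0} (hL : HolderWith L α a) (hα : 0 < α) (hα1 : α ≤ 1)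
    {a_lo a_hi : ℝ} (h0 : 0 < a_lo) (ha : ∀ x, a_lo ≤ a x ∧ a x ≤ a_hi) {γ : ℝ} (hγ : 0 < γ)
    (hγ1 : γ ≤ 1) (C K : ℝ) :
    ∃ M, 0 ≤ M ∧ ∀ u₀ v₀ u v, Function.Periodic u₀ 2 → Function.Periodic v₀ 2 →
      IsRegularSolution a T a_lo a_hi γ C K u₀ v₀ u v →
      ∀ n N h k, IsMesh a T n N h k →
      (∀ t ∈ Ioo 0 T, HasModulus γ K (minScale α γ h) (uApprox a u₀ v₀ h k t) ∧
        HasModulus γ K (minScale α γ h) (vApprox a u₀ v₀ h k t)) →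
      ∀ t ∈ Ioo 0 T,
        sqNorm (fun x => u t x - uApprox a u₀ v₀ h k t x) +
          sqNorm (fun x => v t x - vApprox a u₀ v₀ h k t x) ≤
        M * h ^ (2 * (α * γ / (2 * (α * γ + 1 - γ)))) := by
  have hα0 : (0 : ℝ) < α := hα
  have hα1' : (α : ℝ) ≤ 1 := by exact_mod_cast hα1
  have hden : 0 < α * γ + 1 - γ := by nlinarith [mul_pos hα0 hγ]
  set s := (α : ℝ) / (2 * (α * γ + 1 - γ)) with hs
  have hs0 : 0 < s := by positivity
  have hs2 : s ≤ 1 / 2 := by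
    rw [hs, div_le_iff₀ (by positivity)]
    nlinarith [mul_nonneg (sub_nonneg.2 hα1') (sub_nonneg.2 hγ1)]
  have hexp : α * γ / (2 * (α * γ + 1 - γ)) = s * γ := by rw [hs]; ring
  rw [hexp]
  -- This inequality is equivalent to s ≤ α, the condition of `exists_error_bound` that is not
  -- automatic.
  by_cases hcase : γ * (1 - α) ≤ 1 / 2
  · have hsα : s ≤ α := by
      rw [hs, div_le_iff₀ (by positivity)]
      nlinarith
    obtain ⟨M, hM0, hM⟩ := exists_error_bound hT hL hα hα1 h0 ha hγ hγ1 C K hs0 hs2 hsα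
    refine ⟨M, hM0, fun u₀ v₀ u v hu hv hsol n N h k hm _ t ht => ?_⟩
    have h1 := hM u₀ v₀ u v hsol n N h k hm _ _
      (scheme_isGridSolution hap hu hv hm.fill_space k) t ht
    -- The scheme starts from the exact cell means, so the discrete initial error vanishes.
    have h2 : gridDist n h (scheme a u₀ v₀ h k 0).1 (scheme a u₀ v₀ h k 0).2
        (cellMean h (u 0)) (cellMean h (v 0)) = 0 := by
      simp only [scheme, hsol.cellMean_u hT h, hsol.cellMean_v hT h0 ha h, gridDist]
      simp [cellSum]
    rw [h2, zero_add] at h1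
    exact h1
  · obtain ⟨M, hM0, hM⟩ := exists_const_stability hT hL hα hα1 h0 ha hγ hγ1 C K
    have hγ2 : 1 / 2 < γ := by nlinarith [mul_pos hα0 hγ]
    refine ⟨M * (2 * (6 * |C| + 8 * |K|)) * 4, by positivity,
      fun u₀ v₀ u v hu hv hsol n N h k hm hmod t ht => ?_⟩
    have hh := hm.dx_pos
    have hk := hm.dt_pos
    have hn := hm.fill_space
    have hn0 := hm.nx_pos
    have hC := hsol.holder.nonneg
    have hscale : minScale α γ h = 0 := if_neg hcase
    simp only [hscale] at hmod
    -- The modulus of the approximations is available at positive times only. This time lies inside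
    -- the first step, where they still equal the initial step functions.
    have hr : min k T / 2 ∈ Ioo 0 T := by
      have := lt_min hk hT
      exact ⟨by positivity, by linarith [min_le_right k T]⟩
    have hfl : ⌊min k T / 2 / k⌋₊ = 0 := by
      rw [Nat.floor_eq_zero, div_lt_one hk]
      linarith [min_le_left k T]
    have hmod0 := hmod _ hr
    have eu : uApprox a u₀ v₀ h k (min k T / 2) = stepFn h (cellMean h u₀) := by
      funext x; simp only [uApprox, hfl, scheme, stepFn]
    have ev : vApprox a u₀ v₀ h k (min k T / 2) = stepFn h (cellMean h v₀) := by
      funext x; simp only [vApprox, hfl, scheme, stepFn]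
    rw [eu, ev] at hmod0
    have cu := hmod0.1.stepFn_const hγ2 (cellMean_periodic hn hu) hh hn hn0
    have cv := hmod0.2.stepFn_const hγ2 (cellMean_periodic hn hv) hh hn hn0
    set c := cellMean h u₀ 0 with hc
    set d := cellMean h v₀ 0 with hd
    have eut : (fun x => u t x - uApprox a u₀ v₀ h k t x) = fun x => u t x - c := by
      funext x; simp only [uApprox, scheme_const cu cv]
    have evt : (fun x => v t x - vApprox a u₀ v₀ h k t x) = fun x => v t x - d := by
      funext x; simp only [vApprox, scheme_const cu cv]
    rw [eut, evt]
    have bu := IsRegularSolution.sqNorm_init_sub_cellProj_le hT hγ hC hsol.holder.curve_u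
      hsol.modulus_u hsol.holder.holder_u hh hn hn0
    have bv := IsRegularSolution.sqNorm_init_sub_cellProj_le hT hγ hC hsol.holder.curve_v
      hsol.modulus_v hsol.holder.holder_v hh hn hn0
    rw [← hsol.cellMean_u hT h, cu] at bu
    rw [← hsol.cellMean_v hT h0 ha h, cv] at bv
    simp only [stepFn] at bu bv
    -- In this regime the rate is h^γ, better than required because s ≤ 1/2; the factor 4 covers 1 <
    -- h ≤ 2.
    have hpow : h ^ (2 * γ) ≤ 4 * h ^ (2 * (s * γ)) := by
      have e : h ^ (2 * γ) = h ^ (2 * (1 - s) * γ) * h ^ (2 * (s * γ)) := by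
        rw [← Real.rpow_add hh]; congr 1; ring
      have hle : 2 * (1 - s) * γ ≤ 2 := by nlinarith
      have hge : 0 ≤ 2 * (1 - s) * γ := mul_nonneg (by linarith) hγ.le
      rw [e]
      refine mul_le_mul_of_nonneg_right ?_ (by positivity)
      calc h ^ (2 * (1 - s) * γ) ≤ 2 ^ (2 * (1 - s) * γ) := Real.rpow_le_rpow hh.le hm.dx_le hge
        _ ≤ 2 ^ (2 : ℝ) := Real.rpow_le_rpow_of_exponent_le (by norm_num) hle
        _ = 4 := by norm_num
    rw [abs_of_nonneg hC]
    calc _ ≤ M * _ := hM u₀ v₀ u v hsol c d t ht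
      _ ≤ M * (2 * (6 * C + 8 * |K|) * h ^ (2 * γ)) := by
          refine mul_le_mul_of_nonneg_left ?_ hM0
          linarith
      _ ≤ M * (2 * (6 * C + 8 * |K|) * (4 * h ^ (2 * (s * γ)))) := by gcongr
      _ = _ := by ring

/-! ### Weak solutions -/

/-- `exists_time_holder` is used twice: with weight 1 for u_t = v_x and with weight 1/a for (v/a)_t
= u_x. Its constants are uniform in the solution, hence so is C. -/
theorem IsWeakSolution.exists_isRegularSolution {T : ℝ} (hT : 0 < T) {a : ℝ → ℝ}
    (hap : Function.Periodic a 2) (hac : Continuous a) {a_lo a_hi : ℝ} (h0 : 0 < a_lo)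
    (ha : ∀ x, a_lo ≤ a x ∧ a x ≤ a_hi) {γ : ℝ} (hγ : 0 < γ) (K : ℝ) :
    ∃ C, ∀ u₀ v₀ u v, IsPeriodicL2 u₀ → IsPeriodicL2 v₀ → IsWeakSolution a T u₀ v₀ u v →
      (∀ t ∈ Ioo 0 T, HasModulus γ K 0 (u t) ∧ HasModulus γ K 0 (v t)) →
      IsRegularSolution a T a_lo a_hi γ C K u₀ v₀ u v := by
  have hpos : ∀ x, 0 < a x := fun x => h0.trans_le (ha x).1
  have hhi : 0 < a_hi := (hpos 0).trans_le (ha 0).2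
  have hb : ∀ x, 1 / a_hi ≤ 1 / a x ∧ 1 / a x ≤ 1 / a_lo := fun x =>
    ⟨one_div_le_one_div_of_le (hpos x) (ha x).2, one_div_le_one_div_of_le h0 (ha x).1⟩
  have hbm : AEStronglyMeasurable (fun x => 1 / a x) volume :=
    (continuous_const.div hac fun x => (hpos x).ne').aestronglyMeasurable
  have hbp : Function.Periodic (fun x => 1 / a x) 2 := fun x => by simp only [hap x]
  have hbabs : ∀ x, |1 / a x| ≤ 1 / a_lo := fun x => by
    rw [abs_of_pos (one_div_pos.2 (hpos x))]; exact (hb x).2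
  obtain ⟨C₁, hC₁, H₁⟩ := exists_time_holder (b_hi := 1) hT (b_lo := 1) one_pos hγ K
  obtain ⟨C₂, hC₂, H₂⟩ := exists_time_holder (b_hi := 1 / a_lo) hT (one_div_pos.2 hhi) hγ K
  refine ⟨max C₁ C₂, fun u₀ v₀ u v hu hv hw hm => ?_⟩
  have cu := hw.continuous_u.isL2Curve
  have cv := hw.continuous_v.isL2Curve
  have pu : IsWeakPair T u₀ u v := ⟨cu, cv, hu.isLocL2, hu.1, hw.eq_u⟩
  have pv : IsWeakPair T (fun x => 1 / a x * v₀ x) (fun t x => 1 / a x * v t x) u := by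
    refine ⟨cv.mul hbm hbp hbabs, cu, hv.isLocL2.mul_bound hbm hbabs,
      fun x => by simp only [hap x, hv.1 x], fun φ hφ => ?_⟩
    simp only [one_div_mul_eq_div]
    exact hw.eq_v φ hφ
  refine ⟨⟨pu, pv, one_div_pos.2 hhi, hb, hC₁.trans (le_max_left _ _), fun s hs t ht => ?_,
    fun s hs t ht => ?_⟩, fun t ht => (hm t ht).1, fun t ht => (hm t ht).2⟩
  · refine (H₁ (fun _ => 1) (fun _ => ⟨le_rfl, le_rfl⟩) u₀ u v (by simpa only [one_mul] using pu) cu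
      (fun t ht => (hm t ht).1) (fun t ht => (hm t ht).2) s hs t ht).trans ?_
    gcongr
    exact le_max_left _ _
  · refine (H₂ (fun x => 1 / a x) hb _ v u pv cv
      (fun t ht => (hm t ht).2) (fun t ht => (hm t ht).1) s hs t ht).trans ?_
    gcongr
    exact le_max_right _ _

theorem norm2_nonneg (f : ℝ → ℝ) : 0 ≤ norm2 f := Real.sqrt_nonneg _

theorem norm2_div_le {a : ℝ → ℝ} (hac : Continuous a) {a_lo : ℝ} (h0 : 0 < a_lo)
    (ha : ∀ x, a_lo ≤ a x) {f : ℝ → ℝ} (hf : IsLocL2 f) :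
    norm2 (fun x => f x / a x) ≤ 1 / a_lo * norm2 f := by
  have hpos : ∀ x, 0 < a x := fun x => h0.trans_le (ha x)
  have hb : ∀ x, |1 / a x| ≤ 1 / a_lo := fun x => by
    rw [abs_of_pos (one_div_pos.2 (hpos x))]; exact one_div_le_one_div_of_le h0 (ha x)
  have hbm : AEStronglyMeasurable (fun x => 1 / a x) volume :=
    (continuous_const.div hac fun x => (hpos x).ne').aestronglyMeasurable
  have e : (fun x => f x / a x) = fun x => 1 / a x * f x := by
    funext x; rw [one_div_mul_eq_div]
  have h1 := sqNorm_mono (hf.mul_bound hbm hb) hf ((1 / a_lo) ^ 2) fun x => by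
    rw [mul_pow]
    refine mul_le_mul_of_nonneg_right ?_ (sq_nonneg _)
    rw [← sq_abs]
    exact pow_le_pow_left₀ (abs_nonneg _) (hb x) 2
  rw [e, norm2_eq_sqrt, norm2_eq_sqrt]
  calc _ ≤ Real.sqrt ((1 / a_lo) ^ 2 * sqNorm f) := Real.sqrt_le_sqrt h1
    _ = 1 / a_lo * Real.sqrt (sqNorm f) := by
        rw [Real.sqrt_mul (sq_nonneg _), Real.sqrt_sq (by positivity)]

theorem errorAt_nonneg (a u₀ v₀ : ℝ → ℝ) (h k t : ℝ) (p q : ℝ → ℝ) :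
    0 ≤ errorAt a u₀ v₀ h k t p q :=
  add_nonneg (norm2_nonneg _) (norm2_nonneg _)

end Wave1D

end

/-! ### The error estimate and convergence -/

theorem theorem3p2
    (α : ℝ≥0) (hα : 0 < α) (hα1 : α ≤ 1)
    (γ : ℝ) (hγ : 0 < γ) (hγ1 : γ ≤ 1)
    (T : ℝ) (hT : 0 < T)
    (a : ℝ → ℝ) (ha_per : Function.Periodic a 2)
    (ha_holder : ∃ L : ℝ≥0, HolderWith L α a)
    (a_lo a_hi : ℝ) (ha_lo : 0 < a_lo) (ha : ∀ x, a_lo ≤ a x ∧ a x ≤ a_hi)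
    (K : ℝ) :
    ∃ C : ℝ, ∀ u₀ v₀ : ℝ → ℝ, Wave1D.IsPeriodicL2 u₀ → Wave1D.IsPeriodicL2 v₀ →
      ∀ u v : ℝ → ℝ → ℝ, Wave1D.IsWeakSolution a T u₀ v₀ u v →
      (∀ t ∈ Ioo 0 T, Wave1D.HasModulus γ K 0 (u t) ∧ Wave1D.HasModulus γ K 0 (v t)) →
      (∀ (Nx N : ℕ) (Δx Δt : ℝ), Wave1D.IsMesh a T Nx N Δx Δt →
        (∀ t ∈ Ioo 0 T,
          Wave1D.HasModulus γ K (Wave1D.minScale α γ Δx) (Wave1D.uApprox a u₀ v₀ Δx Δt t) ∧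
          Wave1D.HasModulus γ K (Wave1D.minScale α γ Δx) (Wave1D.vApprox a u₀ v₀ Δx Δt t)) →
        ∀ t ∈ Ioo 0 T,
          Wave1D.errorAt a u₀ v₀ Δx Δt t (u t) (v t) ≤
            C * (Wave1D.errorAt a u₀ v₀ Δx Δt 0 u₀ v₀ +
              Δx ^ ((α * γ) / (2 * (α * γ + 1 - γ))))) ∧
      (∀ (Nx N : ℕ → ℕ) (Δx Δt : ℕ → ℝ), (∀ k, Wave1D.IsMesh a T (Nx k) (N k) (Δx k) (Δt k)) →
        Tendsto Δx atTop (𝓝 0) →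
        (∀ k, ∀ t ∈ Ioo 0 T,
          Wave1D.HasModulus γ K (Wave1D.minScale α γ (Δx k))
            (Wave1D.uApprox a u₀ v₀ (Δx k) (Δt k) t) ∧
          Wave1D.HasModulus γ K (Wave1D.minScale α γ (Δx k))
            (Wave1D.vApprox a u₀ v₀ (Δx k) (Δt k) t)) →
        ∀ t ∈ Ioo 0 T,
          Tendsto (fun k => Wave1D.norm2 (fun x => u t x - Wave1D.uApprox a u₀ v₀ (Δx k) (Δt k) t x))
            atTop (𝓝 0) ∧
          Tendsto (fun k => Wave1D.norm2 (fun x => v t x - Wave1D.vApprox a u₀ v₀ (Δx k) (Δt k) t x))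
            atTop (𝓝 0)) := by
  obtain ⟨L, hL⟩ := ha_holder
  have hac := hL.continuous hα
  obtain ⟨C₀, hreg⟩ := Wave1D.IsWeakSolution.exists_isRegularSolution hT ha_per hac ha_lo ha hγ K
  obtain ⟨M, hM0, hM⟩ := Wave1D.exists_scheme_rate hT ha_per hL hα hα1 ha_lo ha hγ hγ1 C₀ K
  have hα0 : (0 : ℝ) < α := hα
  have hden : 0 < α * γ + 1 - γ := by nlinarith [mul_pos hα0 hγ]
  set q := α * γ / (2 * (α * γ + 1 - γ)) with hq
  have hq0 : 0 < q := by positivity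
  -- The root comes from passing from squared norms to norms, and 1/a_lo from dividing the second
  -- component by a. The power of Δx alone already bounds the error; the initial error only enlarges
  -- the right-hand side.
  refine ⟨(1 + 1 / a_lo) * Real.sqrt M, fun u₀ v₀ hu hv u v hw hm => ?_⟩
  have hsol := hreg u₀ v₀ u v hu hv hw hm
  have rate : ∀ n N h k, Wave1D.IsMesh a T n N h k →
      (∀ t ∈ Ioo 0 T, Wave1D.HasModulus γ K (Wave1D.minScale α γ h) (Wave1D.uApprox a u₀ v₀ h k t) ∧
        Wave1D.HasModulus γ K (Wave1D.minScale α γ h) (Wave1D.vApprox a u₀ v₀ h k t)) →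
      ∀ t ∈ Ioo 0 T,
        Wave1D.norm2 (fun x => u t x - Wave1D.uApprox a u₀ v₀ h k t x) ≤ Real.sqrt M * h ^ q ∧
        Wave1D.norm2 (fun x => v t x - Wave1D.vApprox a u₀ v₀ h k t x) ≤ Real.sqrt M * h ^ q := by
    intro n N h k hmesh hmod t ht
    have h1 := hM u₀ v₀ u v hu.1 hv.1 hsol n N h k hmesh hmod t ht
    have hh := hmesh.dx_pos
    have e : Real.sqrt M * h ^ q = Real.sqrt (M * h ^ (2 * q)) := by
      rw [Real.sqrt_mul hM0, mul_comm 2 q, Real.rpow_mul hh.le, Real.rpow_two,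
        Real.sqrt_sq (by positivity)]
    rw [e]
    exact ⟨Real.sqrt_le_sqrt (le_trans (le_add_of_nonneg_right (Wave1D.sqNorm_nonneg _)) h1),
      Real.sqrt_le_sqrt (le_trans (le_add_of_nonneg_left (Wave1D.sqNorm_nonneg _)) h1)⟩
  refine ⟨fun Nx N h k hmesh hmod t ht => ?_, fun Nx N Δx Δt hmesh hlim hmod t ht => ?_⟩
  · obtain ⟨r1, r2⟩ := rate Nx N h k hmesh hmod t ht
    have hloc : Wave1D.IsLocL2 (fun x => v t x - Wave1D.vApprox a u₀ v₀ h k t x) :=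
      (hsol.holder.curve_v.loc t (Ioo_subset_Icc_self ht)).sub
        (Wave1D.stepFn_isLocL2 hmesh.nx_pos h
          ((Wave1D.scheme_isGridSolution ha_per hu.1 hv.1 hmesh.fill_space k).periodic_v _))
    have r3 := Wave1D.norm2_div_le hac ha_lo (fun x => (ha x).1) hloc
    have r4 := Wave1D.errorAt_nonneg a u₀ v₀ h k 0 u₀ v₀
    have hC : 0 ≤ (1 + 1 / a_lo) * Real.sqrt M := by positivity
    calc Wave1D.errorAt a u₀ v₀ h k t (u t) (v t)
        ≤ Real.sqrt M * h ^ q + 1 / a_lo * (Real.sqrt M * h ^ q) :=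
          add_le_add r1 (r3.trans (mul_le_mul_of_nonneg_left r2 (by positivity)))
      _ = (1 + 1 / a_lo) * Real.sqrt M * h ^ q := by ring
      _ ≤ _ := mul_le_mul_of_nonneg_left (le_add_of_nonneg_left r4) hC
  · have lim : Tendsto (fun k => Real.sqrt M * Δx k ^ q) atTop (𝓝 0) := by
      have := ((Real.continuousAt_rpow_const 0 q (Or.inr hq0.le)).tendsto.comp hlim).const_mul
        (Real.sqrt M)
      rwa [Real.zero_rpow hq0.ne', mul_zero] at this
    exact ⟨squeeze_zero (fun k => Wave1D.norm2_nonneg _)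
        (fun k => (rate _ _ _ _ (hmesh k) (hmod k) t ht).1) lim,
      squeeze_zero (fun k => Wave1D.norm2_nonneg _)
        (fun k => (rate _ _ _ _ (hmesh k) (hmod k) t ht).2) lim⟩
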